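/- **Model.** For each sample size $n$ let $d=d_n$, $\mu^\star\in\mathbb R^{d}$ and a positive definite $\Sigma^\star\in\mathbb R^{d\times d}$ be given (all may depend on $n$), and let $(x_i,y_i^\star)_{i=1}^n\subseteq\mathbb R^d\times\{\pm1\}$ be i.i.d. with $\mathbb P(y_i^\star=1)=\mathbb P(y_i^\star=-1)=1/2$ and $x_i\mid y_i^\star\sim N(y_i^\star\mu^\star,\Sigma^\star)$. Put $\mathrm{SNR}=\mu^{\star\top}\Sigma^{\star-1}\mu^\star$ and let $X=(x_1,\dots,x_n)^\top\in\mathbb R^{n\times d}$ be the data matrix. Let $\mathrm{sgn}(t)=1$ for $t\ge 0$ and $-1$ otherwise, applied entrywise to vectors. For $\widehat y\in\{\pm1\}^n$ let $$\mathcal R(\widehat y,y^\star)=n^{-1}\min_{s=\pm1}\bigl|\{i\in[n]:\ s\,\widehat y_i\ne y_i^\star\}\bigr| .$$ **Spectral initialization.** Let $W=\sqrt n\,X(X^\top X)^{-1/2}$ have rows $w_1^\top,\dots,w_n^\top$, let $S=\frac1n\sum_{i=1}^n(\|w_i\|_2^2-d)\,w_iw_i^\top$, let $v$ be a unit eigenvector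 of $S$ associated with its smallest eigenvalue, and let $\widehat y^{\mathrm{spec}}=\mathrm{sgn}(Wv)$. **Projected power iteration.** Let $H=X(X^\top X)^{-1}X^\top$ and $T=4\lceil\log_2 n\rceil+4$. Starting from $y^0=\widehat y^{\mathrm{spec}}$, let $y^{t+1}=\mathrm{sgn}(Hy^t)$ for $0\le t<T$, and let $\widehat y^{\mathrm{PPI}}=y^T$. **Statement.** Assume that $n/(d^2\log^3 n)\to\infty$ as $n\to\infty$. For every measurable choice of the output $\widehat y^{\mathrm{PPI}}$ (that is, however the eigenvector $v$ is chosen, in particular whatever its sign), the following hold. 1. If $\mathrm{SNR}\to\infty$ and $\mathrm{SNR}\le C\log n$ for all large $n$, for some constant $C$, then $\mathbb E\,\mathcal R(\widehat y^{\mathrm{PPI}},y^\star)\le e^{-\mathrm{SNR}/[2+o(1)]}$; that is, there is a deterministic sequence $\delta_n\to0$ such that $\mathbb E\,\mathcal R(\widehat y^{\mathrm{PPI}},y^\star)\le e^{-\mathrm{SNR}/(2+\delta_n)}$ for all large $n$. 2. If $\mathrm{SNR}\ge(2+\varepsilon)\log n$ for all large $n$, for some constant $\varepsilon>0$, then the labels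 are exactly recovered up to a global sign with probability $1-o(1)$: $\mathbb P\bigl(\mathcal R(\widehat y^{\mathrm{PPI}},y^\star)=0\bigr)=1-o(1)$. -/

import Mathlib

open MeasureTheory ProbabilityTheory Filter Topology

noncomputable section

/-- The sign function with the convention `sgn 0 = 1`. -/
def sgn (t : ℝ) : ℝ := if 0 ≤ t then 1 else -1

/-- The joint law of `(x, y)` with `ℙ(y = 1) = ℙ(y = -1) = 1/2` and
`x ∣ y ∼ N(y μ, Σ)`. -/
def mixtureLaw {d : ℕ} (μ : EuclideanSpace ℝ (Fin d)) (Sig : Matrix (Fin d) (Fin d) ℝ) :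
    Measure (EuclideanSpace ℝ (Fin d) × ℝ) :=
  (2⁻¹ : ENNReal) • ((multivariateGaussian μ Sig).prod (Measure.dirac 1)) +
    (2⁻¹ : ENNReal) • ((multivariateGaussian (-μ) Sig).prod (Measure.dirac (-1)))

/-- The random pairs `(x i, y i)`, `i < n`, are i.i.d. samples of the mixture model. -/
structure IsMixtureSample {Ω : Type*} [MeasurableSpace Ω] (P : Measure Ω) {n d : ℕ}
    (μ : EuclideanSpace ℝ (Fin d)) (Sig : Matrix (Fin d) (Fin d) ℝ)
    (x : Fin n → Ω → EuclideanSpace ℝ (Fin d)) (y : Fin n → Ω → ℝ) : Prop where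
  indep : iIndepFun (fun i ω => (x i ω, y i ω)) P
  law : ∀ i, HasLaw (fun ω => (x i ω, y i ω)) (mixtureLaw μ Sig) P

/-- The signal-to-noise ratio `μᵀ Σ⁻¹ μ`. -/
def snr {d : ℕ} (μ : EuclideanSpace ℝ (Fin d)) (Sig : Matrix (Fin d) (Fin d) ℝ) : ℝ :=
  μ.ofLp ⬝ᵥ (Sig⁻¹).mulVec μ.ofLp

/-- The data matrix, whose rows are the samples. -/
def dataMatrix {n d : ℕ} (x : Fin n → EuclideanSpace ℝ (Fin d)) : Matrix (Fin n) (Fin d) ℝ :=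
  Matrix.of fun i j => x i j

/-- The misclassification proportion `n⁻¹ min_{s = ±1} #{i : s ŷ_i ≠ y_i}`. -/
def misclass {n : ℕ} (yhat y : Fin n → ℝ) : ℝ :=
  (min (Finset.univ.filter fun i => yhat i ≠ y i).card
    (Finset.univ.filter fun i => -yhat i ≠ y i).card : ℕ) / (n : ℝ)

/-- One step `y ↦ sgn (H y)` of the projected power iteration, `H = X (Xᵀ X)⁻¹ Xᵀ`. -/
def ppiStep {n d : ℕ} (X : Matrix (Fin n) (Fin d) ℝ) (y : Fin n → ℝ) : Fin n → ℝ :=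
  fun i => sgn ((X * (X.transpose * X)⁻¹ * X.transpose).mulVec y i)

/-- The output of the projected power iteration: `T = 4 ⌈log₂ n⌉ + 4` steps from `y0`. -/
def ppi {n d : ℕ} (X : Matrix (Fin n) (Fin d) ℝ) (y0 : Fin n → ℝ) : Fin n → ℝ :=
  (ppiStep X)^[4 * ⌈Real.logb 2 n⌉₊ + 4] y0

open scoped MatrixOrder in
/-- The whitened data matrix `W = √n X (Xᵀ X)^{-1/2}`. -/
def whiten {n d : ℕ} (X : Matrix (Fin n) (Fin d) ℝ) : Matrix (Fin n) (Fin d) ℝ :=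
  Real.sqrt n • (X * CFC.sqrt (X.transpose * X)⁻¹)

/-- `S = n⁻¹ ∑ i, (‖w_i‖² - d) w_i w_iᵀ`, with `w_i` the `i`-th row of `W`. -/
def weightedCov {n d : ℕ} (W : Matrix (Fin n) (Fin d) ℝ) : Matrix (Fin d) (Fin d) ℝ :=
  (n : ℝ)⁻¹ • ∑ i, (W i ⬝ᵥ W i - (d : ℝ)) • Matrix.vecMulVec (W i) (W i)

/-- `v` is a unit eigenvector of `S` associated with its smallest eigenvalue. -/
def IsBottomEigenvector {d : ℕ} (S : Matrix (Fin d) (Fin d) ℝ) (v : Fin d → ℝ) : Prop :=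
  v ⬝ᵥ v = 1 ∧ ∃ l : ℝ,
    IsLeast {r : ℝ | Module.End.HasEigenvalue (Matrix.toLin' S) r} l ∧ S.mulVec v = l • v

/-- `y0` is an output of the spectral initialization on `X`, for some choice of the unit
eigenvector (which is unique at most up to its sign). -/
def IsSpectralOutput {n d : ℕ} (X : Matrix (Fin n) (Fin d) ℝ) (y0 : Fin n → ℝ) : Prop :=
  ∃ v : Fin d → ℝ, IsBottomEigenvector (weightedCov (whiten X)) v ∧
    y0 = fun i => sgn ((whiten X).mulVec v i)

/-- `yhat` is an output of the projected power iteration initialized by an output of the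
spectral initialization. -/
def IsTwoStageOutput {n d : ℕ} (X : Matrix (Fin n) (Fin d) ℝ) (yhat : Fin n → ℝ) : Prop :=
  ∃ y0 : Fin n → ℝ, IsSpectralOutput X y0 ∧ yhat = ppi X y0

end

/-! ### Moments of linear functionals of a standard Gaussian vector. -/

section GaussianMoments

open scoped RealInnerProductSpace

/-! Whiten by the population covariance. Put m = √SNR, let e be the unit vector along Σ^{-1/2}μ, and
let z_i = Σ^{-1/2}(y_i x_i − μ). The z_i are i.i.d. standard Gaussian, and every vector Xu has
entries y_i f_i(b) with f_i(b) = m⟪e,b⟫ + ⟪b,z_i⟫ for a linear image b of u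
(`IsMixtureSample.exists_whitened`). Both stages can be stated through such fits alone: a power step
takes signs of a least squares fit (`exists_ppiStep_eq`), and the spectral stage is a constrained
minimization over fits (`IsSpectralOutput.exists_fit`). The analysis is therefore deterministic on
an event of regular noise (`RegularNoise`), whatever the labels and the coordinates.

Spectral stage. Its output minimizes n⁻¹ ∑ (‖w_i‖² − d) f_i(b)² under ∑ f_i(b)² = n. Each ‖w_i‖² is
n times a leverage score and is uniformly close to its population value (`abs_leverage_sub_le`).
After subtracting d, that value is the centred chi-square term a_i = ‖z_i‖² − ⟪e,z_i⟫² − (d − 1)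
plus (m + ⟪e,z_i⟫)²/(1 + m²) − 1, which is mostly negligible for large m. Since a_i f_i(b)² has mean
2(‖b‖² − ⟪e,b⟫²), the objective charges only the part of b orthogonal to e. Comparison with the
direction e forces b to be nearly parallel to e, so all labels but a small fixed proportion are
right up to one global sign (`exists_sign_card_spectral_le`).

Iteration. If B is the current wrong set, the fit is the regression of 1 − 2·1_B. It differs from
its population target (m/(1 + m²)) e by an error of squared energy O(ε² + |B|σ/n)
(`energy_fit_sub_le`), where ε is the relative covariance error and σ bounds the share of second
moment carried by small subsets. A new error at i requires atypical noise ⟪e,z_i⟫ ≤ −(1 − δ)m or a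
residual of size at least δ/2, so |B'| ≤ N + O(ε²n/δ²) + |B|/4, with N the number of atypical
indices. After logarithmically many steps the errors are O(N + d log n).

Two regimes. For large n one has d log n ≤ √n. If SNR ≤ log n, the floor d log n / n ≤ n^{-1/2} is
below e^{-SNR/2} (`exists_twoStageBound`). If SNR ≥ log n, about n^{3/5} errors at most remain
before the last step; the residuals of that step are then below δ/2 uniformly in i, and all
remaining errors are atypical indices (`exists_twoStageBound_of_le_sq`). Since N has mean at most n
exp(−(1 − δ)² SNR/2), taking expectations and letting δ → 0 gives the first claim, and Markov's
inequality for N ≥ 1 gives the second.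

The condition on n says that q = d log n · √(log n / n) tends to 0. This is the order of the
leverage errors and of the fourth-moment fluctuations, for which weights of size √d log n meet
deviations of size √(d log n / n). -/

lemma integral_sq_exp_gaussianReal {b : ℝ} (hb : b < 1 / 2) :
    Integrable (fun x : ℝ => Real.exp (b * x ^ 2)) (gaussianReal 0 1) ∧
      ∫ x, Real.exp (b * x ^ 2) ∂(gaussianReal 0 1) = (√(1 - 2 * b))⁻¹ := by
  have hpdf : ∀ x : ℝ, gaussianPDFReal 0 1 x * Real.exp (b * x ^ 2) =
      (√(2 * Real.pi))⁻¹ * Real.exp (-(1 / 2 - b) * x ^ 2) := by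
    intro x
    rw [gaussianPDFReal, mul_assoc, ← Real.exp_add]
    simp only [NNReal.coe_one]
    congr 2
    · ring_nf
    · ring
  constructor
  · rw [gaussianReal_of_var_ne_zero _ one_ne_zero, integrable_withDensity_iff_integrable_smul']
    · have : (fun x : ℝ => (gaussianPDF 0 1 x).toReal • Real.exp (b * x ^ 2)) =
          fun x => (√(2 * Real.pi))⁻¹ * Real.exp (-(1 / 2 - b) * x ^ 2) := by
        ext x; rw [toReal_gaussianPDF, smul_eq_mul, hpdf]
      rw [this]
      exact (integrable_exp_neg_mul_sq (by linarith)).const_mul _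
    · exact measurable_gaussianPDF 0 1
    · exact ae_of_all _ fun x => gaussianPDF_lt_top
  · rw [integral_gaussianReal_eq_integral_smul one_ne_zero]
    simp only [smul_eq_mul, hpdf]
    rw [integral_const_mul, integral_gaussian, ← Real.sqrt_inv, ← Real.sqrt_inv, ← Real.sqrt_mul (by positivity)]
    congr 1
    have := Real.pi_pos
    have : (1 : ℝ) / 2 - b ≠ 0 := by linarith
    have : (1 : ℝ) - 2 * b ≠ 0 := by linarith
    field_simp
    

/-- The moments are derivatives at 0 of the moment generating function exp(t²/2). Differentiation
keeps the shape polynomial times exp(t²/2), which `hd` records. -/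
lemma integral_pow_gaussianReal :
    ∫ x, x ^ 2 ∂(gaussianReal 0 1) = 1 ∧ ∫ x, x ^ 4 ∂(gaussianReal 0 1) = 3 := by
  have h0 : (0 : ℝ) ∈ interior (integrableExpSet id (gaussianReal 0 1)) := by
    simp [integrableExpSet_id_gaussianReal]
  have hm := fun k => iteratedDeriv_mgf_zero h0 k
  have e0 : mgf id (gaussianReal 0 1) = fun t => Real.exp (t ^ 2 / 2) := by
    rw [mgf_id_gaussianReal]; ext t; simp
  have hd : ∀ (p : ℝ → ℝ) (p' : ℝ → ℝ), (∀ t, HasDerivAt p (p' t) t) →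
      deriv (fun t => p t * Real.exp (t ^ 2 / 2)) =
        fun t => (p' t + p t * t) * Real.exp (t ^ 2 / 2) := by
    intro p p' h
    ext t
    have h2 : HasDerivAt (fun t : ℝ => Real.exp (t ^ 2 / 2)) (Real.exp (t ^ 2 / 2) * t) t := by
      have := ((hasDerivAt_pow 2 t).div_const 2).exp
      convert this using 1
      ring
    rw [((h t).fun_mul h2).deriv]; ring
  have e1 : iteratedDeriv 1 (mgf id (gaussianReal 0 1)) = fun t => t * Real.exp (t ^ 2 / 2) := by
    rw [iteratedDeriv_one, e0]
    have := hd (fun _ => 1) (fun _ => 0) (fun t => hasDerivAt_const t 1)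
    simpa using this
  have e2 : iteratedDeriv 2 (mgf id (gaussianReal 0 1)) =
      fun t => (1 + t ^ 2) * Real.exp (t ^ 2 / 2) := by
    rw [iteratedDeriv_succ, e1, hd (fun t => t) (fun _ => 1) (fun t => hasDerivAt_id t)]
    ext t; ring
  have e3 : iteratedDeriv 3 (mgf id (gaussianReal 0 1)) =
      fun t => (3 * t + t ^ 3) * Real.exp (t ^ 2 / 2) := by
    rw [iteratedDeriv_succ, e2, hd (fun t => 1 + t ^ 2) (fun t => 2 * t)
      (fun t => by simpa using (hasDerivAt_pow 2 t).const_add 1)]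
    ext t; ring
  have e4 : iteratedDeriv 4 (mgf id (gaussianReal 0 1)) =
      fun t => (3 + 6 * t ^ 2 + t ^ 4) * Real.exp (t ^ 2 / 2) := by
    rw [iteratedDeriv_succ, e3, hd (fun t => 3 * t + t ^ 3) (fun t => 3 + 3 * t ^ 2)
      (fun t => by simpa using ((hasDerivAt_id t).const_mul 3).fun_add (hasDerivAt_pow 3 t))]
    ext t; ring
  constructor
  · have := hm 2
    rw [e2] at this
    simpa using this.symm
  · have := hm 4
    rw [e4] at this
    simpa using this.symm

variable {E : Type*} [NormedAddCommGroup E] [InnerProductSpace ℝ E] [FiniteDimensional ℝ E]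
  [MeasurableSpace E] [BorelSpace E]

lemma map_inner_stdGaussian (v : E) :
    (stdGaussian E).map (fun z => ⟪v, z⟫) = (gaussianReal 0 1).map (fun x => ‖v‖ * x) := by
  have h := IsGaussian.map_eq_gaussianReal (μ := stdGaussian E) (innerSL ℝ v)
  rw [integral_strongDual_stdGaussian, variance_dual_stdGaussian, innerSL_apply_norm] at h
  rw [gaussianReal_map_const_mul]
  convert h using 2
  · rfl
  · rw [mul_zero]
  · rw [mul_one]
    exact (Real.toNNReal_of_nonneg (sq_nonneg ‖v‖)).symm

lemma integral_comp_inner_stdGaussian (v : E) {g : ℝ → ℝ} (hg : Measurable g) :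
    ∫ z, g ⟪v, z⟫ ∂(stdGaussian E) = ∫ x, g (‖v‖ * x) ∂(gaussianReal 0 1) := by
  have h1 : ∫ z, g ⟪v, z⟫ ∂(stdGaussian E) = ∫ x, g x ∂((stdGaussian E).map (fun z => ⟪v, z⟫)) := by
    rw [integral_map (by fun_prop) hg.aestronglyMeasurable]
  rw [h1, map_inner_stdGaussian, integral_map (by fun_prop) hg.aestronglyMeasurable]

lemma integrable_comp_inner_stdGaussian (v : E) {g : ℝ → ℝ} (hg : Measurable g) :
    Integrable (fun z => g ⟪v, z⟫) (stdGaussian E) ↔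
      Integrable (fun x => g (‖v‖ * x)) (gaussianReal 0 1) := by
  have h1 := integrable_map_measure (f := fun z : E => ⟪v, z⟫) (μ := stdGaussian E)
    hg.aestronglyMeasurable (by fun_prop)
  have h2 := integrable_map_measure (f := fun x : ℝ => ‖v‖ * x) (μ := gaussianReal 0 1)
    hg.aestronglyMeasurable (by fun_prop)
  rw [map_inner_stdGaussian] at h1
  exact h1.symm.trans h2

lemma integral_exp_inner_sq_le {v : E} (hv : ‖v‖ ≤ 1) {b : ℝ} (hb0 : 0 ≤ b) (hb : b < 1 / 2) :
    Integrable (fun z => Real.exp (b * ⟪v, z⟫ ^ 2)) (stdGaussian E) ∧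
      ∫ z, Real.exp (b * ⟪v, z⟫ ^ 2) ∂(stdGaussian E) ≤ (√(1 - 2 * b))⁻¹ := by
  have hm : Measurable (fun x : ℝ => Real.exp (b * x ^ 2)) := by fun_prop
  obtain ⟨hi, he⟩ := integral_sq_exp_gaussianReal hb
  have hle : ∀ x : ℝ, Real.exp (b * (‖v‖ * x) ^ 2) ≤ Real.exp (b * x ^ 2) := by
    intro x
    apply Real.exp_le_exp.2
    apply mul_le_mul_of_nonneg_left _ hb0
    rw [mul_pow]
    have : ‖v‖ ^ 2 ≤ 1 := pow_le_one₀ (norm_nonneg _) hv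
    nlinarith [sq_nonneg x]
  have hi2 : Integrable (fun x : ℝ => Real.exp (b * (‖v‖ * x) ^ 2)) (gaussianReal 0 1) := by
    refine hi.mono' (by fun_prop) (ae_of_all _ fun x => ?_)
    rw [Real.norm_eq_abs, abs_of_pos (Real.exp_pos _)]
    exact hle x
  refine ⟨(integrable_comp_inner_stdGaussian v hm).2 hi2, ?_⟩
  rw [integral_comp_inner_stdGaussian v hm, ← he]
  exact integral_mono hi2 hi hle

lemma integrable_inner_pow (v : E) (k : ℕ) :
    Integrable (fun z => ⟪v, z⟫ ^ k) (stdGaussian E) := by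
  refine (integrable_comp_inner_stdGaussian v (g := fun x => x ^ k) (by fun_prop)).2 ?_
  simp only [mul_pow]
  refine Integrable.const_mul ?_ _
  have := (memLp_id_gaussianReal (μ := 0) (v := 1) (k : NNReal)).integrable_norm_pow'
  refine this.mono' (by fun_prop) (ae_of_all _ fun x => by simp)

lemma integral_inner_sq (v : E) : ∫ z, ⟪v, z⟫ ^ 2 ∂(stdGaussian E) = ‖v‖ ^ 2 := by
  rw [integral_comp_inner_stdGaussian v (g := fun x => x ^ 2) (by fun_prop)]
  simp only [mul_pow]
  rw [integral_const_mul, integral_pow_gaussianReal.1, mul_one]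

lemma integral_inner_pow_four (v : E) : ∫ z, ⟪v, z⟫ ^ 4 ∂(stdGaussian E) = 3 * ‖v‖ ^ 4 := by
  rw [integral_comp_inner_stdGaussian v (g := fun x => x ^ 4) (by fun_prop)]
  simp only [mul_pow]
  rw [integral_const_mul, integral_pow_gaussianReal.2, mul_comm]

lemma integral_odd_stdGaussian (g : E → ℝ) (hg : ∀ z, g (-z) = -g z) :
    ∫ z, g z ∂(stdGaussian E) = 0 := by
  have h := stdGaussian_map (LinearIsometryEquiv.neg ℝ (E := E))
  have h2 : ∫ z, g z ∂(stdGaussian E) = ∫ z, g (-z) ∂(stdGaussian E) := by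
    conv_lhs => rw [← h]
    exact integral_map_equiv (LinearIsometryEquiv.neg ℝ (E := E)).toHomeomorph.toMeasurableEquiv g
  simp only [hg, integral_neg] at h2
  linarith

lemma integrable_sq_mul_sq (e u : E) :
    Integrable (fun z => ⟪e, z⟫ ^ 2 * ⟪u, z⟫ ^ 2) (stdGaussian E) := by
  refine ((integrable_inner_pow e 4).add (integrable_inner_pow u 4)).mono' (by fun_prop)
    (ae_of_all _ fun z => ?_)
  rw [Real.norm_eq_abs, abs_of_nonneg (by positivity)]
  simp only [Pi.add_apply]
  nlinarith [sq_nonneg (⟪e, z⟫ ^ 2 - ⟪u, z⟫ ^ 2), sq_nonneg (⟪e, z⟫ ^ 2), sq_nonneg (⟪u, z⟫ ^ 2)]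

/-- Wick's formula by polarization: a²b² is a combination of fourth powers of a + b, a − b, a and b,
so one-dimensional fourth moments suffice. -/
lemma integral_sq_mul_sq (e u : E) :
    ∫ z, ⟪e, z⟫ ^ 2 * ⟪u, z⟫ ^ 2 ∂(stdGaussian E) = ‖e‖ ^ 2 * ‖u‖ ^ 2 + 2 * ⟪e, u⟫ ^ 2 := by
  have h : ∀ z : E, ⟪e, z⟫ ^ 2 * ⟪u, z⟫ ^ 2 =
      (1 / 12) * (⟪e + u, z⟫ ^ 4 + ⟪e - u, z⟫ ^ 4 - 2 * ⟪e, z⟫ ^ 4 - 2 * ⟪u, z⟫ ^ 4) := by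
    intro z; rw [inner_add_left, inner_sub_left]; ring
  simp only [h]
  have i1 := integrable_inner_pow (e + u) 4
  have i2 := integrable_inner_pow (e - u) 4
  have i3 := (integrable_inner_pow e 4).const_mul 2
  have i4 := (integrable_inner_pow u 4).const_mul 2
  have i12 : Integrable (fun z : E => ⟪e + u, z⟫ ^ 4 + ⟪e - u, z⟫ ^ 4) (stdGaussian E) := i1.add i2
  have i123 : Integrable (fun z : E => ⟪e + u, z⟫ ^ 4 + ⟪e - u, z⟫ ^ 4 - 2 * ⟪e, z⟫ ^ 4)
    (stdGaussian E) := i12.sub i3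
  rw [integral_const_mul, integral_sub i123 i4, integral_sub i12 i3,
    integral_add i1 i2, integral_const_mul, integral_const_mul]
  simp only [integral_inner_pow_four]
  have hp : ∀ w : E, ‖w‖ ^ 4 = (‖w‖ ^ 2) ^ 2 := fun w => by ring
  rw [hp (e + u), hp (e - u), norm_add_sq_real, norm_sub_sq_real]
  ring

lemma integrable_coord_mul (e : E) (c : ℝ) (u : E) :
    Integrable (fun z => (⟪e, z⟫ ^ 2 - 1) * (c + ⟪u, z⟫) ^ 2) (stdGaussian E) := by
  have h : (fun z : E => (⟪e, z⟫ ^ 2 - 1) * (c + ⟪u, z⟫) ^ 2) = fun z : E =>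
      c ^ 2 * ⟪e, z⟫ ^ 2 + 2 * c * (⟪e, z⟫ ^ 2 * ⟪u, z⟫) + ⟪e, z⟫ ^ 2 * ⟪u, z⟫ ^ 2 - 
        (c ^ 2 + 2 * c * ⟪u, z⟫ + ⟪u, z⟫ ^ 2) := by ext z; ring
  rw [h]
  have i0 : Integrable (fun z : E => ⟪u, z⟫) (stdGaussian E) := by
    simpa using integrable_inner_pow u 1
  have i1 : Integrable (fun z : E => ⟪e, z⟫ ^ 2 * ⟪u, z⟫) (stdGaussian E) := by
    refine ((integrable_sq_mul_sq e u).add (integrable_inner_pow e 2)).mono' (by fun_prop)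
      (ae_of_all _ fun z => ?_)
    rw [Real.norm_eq_abs, abs_mul, abs_of_nonneg (sq_nonneg ⟪e, z⟫)]
    simp only [Pi.add_apply]
    have : |⟪u, z⟫| ≤ ⟪u, z⟫ ^ 2 + 1 := by
      rw [← sq_abs]; nlinarith [sq_nonneg (|⟪u, z⟫| - 1 / 2)]
    nlinarith [sq_nonneg ⟪e, z⟫]
  exact ((((integrable_inner_pow e 2).const_mul _).add (i1.const_mul _)).add
    (integrable_sq_mul_sq e u)).sub (((integrable_const _).add (i0.const_mul _)).add
      (integrable_inner_pow u 2))

/-- The intercept c drops out: its cross term is odd, and ⟪e,z⟫² − 1 has mean zero against c².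
Weights of this kind test the direction of u and ignore the mean, which is what lets the spectral
stage see the signal. -/
lemma integral_coord_mul {e : E} (he : ‖e‖ = 1) (c : ℝ) (u : E) :
    ∫ z, (⟪e, z⟫ ^ 2 - 1) * (c + ⟪u, z⟫) ^ 2 ∂(stdGaussian E) = 2 * ⟪e, u⟫ ^ 2 := by
  have h : ∀ z : E, (⟪e, z⟫ ^ 2 - 1) * (c + ⟪u, z⟫) ^ 2 =
      (2 * c * ((⟪e, z⟫ ^ 2 - 1) * ⟪u, z⟫)) +
      (c ^ 2 * ⟪e, z⟫ ^ 2 + ⟪e, z⟫ ^ 2 * ⟪u, z⟫ ^ 2 - (c ^ 2 + ⟪u, z⟫ ^ 2)) := by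
    intro z; ring
  have hi := integrable_coord_mul e c u
  simp only [h] at hi ⊢
  have i2 : Integrable (fun z : E => c ^ 2 * ⟪e, z⟫ ^ 2 + ⟪e, z⟫ ^ 2 * ⟪u, z⟫ ^ 2)
      (stdGaussian E) := ((integrable_inner_pow e 2).const_mul _).add (integrable_sq_mul_sq e u)
  have i4 : Integrable (fun z : E => c ^ 2 + ⟪u, z⟫ ^ 2) (stdGaussian E) :=
    (integrable_const _).add (integrable_inner_pow u 2)
  have i5 : Integrable (fun z : E => 2 * c * ((⟪e, z⟫ ^ 2 - 1) * ⟪u, z⟫)) (stdGaussian E) := by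
    have := hi.sub (i2.sub i4)
    refine this.congr (ae_of_all _ fun z => ?_)
    simp
  have i24 : Integrable (fun z : E => c ^ 2 * ⟪e, z⟫ ^ 2 + ⟪e, z⟫ ^ 2 * ⟪u, z⟫ ^ 2 -
      (c ^ 2 + ⟪u, z⟫ ^ 2)) (stdGaussian E) := i2.sub i4
  rw [integral_add i5 i24, integral_odd_stdGaussian _ (fun z => by
      simp only [inner_neg_right]; ring), integral_sub i2 i4,
    integral_add ((integrable_inner_pow e 2).const_mul _) (integrable_sq_mul_sq e u),
    integral_const_mul, integral_inner_sq, integral_sq_mul_sq,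
    integral_add (integrable_const _) (integrable_inner_pow u 2), integral_inner_sq, he]
  simp

end GaussianMoments

/-! ### Nets of the unit ball, and quadratic forms controlled on a net. -/

section Nets

variable {F : Type*} [NormedAddCommGroup F] [NormedSpace ℝ F] [FiniteDimensional ℝ F]

/-- A largest 1-separated set in the ball of radius 2 has at most 5^dim points by volume comparison.
By maximality 2v lies within distance 1 of it, and halving everything gives the net. -/
lemma exists_half_net : ∃ N : Finset F, N.card ≤ 5 ^ Module.finrank ℝ F ∧
    ∀ v : F, ‖v‖ ≤ 1 → ∃ w ∈ N, ‖v - w‖ ≤ 1 / 2 := by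
  classical
  let p : ℕ → Prop := fun k => ∃ s : Finset F, s.card = k ∧ (∀ c ∈ s, ‖c‖ ≤ 2) ∧
    ∀ c ∈ s, ∀ d ∈ s, c ≠ d → 1 ≤ ‖c - d‖
  have hp0 : p 0 := ⟨∅, by simp⟩
  have hb : ∀ k, p k → k ≤ 5 ^ Module.finrank ℝ F := by
    rintro k ⟨s, rfl, h1, h2⟩
    exact Besicovitch.card_le_of_separated s h1 h2
  obtain ⟨s, hs, h1, h2⟩ := Nat.findGreatest_spec (P := p) (Nat.zero_le _) hp0
  refine ⟨s.image (fun c => (1 / 2 : ℝ) • c), (Finset.card_image_le).trans ?_, ?_⟩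
  · rw [hs]; exact Nat.findGreatest_le _
  · intro v hv
    by_contra! hcon
    have hsep : ∀ c ∈ s, 1 < ‖(2 : ℝ) • v - c‖ := by
      intro c hc
      have := hcon _ (Finset.mem_image_of_mem _ hc)
      have h3 : (2 : ℝ) • v - c = (2 : ℝ) • (v - (1 / 2 : ℝ) • c) := by
        rw [smul_sub, smul_smul]; norm_num
      rw [h3, norm_smul]
      norm_num
      linarith
    have hnot : (2 : ℝ) • v ∉ s := by
      intro h
      have := hsep _ h
      simp at this
      linarith
    have hp : p (s.card + 1) := by
      refine ⟨insert ((2 : ℝ) • v) s, Finset.card_insert_of_notMem hnot, ?_, ?_⟩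
      · intro c hc
        rcases Finset.mem_insert.1 hc with rfl | hc
        · rw [norm_smul]; norm_num; linarith
        · exact h1 c hc
      · intro c hc d hd hcd
        rcases Finset.mem_insert.1 hc with rfl | hc <;> rcases Finset.mem_insert.1 hd with rfl | hd
        · exact absurd rfl hcd
        · exact (hsep d hd).le
        · rw [norm_sub_rev]; exact (hsep c hc).le
        · exact h2 c hc d hd hcd
    have := Nat.le_findGreatest (hb _ hp) hp
    omega

lemma exists_dyadic_net (j : ℕ) : ∃ N : Finset F, N.card ≤ (5 ^ j) ^ Module.finrank ℝ F ∧
    ∀ v : F, ‖v‖ ≤ 1 → ∃ w ∈ N, ‖v - w‖ ≤ (1 / 2) ^ j := by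
  classical
  induction j with
  | zero => exact ⟨{0}, by simp, fun v hv => ⟨0, by simp, by simpa using hv⟩⟩
  | succ j ih =>
    obtain ⟨N, hN, hN'⟩ := ih
    obtain ⟨M, hM, hM'⟩ := exists_half_net (F := F)
    refine ⟨(N ×ˢ M).image (fun p => p.1 + ((1 / 2 : ℝ) ^ j) • p.2), ?_, ?_⟩
    · refine Finset.card_image_le.trans ?_
      rw [Finset.card_product, pow_succ, mul_pow]
      exact Nat.mul_le_mul hN hM
    · intro v hv
      obtain ⟨w, hw, hvw⟩ := hN' v hv
      have h2 : ‖((2 : ℝ) ^ j) • (v - w)‖ ≤ 1 := by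
        rw [norm_smul, norm_pow, Real.norm_two]
        calc (2 : ℝ) ^ j * ‖v - w‖ ≤ 2 ^ j * (1 / 2) ^ j := by gcongr
          _ = 1 := by rw [← mul_pow]; norm_num
      obtain ⟨x, hx, hvx⟩ := hM' _ h2
      refine ⟨_, Finset.mem_image_of_mem _ (Finset.mk_mem_product hw hx), ?_⟩
      have h3 : v - (w + ((1 / 2 : ℝ) ^ j) • x) =
          ((1 / 2 : ℝ) ^ j) • (((2 : ℝ) ^ j) • (v - w) - x) := by
        rw [smul_sub, smul_smul, ← mul_pow]; norm_num; abel
      simp only [h3]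
      rw [norm_smul, pow_succ, Real.norm_of_nonneg (by positivity)]
      gcongr

variable (F) in
-- The net points have to lie in the ball, because the concentration bounds are applied to
-- functionals of norm at most one. Each point of a net of mesh 1/16 is moved to a point of the ball
-- within 1/16 of it, which doubles the mesh; 625 is 5⁴.
lemma exists_eighth_net : ∃ N : Finset F, N.card ≤ 625 ^ Module.finrank ℝ F ∧
    (∀ w ∈ N, ‖w‖ ≤ 1) ∧ ∀ v : F, ‖v‖ ≤ 1 → ∃ w ∈ N, ‖v - w‖ ≤ 1 / 8 := by
  classical
  obtain ⟨N, hN, hN'⟩ := exists_dyadic_net (F := F) 4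
  let f : F → F := fun w => if h : ∃ v : F, ‖v‖ ≤ 1 ∧ ‖v - w‖ ≤ (1 / 2) ^ 4 then h.choose else 0
  refine ⟨N.image f, Finset.card_image_le.trans (by simpa using hN), ?_, ?_⟩
  · intro w hw
    obtain ⟨x, -, rfl⟩ := Finset.mem_image.1 hw
    by_cases h : ∃ v : F, ‖v‖ ≤ 1 ∧ ‖v - x‖ ≤ (1 / 2) ^ 4
    · simp only [f, dif_pos h]; exact h.choose_spec.1
    · simp only [f]; rw [dif_neg h]; simp
  · intro v hv
    obtain ⟨w, hw, hvw⟩ := hN' v hv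
    have h : ∃ v : F, ‖v‖ ≤ 1 ∧ ‖v - w‖ ≤ (1 / 2) ^ 4 := ⟨v, hv, hvw⟩
    refine ⟨f w, Finset.mem_image_of_mem _ hw, ?_⟩
    have h2 : f w = h.choose := by simp only [f, dif_pos h]
    have h3 := h.choose_spec.2
    rw [h2]
    calc ‖v - h.choose‖ = ‖(v - w) - (h.choose - w)‖ := by congr 1; abel
      _ ≤ ‖v - w‖ + ‖h.choose - w‖ := norm_sub_le _ _
      _ ≤ (1 / 2) ^ 4 + (1 / 2) ^ 4 := add_le_add hvw h3
      _ = 1 / 8 := by norm_num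

/-- Compare a maximizer of the form on the ball with its nearest net point. Polarization bounds the
off-diagonal values by 2M, where M is the maximum, so M ≤ t + M/2 + M/64. Only a norm is assumed,
since the lemma serves ℝ × E with its sup norm. -/
lemma abs_quadratic_le_of_net {N : Finset F} (hN : ∀ v : F, ‖v‖ ≤ 1 → ∃ w ∈ N, ‖v - w‖ ≤ 1 / 8)
    (B : F →L[ℝ] F →L[ℝ] ℝ) (hB : ∀ x y, B x y = B y x) {t : ℝ}
    (ht : ∀ w ∈ N, |B w w| ≤ t) (v : F) : |B v v| ≤ 3 * t * ‖v‖ ^ 2 := by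
  have hcont : Continuous fun v : F => |B v v| :=
    ((isBoundedBilinearMap_apply.continuous).comp (B.continuous.prodMk continuous_id)).abs
  obtain ⟨x0, hx0, hmax⟩ := (isCompact_closedBall (0 : F) 1).exists_isMaxOn
    ⟨0, by simp⟩ hcont.continuousOn
  set M := |B x0 x0| with hM
  have hM0 : 0 ≤ M := abs_nonneg _
  have hball : ∀ v : F, ‖v‖ ≤ 1 → |B v v| ≤ M := fun v hv =>
    hmax (by simpa using hv)
  have hscale : ∀ v : F, |B v v| ≤ M * ‖v‖ ^ 2 := by
    intro v
    rcases eq_or_ne v 0 with rfl | hv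
    · simp
    have hv' : ‖v‖ ≠ 0 := norm_ne_zero_iff.2 hv
    have h1 := hball (‖v‖⁻¹ • v) (by rw [norm_smul, norm_inv, norm_norm, inv_mul_cancel₀ hv'])
    simp only [map_smul, smul_apply, smul_eq_mul, abs_mul, abs_inv,
      abs_norm] at h1
    have h2 : ‖v‖⁻¹ * (‖v‖⁻¹ * |B v v|) * ‖v‖ ^ 2 = |B v v| := by field_simp
    rw [← h2]
    gcongr
  have hbil : ∀ x y : F, ‖x‖ ≤ 1 → ‖y‖ ≤ 1 → |B x y| ≤ 2 * M := by
    intro x y hx hy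
    have h4 : 4 * B x y = B (x + y) (x + y) - B (x - y) (x - y) := by
      simp only [map_add, map_sub, add_apply, sub_apply,
        hB y x]
      ring
    have h1 := hscale (x + y)
    have h2 := hscale (x - y)
    have h5 : ‖x + y‖ ^ 2 ≤ 4 := by nlinarith [norm_add_le x y, norm_nonneg (x + y)]
    have h6 : ‖x - y‖ ^ 2 ≤ 4 := by nlinarith [norm_sub_le x y, norm_nonneg (x - y)]
    have h7 : |4 * B x y| ≤ M * 4 + M * 4 := by
      rw [h4]
      refine (abs_sub _ _).trans ?_
      nlinarith
    rw [abs_mul, abs_of_pos (by norm_num : (0 : ℝ) < 4)] at h7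
    linarith
  have hMt : M ≤ 3 * t := by
    obtain ⟨w, hw, hvw⟩ := hN x0 (by simpa using hx0)
    have hx1 : ‖x0‖ ≤ 1 := by simpa using hx0
    have h1 : B x0 x0 = B w w + (2 * B (x0 - w) x0 - B (x0 - w) (x0 - w)) := by
      simp only [map_sub, sub_apply, hB w x0]
      ring
    have h2 : |B (x0 - w) x0| ≤ M / 4 := by
      have := hbil ((8 : ℝ) • (x0 - w)) x0 (by rw [norm_smul]; norm_num; linarith) hx1
      simp only [map_smul, smul_apply, smul_eq_mul, abs_mul] at this
      rw [map_sub, sub_apply]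
      norm_num at this
      linarith
    have h3 : |B (x0 - w) (x0 - w)| ≤ M / 64 := by
      refine (hscale _).trans ?_
      have : ‖x0 - w‖ ^ 2 ≤ (1 / 8) ^ 2 := by gcongr
      nlinarith
    have h4 : M ≤ t + (2 * (M / 4) + M / 64) := by
      calc M = |B w w + (2 * B (x0 - w) x0 - B (x0 - w) (x0 - w))| := by rw [hM, h1]
        _ ≤ |B w w| + |2 * B (x0 - w) x0 - B (x0 - w) (x0 - w)| := abs_add_le _ _
        _ ≤ |B w w| + (|2 * B (x0 - w) x0| + |B (x0 - w) (x0 - w)|) := by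
            gcongr; exact abs_sub _ _
        _ ≤ t + (2 * (M / 4) + M / 64) := by
            rw [abs_mul, abs_two]
            gcongr
            exact ht w hw
    linarith [abs_nonneg (B w w), ht w hw]
  exact (hscale v).trans (by gcongr)

end Nets

/-! ### Bernstein bounds for quadratic functionals of i.i.d. Gaussian vectors. -/

section Chernoff

lemma measureReal_sum_ge_le {Ω E ι : Type*} [MeasurableSpace Ω] [MeasurableSpace E]
    {P : Measure Ω} [IsProbabilityMeasure P] {ν : Measure E} {z : ι → Ω → E}
    (hzm : ∀ i, Measurable (z i)) (hind : iIndepFun z P) (hz : ∀ i, HasLaw (z i) ν P) {g : E → ℝ} (hg : Measurable g)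
    (hint : Integrable (fun x => Real.exp (g x)) ν) {B : ℝ}
    (hB : ∫ x, Real.exp (g x) ∂ν ≤ B) (s : Finset ι) (t : ℝ) :
    P.real {ω | t ≤ ∑ i ∈ s, g (z i ω)} ≤ Real.exp (-t) * B ^ s.card := by
  classical
  have hind' : iIndepFun (fun i ω => g (z i ω)) P := hind.comp (fun _ => g) (fun _ => hg)
  have hm : ∀ i, Measurable (fun ω => g (z i ω)) := fun i => hg.comp (hzm i)
  have hexp : Measurable (fun x => Real.exp (g x)) := hg.exp
  have hmgf : ∀ i, mgf (fun ω => g (z i ω)) P 1 ≤ B := by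
    intro i
    simp only [mgf, one_mul]
    have := (hz i).integral_comp (f := fun x => Real.exp (g x)) hexp.aestronglyMeasurable
    rw [← this] at hB
    exact hB
  have hinti : ∀ i, Integrable (fun ω => Real.exp (1 * g (z i ω))) P := by
    intro i
    simp only [one_mul]
    have h := hint
    rw [← (hz i).map_eq] at h
    exact h.comp_measurable (hzm i)
  have h1 : Integrable (fun ω => Real.exp (1 * (∑ i ∈ s, fun ω => g (z i ω)) ω)) P :=
    hind'.integrable_exp_mul_sum hm (fun i _ => hinti i)
  have h2 := measure_ge_le_exp_mul_mgf (μ := P) t zero_le_one h1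
  rw [hind'.mgf_sum hm] at h2
  simp only [Finset.sum_apply, neg_mul, one_mul] at h2
  refine h2.trans ?_
  gcongr
  calc ∏ i ∈ s, mgf (fun ω => g (z i ω)) P 1 ≤ ∏ i ∈ s, B :=
        Finset.prod_le_prod (fun i _ => mgf_nonneg) (fun i _ => hmgf i)
    _ = B ^ s.card := by simp


lemma exp_le_quadratic (y : ℝ) : Real.exp y ≤ 1 + y + y ^ 2 * Real.exp |y| := by
  have h := Complex.norm_exp_sub_sum_le_norm_mul_exp (y : ℂ) 2
  simp only [Finset.sum_range_succ, Finset.sum_range_zero, pow_zero, pow_one, Nat.factorial,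
    Complex.norm_real, Real.norm_eq_abs] at h
  have h2 : Complex.exp (y : ℂ) - (0 + 1 / ((1 : ℕ) : ℂ) + (y : ℂ) / ((Nat.succ 0 * 1 : ℕ) : ℂ)) =
      ((Real.exp y - (1 + y) : ℝ) : ℂ) := by
    push_cast; simp
  rw [h2, Complex.norm_real, Real.norm_eq_abs, sq_abs] at h
  linarith [le_abs_self (Real.exp y - (1 + y))]

variable {E : Type*} [NormedAddCommGroup E] [InnerProductSpace ℝ E] [FiniteDimensional ℝ E]
  [MeasurableSpace E] [BorelSpace E]

open scoped RealInnerProductSpace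

lemma integral_exp_affine_sq_le {c : ℝ} (hc : |c| ≤ 1) {u : E} (hu : ‖u‖ ≤ 1) :
    Integrable (fun z => Real.exp ((c + ⟪u, z⟫) ^ 2 / 8)) (stdGaussian E) ∧
      ∫ z, Real.exp ((c + ⟪u, z⟫) ^ 2 / 8) ∂(stdGaussian E) ≤ 2 := by
  obtain ⟨hi, hle⟩ := integral_exp_inner_sq_le hu (b := 1 / 4) (by norm_num) (by norm_num)
  have hpt : ∀ z : E, Real.exp ((c + ⟪u, z⟫) ^ 2 / 8) ≤
      Real.exp (1 / 4) * Real.exp (1 / 4 * ⟪u, z⟫ ^ 2) := by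
    intro z
    rw [← Real.exp_add]
    apply Real.exp_le_exp.2
    have : c ^ 2 ≤ 1 := by rw [← sq_abs]; nlinarith [abs_nonneg c]
    nlinarith [sq_nonneg (c - ⟪u, z⟫)]
  have hi2 : Integrable (fun z => Real.exp ((c + ⟪u, z⟫) ^ 2 / 8)) (stdGaussian E) := by
    refine (hi.const_mul (Real.exp (1 / 4))).mono' (by fun_prop) (ae_of_all _ fun z => ?_)
    rw [Real.norm_eq_abs, abs_of_pos (Real.exp_pos _)]
    exact hpt z
  refine ⟨hi2, (integral_mono hi2 (hi.const_mul _) hpt).trans ?_⟩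
  rw [integral_const_mul]
  have h1 : (√(1 - 2 * (1 / 4 : ℝ)))⁻¹ ≤ 3 / 2 := by
    rw [inv_le_comm₀ (by apply Real.sqrt_pos.2; norm_num) (by norm_num)]
    apply Real.le_sqrt_of_sq_le
    norm_num
  have h2 : Real.exp (1 / 4) ≤ 4 / 3 := by
    have := Real.exp_bound_div_one_sub_of_interval (x := 1 / 4) (by norm_num) (by norm_num)
    norm_num at this ⊢
    linarith
  calc Real.exp (1 / 4) * ∫ z, Real.exp (1 / 4 * ⟪u, z⟫ ^ 2) ∂(stdGaussian E)
      ≤ 4 / 3 * (3 / 2) := by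
        apply mul_le_mul h2 (hle.trans h1) _ (by norm_num)
        exact integral_nonneg fun z => (Real.exp_pos _).le
    _ = 2 := by norm_num

lemma pow_four_le_exp (q : ℝ) : q ^ 4 ≤ 512 * Real.exp (q ^ 2 / 16) := by
  have := Real.quadratic_le_exp_of_nonneg (x := q ^ 2 / 16) (by positivity)
  nlinarith [sq_nonneg q]

/-- An arbitrary bounded weight rules out an exact computation, so the exponential is expanded to
second order. The remainder is at most 512 l² exp((c + ⟪u,z⟫)²/8), and that exponential has integral
at most 2. -/
lemma integral_exp_weighted_sq_le {a : E → ℝ} (ha : Measurable a) (ha1 : ∀ z, |a z| ≤ 1)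
    {c : ℝ} (hc : |c| ≤ 1) {u : E} (hu : ‖u‖ ≤ 1) {l : ℝ} (hl : |l| ≤ 1 / 16) :
    Integrable (fun z => Real.exp (l * (a z * (c + ⟪u, z⟫) ^ 2))) (stdGaussian E) ∧
    Integrable (fun z => a z * (c + ⟪u, z⟫) ^ 2) (stdGaussian E) ∧
      ∫ z, Real.exp (l * (a z * (c + ⟪u, z⟫) ^ 2)) ∂(stdGaussian E) ≤
        Real.exp (l * ∫ z, a z * (c + ⟪u, z⟫) ^ 2 ∂(stdGaussian E) + 1024 * l ^ 2) := by
  obtain ⟨hi, hle⟩ := integral_exp_affine_sq_le hc hu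
  have hx : ∀ z : E, |a z * (c + ⟪u, z⟫) ^ 2| ≤ (c + ⟪u, z⟫) ^ 2 := by
    intro z
    rw [abs_mul, abs_of_nonneg (sq_nonneg (c + ⟪u, z⟫))]
    nlinarith [ha1 z, sq_nonneg (c + ⟪u, z⟫)]
  have hlx : ∀ z : E, |l * (a z * (c + ⟪u, z⟫) ^ 2)| ≤ (c + ⟪u, z⟫) ^ 2 / 16 := by
    intro z
    rw [abs_mul]
    calc |l| * |a z * (c + ⟪u, z⟫) ^ 2| ≤ 1 / 16 * (c + ⟪u, z⟫) ^ 2 := by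
          gcongr; exact hx z
      _ = _ := by ring
  have i1 : Integrable (fun z => Real.exp (l * (a z * (c + ⟪u, z⟫) ^ 2))) (stdGaussian E) := by
    refine hi.mono' (by fun_prop) (ae_of_all _ fun z => ?_)
    rw [Real.norm_eq_abs, abs_of_pos (Real.exp_pos _)]
    apply Real.exp_le_exp.2
    have := (le_abs_self _).trans (hlx z)
    nlinarith [sq_nonneg (c + ⟪u, z⟫)]
  have i2 : Integrable (fun z => a z * (c + ⟪u, z⟫) ^ 2) (stdGaussian E) := by
    refine (hi.const_mul 8).mono' (by fun_prop) (ae_of_all _ fun z => ?_)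
    rw [Real.norm_eq_abs]
    refine (hx z).trans ?_
    have := Real.add_one_le_exp ((c + ⟪u, z⟫) ^ 2 / 8)
    linarith
  refine ⟨i1, i2, ?_⟩
  have hpt : ∀ z : E, Real.exp (l * (a z * (c + ⟪u, z⟫) ^ 2)) ≤
      1 + l * (a z * (c + ⟪u, z⟫) ^ 2) + 512 * l ^ 2 * Real.exp ((c + ⟪u, z⟫) ^ 2 / 8) := by
    intro z
    refine (exp_le_quadratic _).trans ?_
    have h1 : (l * (a z * (c + ⟪u, z⟫) ^ 2)) ^ 2 ≤
        l ^ 2 * (512 * Real.exp ((c + ⟪u, z⟫) ^ 2 / 16)) := by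
      rw [mul_pow]
      gcongr
      refine le_trans ?_ (pow_four_le_exp _)
      rw [← sq_abs]
      calc |a z * (c + ⟪u, z⟫) ^ 2| ^ 2 ≤ ((c + ⟪u, z⟫) ^ 2) ^ 2 := by gcongr; exact hx z
        _ = _ := by ring
    have h2 : Real.exp |l * (a z * (c + ⟪u, z⟫) ^ 2)| ≤ Real.exp ((c + ⟪u, z⟫) ^ 2 / 16) :=
      Real.exp_le_exp.2 (hlx z)
    have h3 : Real.exp ((c + ⟪u, z⟫) ^ 2 / 8) =
        Real.exp ((c + ⟪u, z⟫) ^ 2 / 16) * Real.exp ((c + ⟪u, z⟫) ^ 2 / 16) := by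
      rw [← Real.exp_add]; congr 1; ring
    rw [h3]
    have h4 := mul_le_mul h1 h2 (Real.exp_pos _).le (by positivity)
    linarith
  have i3 : Integrable (fun z => 1 + l * (a z * (c + ⟪u, z⟫) ^ 2)) (stdGaussian E) :=
    (integrable_const _).add (i2.const_mul l)
  have i4 : Integrable (fun z => 512 * l ^ 2 * Real.exp ((c + ⟪u, z⟫) ^ 2 / 8))
    (stdGaussian E) := hi.const_mul _
  refine (integral_mono i1 (i3.add i4) hpt).trans ?_
  simp only [Pi.add_apply]
  rw [integral_add i3 i4, integral_add (integrable_const _) (i2.const_mul l), integral_const_mul,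
    integral_const_mul]
  simp only [integral_const, probReal_univ, one_smul]
  refine le_trans ?_ (Real.add_one_le_exp _)
  nlinarith [sq_nonneg l]

variable {Ω ι : Type*} [MeasurableSpace Ω] {P : Measure Ω} [IsProbabilityMeasure P]
  {z : ι → Ω → E}

lemma measureReal_weighted_sum_ge_le (hzm : ∀ i, Measurable (z i)) (hind : iIndepFun z P)
    (hz : ∀ i, HasLaw (z i) (stdGaussian E) P)
    {a : E → ℝ} (ha : Measurable a) (ha1 : ∀ z, |a z| ≤ 1)
    {c : ℝ} (hc : |c| ≤ 1) {u : E} (hu : ‖u‖ ≤ 1) {r : ℝ} (hr0 : 0 ≤ r) (hr : r ≤ 128)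
    (s : Finset ι) {m : ℝ} (hm : m = ∫ z, a z * (c + ⟪u, z⟫) ^ 2 ∂(stdGaussian E)) :
    P.real {ω | s.card * r ≤ |∑ i ∈ s, a (z i ω) * (c + ⟪u, z i ω⟫) ^ 2 - s.card * m|} ≤
      2 * Real.exp (-(s.card * r ^ 2 / 4096)) := by
  -- The value r/2048 minimizes the exponent −lr + 1024 l², and r ≤ 128 keeps it below 1/16. Both
  -- signs of l are used, one for each tail.
  have key : ∀ l : ℝ, |l| = r / 2048 →
      P.real {ω | |l| * (s.card * r) + l * (s.card * m) ≤
        ∑ i ∈ s, l * (a (z i ω) * (c + ⟪u, z i ω⟫) ^ 2)} ≤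
      Real.exp (-(s.card * r ^ 2 / 4096)) := by
    intro l hl
    obtain ⟨i1, -, h⟩ := integral_exp_weighted_sq_le ha ha1 hc hu (l := l) (by rw [hl]; linarith)
    refine (measureReal_sum_ge_le hzm hind hz (by fun_prop) i1 h s _).trans ?_
    rw [← hm, ← Real.exp_nat_mul, ← Real.exp_add]
    apply Real.exp_le_exp.2
    have : l ^ 2 = (r / 2048) ^ 2 := by rw [← hl, sq_abs]
    rw [this, hl]
    apply le_of_eq
    ring
  have hk1 := key (r / 2048) (abs_of_nonneg (by positivity))
  have hk2 := key (-(r / 2048)) (by rw [abs_neg]; exact abs_of_nonneg (by positivity))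
  rcases hr0.eq_or_lt with rfl | hr0
  · refine (measureReal_le_one).trans ?_
    simp
  have hsub : {ω | s.card * r ≤ |∑ i ∈ s, a (z i ω) * (c + ⟪u, z i ω⟫) ^ 2 - s.card * m|} ⊆
      {ω | |r / 2048| * (s.card * r) + r / 2048 * (s.card * m) ≤
        ∑ i ∈ s, r / 2048 * (a (z i ω) * (c + ⟪u, z i ω⟫) ^ 2)} ∪
      {ω | |-(r / 2048)| * (s.card * r) + -(r / 2048) * (s.card * m) ≤
        ∑ i ∈ s, -(r / 2048) * (a (z i ω) * (c + ⟪u, z i ω⟫) ^ 2)} := by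
    intro ω hω
    simp only [Set.mem_ofPred_eq, Set.mem_union, ← Finset.mul_sum, abs_neg] at hω ⊢
    rw [abs_of_pos (by positivity : 0 < r / 2048)]
    have hp : 0 < r / 2048 := by positivity
    rcases le_abs'.1 hω with h | h
    · right; nlinarith
    · left; nlinarith
  refine (measureReal_mono hsub).trans ((measureReal_union_le _ _).trans ?_)
  linarith

end Chernoff

/-! ### Deviation bounds uniform over all directions. -/

section Uniform

open scoped RealInnerProductSpace

variable {E : Type*} [NormedAddCommGroup E] [InnerProductSpace ℝ E]

/-- The functional `(c, u) ↦ c + ⟪u, z⟫`. -/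
noncomputable def affineFunctional (z : E) : (ℝ × E) →L[ℝ] ℝ :=
  ContinuousLinearMap.fst ℝ ℝ E + (innerSL ℝ z).comp (ContinuousLinearMap.snd ℝ ℝ E)

lemma affineFunctional_apply (z : E) (v : ℝ × E) : affineFunctional z v = v.1 + ⟪v.2, z⟫ := by
  simp [affineFunctional, real_inner_comm]

/-- The symmetric bilinear form `(v, w) ↦ ∑ i, a i * ℓ i v * ℓ i w`. -/
noncomputable def weightedForm {F ι : Type*} [NormedAddCommGroup F] [NormedSpace ℝ F]
    (s : Finset ι) (a : ι → ℝ) (l : ι → F →L[ℝ] ℝ) : F →L[ℝ] F →L[ℝ] ℝ :=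
  ∑ i ∈ s, a i • (l i).smulRight (l i)

lemma weightedForm_apply {F ι : Type*} [NormedAddCommGroup F] [NormedSpace ℝ F]
    (s : Finset ι) (a : ι → ℝ) (l : ι → F →L[ℝ] ℝ) (v w : F) :
    weightedForm s a l v w = ∑ i ∈ s, a i * (l i v * l i w) := by
  simp [weightedForm]

lemma norm_prod_sq_le {E : Type*} [NormedAddCommGroup E] (v : ℝ × E) : ‖v‖ ^ 2 ≤ v.1 ^ 2 + ‖v.2‖ ^ 2 := by
  rcases max_choice ‖v.1‖ ‖v.2‖ with h | h
  · rw [Prod.norm_def, h, Real.norm_eq_abs, sq_abs]; nlinarith [sq_nonneg ‖v.2‖]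
  · rw [Prod.norm_def, h]; nlinarith [sq_nonneg v.1]

variable [FiniteDimensional ℝ E] [MeasurableSpace E] [BorelSpace E]
variable {Ω : Type*} [MeasurableSpace Ω] {P : Measure Ω} [IsProbabilityMeasure P]
  {n : ℕ} {z : Fin n → Ω → E}

/-- The target form T need not be the exact mean: the bias β leaves room for weights that are
truncations of unbounded ones. The net lives in ℝ × E, which treats intercept and slope together and
explains the extra 1 in the exponent. -/
lemma measureReal_weighted_dev_le (hn : 0 < n) (hzm : ∀ i, Measurable (z i)) (hind : iIndepFun z P)
    (hz : ∀ i, HasLaw (z i) (stdGaussian E) P)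
    {a : E → ℝ} (ha : Measurable a) {τ : ℝ} (hτ : 0 < τ) (haτ : ∀ z, |a z| ≤ τ)
    (T : (ℝ × E) →L[ℝ] (ℝ × E) →L[ℝ] ℝ) (hT : ∀ v w, T v w = T w v) {β : ℝ}
    (hβ : ∀ (c : ℝ) (u : E), |c| ≤ 1 → ‖u‖ ≤ 1 →
      |∫ z, a z * (c + ⟪u, z⟫) ^ 2 ∂(stdGaussian E) - T (c, u) (c, u)| ≤ β)
    {r : ℝ} (hr0 : 0 ≤ r) (hr : r ≤ 128) :
    P.real {ω | ¬ ∀ (c : ℝ) (u : E),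
      |(n : ℝ)⁻¹ * ∑ i, a (z i ω) * (c + ⟪u, z i ω⟫) ^ 2 - T (c, u) (c, u)| ≤
        3 * (τ * r + β) * (c ^ 2 + ‖u‖ ^ 2)} ≤
      625 ^ (Module.finrank ℝ E + 1) * (2 * Real.exp (-(n * r ^ 2 / 4096))) := by
  classical
  obtain ⟨N, hNc, hN1, hN2⟩ := exists_eighth_net (ℝ × E)
  have hn' : (0 : ℝ) < n := by exact_mod_cast hn
  let m : ℝ × E → ℝ := fun w => ∫ z, (τ⁻¹ * a z) * (w.1 + ⟪w.2, z⟫) ^ 2 ∂(stdGaussian E)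
  let S : ℝ × E → Set Ω := fun w =>
    {ω | (Finset.univ : Finset (Fin n)).card * r ≤
      |∑ i, (τ⁻¹ * a (z i ω)) * (w.1 + ⟪w.2, z i ω⟫) ^ 2 -
        (Finset.univ : Finset (Fin n)).card * m w|}
  have hS : ∀ w ∈ N, P.real (S w) ≤ 2 * Real.exp (-(n * r ^ 2 / 4096)) := by
    intro w hw
    have h1 : |w.1| ≤ 1 := (norm_fst_le w).trans (hN1 w hw)
    have h2 : ‖w.2‖ ≤ 1 := (norm_snd_le w).trans (hN1 w hw)
    have := measureReal_weighted_sum_ge_le hzm hind hz (a := fun z => τ⁻¹ * a z) (by fun_prop)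
      (fun z => by
        rw [abs_mul, abs_inv, abs_of_pos hτ, inv_mul_le_iff₀ hτ, mul_one]; exact haτ z)
      h1 h2 hr0 hr Finset.univ (m := m w) rfl
    simpa [S] using this
  have hsub : {ω | ¬ ∀ (c : ℝ) (u : E),
      |(n : ℝ)⁻¹ * ∑ i, a (z i ω) * (c + ⟪u, z i ω⟫) ^ 2 - T (c, u) (c, u)| ≤
        3 * (τ * r + β) * (c ^ 2 + ‖u‖ ^ 2)} ⊆ ⋃ w ∈ N, S w := by
    intro ω hω
    by_contra hcon
    apply hω
    intro c u
    simp only [Set.mem_iUnion, not_exists] at hcon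
    let B : (ℝ × E) →L[ℝ] (ℝ × E) →L[ℝ] ℝ :=
      (n : ℝ)⁻¹ • weightedForm Finset.univ (fun i => a (z i ω)) (fun i => affineFunctional (z i ω)) - T
    have hB : ∀ v w, B v w = (n : ℝ)⁻¹ * ∑ i, a (z i ω) * ((v.1 + ⟪v.2, z i ω⟫) *
        (w.1 + ⟪w.2, z i ω⟫)) - T v w := by
      intro v w
      simp only [B, sub_apply, smul_apply, weightedForm_apply, affineFunctional_apply, smul_eq_mul]
    have hBv : ∀ v, B v v = (n : ℝ)⁻¹ * ∑ i, a (z i ω) * (v.1 + ⟪v.2, z i ω⟫) ^ 2 - T v v := by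
      intro v; rw [hB]; simp only [sq]
    have h := abs_quadratic_le_of_net hN2 B (fun x y => by
      rw [hB, hB, hT]; congr 2; refine Finset.sum_congr rfl fun i _ => by ring)
      (t := τ * r + β) ?_ (c, u)
    · rw [hBv] at h
      refine h.trans ?_
      have h0 : 0 ≤ β := (abs_nonneg _).trans (hβ 0 0 (by simp) (by simp))
      have := norm_prod_sq_le (c, u)
      gcongr
    · intro w hw
      have h1 : |w.1| ≤ 1 := (norm_fst_le w).trans (hN1 w hw)
      have h2 : ‖w.2‖ ≤ 1 := (norm_snd_le w).trans (hN1 w hw)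
      have h3 := hcon w hw
      simp only [S, Set.mem_ofPred_eq, not_le, Finset.card_univ, Fintype.card_fin] at h3
      have h4 := hβ w.1 w.2 h1 h2
      have h5 : B w w = τ * (n : ℝ)⁻¹ * (∑ i, (τ⁻¹ * a (z i ω)) * (w.1 + ⟪w.2, z i ω⟫) ^ 2 -
          n * m w) + (∫ z, a z * (w.1 + ⟪w.2, z⟫) ^ 2 ∂(stdGaussian E) - T w w) := by
        have h6 : m w = τ⁻¹ * ∫ z, a z * (w.1 + ⟪w.2, z⟫) ^ 2 ∂(stdGaussian E) := by
          simp only [m, mul_assoc, integral_const_mul]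
        rw [hBv, h6]
        simp only [mul_assoc, ← Finset.mul_sum]
        field_simp
        ring
      rw [h5]
      refine (abs_add_le _ _).trans (add_le_add ?_ h4)
      rw [abs_mul, abs_of_pos (by positivity)]
      calc τ * (n : ℝ)⁻¹ * _ ≤ τ * (n : ℝ)⁻¹ * (n * r) := by gcongr
        _ = τ * r := by field_simp
  refine (measureReal_mono hsub (measure_ne_top _ _)).trans ((measureReal_biUnion_finset_le _ _).trans ?_)
  refine (Finset.sum_le_sum hS).trans ?_
  rw [Finset.sum_const, nsmul_eq_mul]
  gcongr
  have : Module.finrank ℝ (ℝ × E) = Module.finrank ℝ E + 1 := by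
    rw [Module.finrank_prod, Module.finrank_self, add_comm]
  rw [this] at hNc
  exact_mod_cast hNc

/-- Where |A| > τ, one factor exp(θ|A|/4) pays for |A| and another for the decay exp(−θτ/4). The
remaining product is split into exp(θ|A|) and a quartic in the functional, both integrable; 5000
exceeds 4·(4 + 512·2). -/
lemma truncation_bias_le {A : E → ℝ} (hA : Measurable A) {θ : ℝ} (hθ : 0 < θ)
    (hAi : Integrable (fun z => Real.exp (θ * |A z|)) (stdGaussian E))
    (hA4 : ∫ z, Real.exp (θ * |A z|) ∂(stdGaussian E) ≤ 4) (τ : ℝ)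
    {c : ℝ} (hc : |c| ≤ 1) {u : E} (hu : ‖u‖ ≤ 1)
    (hi : Integrable (fun z => A z * (c + ⟪u, z⟫) ^ 2) (stdGaussian E)) :
    |∫ z, (if |A z| ≤ τ then A z else 0) * (c + ⟪u, z⟫) ^ 2 ∂(stdGaussian E) -
      ∫ z, A z * (c + ⟪u, z⟫) ^ 2 ∂(stdGaussian E)| ≤ 5000 / θ * Real.exp (-(θ * τ / 4)) := by
  obtain ⟨hei, hle⟩ := integral_exp_affine_sq_le hc hu
  have hmeas : Measurable fun z => (if |A z| ≤ τ then A z else 0) :=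
    Measurable.ite (measurableSet_le (by fun_prop) measurable_const) hA measurable_const
  have hti : Integrable (fun z => (if |A z| ≤ τ then A z else 0) * (c + ⟪u, z⟫) ^ 2)
      (stdGaussian E) := by
    refine hi.mono (by fun_prop) (ae_of_all _ fun z => ?_)
    by_cases h : |A z| ≤ τ
    · simp [h]
    · simp only [if_neg h, zero_mul, norm_zero]; positivity
  rw [← integral_sub hti hi]
  refine (abs_integral_le_integral_abs).trans ?_
  have hpt : ∀ z, |(if |A z| ≤ τ then A z else 0) * (c + ⟪u, z⟫) ^ 2 - A z * (c + ⟪u, z⟫) ^ 2| ≤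
      4 / θ * Real.exp (-(θ * τ / 4)) *
        (Real.exp (θ * |A z|) + 512 * Real.exp ((c + ⟪u, z⟫) ^ 2 / 8)) := by
    intro z
    by_cases h : |A z| ≤ τ
    · simp only [if_pos h, sub_self, abs_zero]; positivity
    · simp only [if_neg h, zero_mul, zero_sub, abs_neg, abs_mul, abs_pow, sq_abs]
      push Not at h
      have h1 : |A z| ≤ 4 / θ * Real.exp (θ * |A z| / 4) := by
        have := Real.add_one_le_exp (θ * |A z| / 4)
        calc |A z| = 4 / θ * (θ * |A z| / 4) := by field_simp
          _ ≤ _ := by gcongr; linarith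
      have h2 : 1 ≤ Real.exp (θ * |A z| / 4) * Real.exp (-(θ * τ / 4)) := by
        rw [← Real.exp_add]
        apply Real.one_le_exp
        have := mul_le_mul_of_nonneg_left h.le hθ.le
        linarith
      have h3 : Real.exp (θ * |A z|) = (Real.exp (θ * |A z| / 4) * Real.exp (θ * |A z| / 4)) ^ 2 := by
        rw [← Real.exp_add, ← Real.exp_nat_mul]; congr 1; push_cast; ring
      have h4 : (c + ⟪u, z⟫) ^ 4 ≤ 512 * Real.exp ((c + ⟪u, z⟫) ^ 2 / 8) := by
        refine (pow_four_le_exp _).trans ?_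
        gcongr
        norm_num
      set X := Real.exp (θ * |A z| / 4) with hX
      set Y := Real.exp (-(θ * τ / 4)) with hY
      have hXp : 0 < X := Real.exp_pos _
      have hYp : 0 < Y := Real.exp_pos _
      calc |A z| * (c + ⟪u, z⟫) ^ 2 ≤ (4 / θ * X * (X * Y)) * (c + ⟪u, z⟫) ^ 2 := by
            gcongr
            calc |A z| ≤ 4 / θ * X * 1 := by rw [mul_one]; exact h1
              _ ≤ _ := by gcongr
        _ = 4 / θ * Y * (X * X * (c + ⟪u, z⟫) ^ 2) := by ring
        _ ≤ 4 / θ * Y * (Real.exp (θ * |A z|) + 512 * Real.exp ((c + ⟪u, z⟫) ^ 2 / 8)) := by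
            gcongr
            rw [h3]
            nlinarith [sq_nonneg (X * X - (c + ⟪u, z⟫) ^ 2), sq_nonneg (X * X),
              sq_nonneg ((c + ⟪u, z⟫) ^ 2)]
  have i1 : Integrable (fun z => Real.exp (θ * |A z|) + 512 * Real.exp ((c + ⟪u, z⟫) ^ 2 / 8))
    (stdGaussian E) := hAi.add (hei.const_mul 512)
  refine (integral_mono (hti.sub hi).abs (i1.const_mul _) hpt).trans ?_
  rw [integral_const_mul, integral_add hAi (hei.const_mul 512), integral_const_mul]
  have : 4 / θ * Real.exp (-(θ * τ / 4)) * (∫ z, Real.exp (θ * |A z|) ∂(stdGaussian E) +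
      512 * ∫ z, Real.exp ((c + ⟪u, z⟫) ^ 2 / 8) ∂(stdGaussian E)) ≤
      4 / θ * Real.exp (-(θ * τ / 4)) * (4 + 512 * 2) := by gcongr
  refine this.trans ?_
  have h5 : 4 / θ * Real.exp (-(θ * τ / 4)) * (4 + 512 * 2) =
      4112 / θ * Real.exp (-(θ * τ / 4)) := by ring
  rw [h5]
  gcongr
  norm_num

lemma measureReal_exists_gt_le (hzm : ∀ i, Measurable (z i)) (hind : iIndepFun z P)
    (hz : ∀ i, HasLaw (z i) (stdGaussian E) P) {A : E → ℝ} (hA : Measurable A) {θ : ℝ} (hθ : 0 < θ)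
    (hAi : Integrable (fun z => Real.exp (θ * |A z|)) (stdGaussian E))
    (hA4 : ∫ z, Real.exp (θ * |A z|) ∂(stdGaussian E) ≤ 4) (τ : ℝ) :
    P.real {ω | ¬ ∀ i, |A (z i ω)| ≤ τ} ≤ n * (4 * Real.exp (-(θ * τ))) := by
  have hsub : {ω | ¬ ∀ i, |A (z i ω)| ≤ τ} ⊆
      ⋃ i ∈ (Finset.univ : Finset (Fin n)), {ω | θ * τ ≤ ∑ j ∈ {i}, θ * |A (z j ω)|} := by
    intro ω hω
    simp only [Set.mem_ofPred_eq, not_forall, not_le] at hω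
    obtain ⟨i, hi⟩ := hω
    simp only [Set.mem_iUnion, Set.mem_ofPred_eq, Finset.sum_singleton]
    exact ⟨i, Finset.mem_univ i, by gcongr⟩
  refine (measureReal_mono hsub (measure_ne_top _ _)).trans ((measureReal_biUnion_finset_le _ _).trans ?_)
  have : ∀ i ∈ (Finset.univ : Finset (Fin n)),
      P.real {ω | θ * τ ≤ ∑ j ∈ {i}, θ * |A (z j ω)|} ≤ 4 * Real.exp (-(θ * τ)) := by
    intro i _
    have := measureReal_sum_ge_le hzm hind hz (g := fun z => θ * |A z|) (by fun_prop) hAi hA4 {i}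
      (θ * τ)
    simpa [mul_comm] using this
  refine (Finset.sum_le_sum this).trans ?_
  simp

/-- No union over subsets is needed: each square is at most b plus its excess over b, and the
excesses are summed over all n indices. The excess has moment generating function at most exp(2
exp(−b/4)), so only the net over directions costs a union bound. -/
lemma measureReal_subset_sum_le (hzm : ∀ i, Measurable (z i)) (hind : iIndepFun z P)
    (hz : ∀ i, HasLaw (z i) (stdGaussian E) P) (k : ℕ) {b : ℝ} (hb : 1 ≤ b) (t : ℝ) :
    P.real {ω | ¬ ∀ s : Finset (Fin n), s.card ≤ k → ∀ (c : ℝ) (u : E),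
      ∑ i ∈ s, (c + ⟪u, z i ω⟫) ^ 2 ≤ 6 * (b * k + 4 * t) * (c ^ 2 + ‖u‖ ^ 2)} ≤
      625 ^ (Module.finrank ℝ E) * Real.exp (-t + 2 * n * Real.exp (-(b / 4))) := by
  classical
  obtain ⟨N, hNc, hN1, hN2⟩ := exists_eighth_net E
  let S : E → Set Ω := fun u => {ω | t ≤ ∑ i, max (⟪u, z i ω⟫ ^ 2 - b) 0 / 4}
  have hS : ∀ u ∈ N, P.real (S u) ≤ Real.exp (-t + 2 * n * Real.exp (-(b / 4))) := by
    intro u hu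
    obtain ⟨hi, hle⟩ := integral_exp_inner_sq_le (hN1 u hu) (b := 1 / 4) (by norm_num) (by norm_num)
    have hpt : ∀ x : E, Real.exp (max (⟪u, x⟫ ^ 2 - b) 0 / 4) ≤
        1 + Real.exp (-(b / 4)) * Real.exp (1 / 4 * ⟪u, x⟫ ^ 2) := by
      intro x
      rw [← Real.exp_add]
      rcases le_total (⟪u, x⟫ ^ 2 - b) 0 with h | h
      · rw [max_eq_right h, zero_div, Real.exp_zero]
        linarith [Real.exp_pos (-(b / 4) + 1 / 4 * ⟪u, x⟫ ^ 2)]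
      · rw [max_eq_left h]
        have : (⟪u, x⟫ ^ 2 - b) / 4 = -(b / 4) + 1 / 4 * ⟪u, x⟫ ^ 2 := by ring
        rw [this]; linarith
    have i1 : Integrable (fun x => 1 + Real.exp (-(b / 4)) * Real.exp (1 / 4 * ⟪u, x⟫ ^ 2))
      (stdGaussian E) := (integrable_const _).add (hi.const_mul _)
    have i2 : Integrable (fun x => Real.exp (max (⟪u, x⟫ ^ 2 - b) 0 / 4)) (stdGaussian E) := by
      refine i1.mono' (by fun_prop) (ae_of_all _ fun x => ?_)
      rw [Real.norm_eq_abs, abs_of_pos (Real.exp_pos _)]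
      exact hpt x
    have h3 : ∫ x, Real.exp (max (⟪u, x⟫ ^ 2 - b) 0 / 4) ∂(stdGaussian E) ≤
        Real.exp (2 * Real.exp (-(b / 4))) := by
      refine (integral_mono i2 i1 hpt).trans ?_
      rw [integral_add (integrable_const _) (hi.const_mul _), integral_const_mul]
      simp only [integral_const, probReal_univ, one_smul]
      refine le_trans ?_ (Real.add_one_le_exp _)
      have h1 : (√(1 - 2 * (1 / 4 : ℝ)))⁻¹ ≤ 2 := by
        rw [inv_le_comm₀ (by apply Real.sqrt_pos.2; norm_num) (by norm_num)]
        apply Real.le_sqrt_of_sq_le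
        norm_num
      have := mul_le_mul_of_nonneg_left (hle.trans h1) (Real.exp_pos (-(b / 4))).le
      linarith
    have h4 := measureReal_sum_ge_le hzm hind hz (g := fun x => max (⟪u, x⟫ ^ 2 - b) 0 / 4)
      (by fun_prop) i2 h3 Finset.univ t
    refine h4.trans ?_
    rw [← Real.exp_nat_mul, ← Real.exp_add]
    apply Real.exp_le_exp.2
    simp
    linarith
  have hsub : {ω | ¬ ∀ s : Finset (Fin n), s.card ≤ k → ∀ (c : ℝ) (u : E),
      ∑ i ∈ s, (c + ⟪u, z i ω⟫) ^ 2 ≤ 6 * (b * k + 4 * t) * (c ^ 2 + ‖u‖ ^ 2)} ⊆ ⋃ u ∈ N, S u := by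
    intro ω hω
    by_contra hcon
    apply hω
    intro s hs c u
    simp only [Set.mem_iUnion, not_exists] at hcon
    have hB := fun v => weightedForm_apply s (fun _ => (1 : ℝ)) (fun i => innerSL ℝ (z i ω)) v
    have hs' : (s.card : ℝ) ≤ k := by exact_mod_cast hs
    have hnet : ∀ w ∈ N, ∑ i ∈ s, ⟪w, z i ω⟫ ^ 2 ≤ b * k + 4 * t := by
      intro w hw
      have h3 := hcon w hw
      simp only [S, Set.mem_ofPred_eq, not_le] at h3
      calc ∑ i ∈ s, ⟪w, z i ω⟫ ^ 2 ≤ ∑ i ∈ s, (b + 4 * (max (⟪w, z i ω⟫ ^ 2 - b) 0 / 4)) := by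
            gcongr with i _
            linarith [le_max_left (⟪w, z i ω⟫ ^ 2 - b) 0]
        _ = b * s.card + 4 * ∑ i ∈ s, max (⟪w, z i ω⟫ ^ 2 - b) 0 / 4 := by
            rw [Finset.sum_add_distrib, ← Finset.mul_sum]; simp [mul_comm]
        _ ≤ b * k + 4 * ∑ i, max (⟪w, z i ω⟫ ^ 2 - b) 0 / 4 := by
            gcongr
            exact Finset.subset_univ s
        _ ≤ b * k + 4 * t := by gcongr
    have h := abs_quadratic_le_of_net hN2
      (weightedForm s (fun _ => (1 : ℝ)) (fun i => innerSL ℝ (z i ω)))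
      (fun x y => by rw [hB, hB]; refine Finset.sum_congr rfl fun i _ => by ring)
      (t := b * k + 4 * t) (fun w hw => by
        rw [hB, abs_of_nonneg (Finset.sum_nonneg fun i _ => by
          rw [one_mul]; exact mul_self_nonneg _)]
        refine le_trans (le_of_eq ?_) (hnet w hw)
        refine Finset.sum_congr rfl fun i _ => ?_
        rw [innerSL_apply_apply, real_inner_comm]; ring) u
    have h5 : ∑ i ∈ s, ⟪u, z i ω⟫ ^ 2 ≤ 3 * (b * k + 4 * t) * ‖u‖ ^ 2 := by
      refine le_trans ?_ ((le_abs_self _).trans h)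
      rw [hB]
      apply le_of_eq
      refine Finset.sum_congr rfl fun i _ => ?_
      rw [innerSL_apply_apply, real_inner_comm]; ring
    obtain ⟨w0, hw0, -⟩ := hN2 0 (by simp)
    have ht0 : 0 ≤ t := by
      have h3 := hcon w0 hw0
      simp only [S, Set.mem_ofPred_eq, not_le] at h3
      refine le_trans (Finset.sum_nonneg fun i _ => ?_) h3.le
      positivity
    calc ∑ i ∈ s, (c + ⟪u, z i ω⟫) ^ 2 ≤ ∑ i ∈ s, (2 * c ^ 2 + 2 * ⟪u, z i ω⟫ ^ 2) := by
          gcongr with i _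
          nlinarith [sq_nonneg (c - ⟪u, z i ω⟫)]
      _ = 2 * s.card * c ^ 2 + 2 * ∑ i ∈ s, ⟪u, z i ω⟫ ^ 2 := by
          rw [Finset.sum_add_distrib, Finset.sum_const, nsmul_eq_mul, ← Finset.mul_sum]; ring
      _ ≤ 2 * (b * k) * c ^ 2 + 2 * (3 * (b * k + 4 * t) * ‖u‖ ^ 2) := by
          gcongr
          nlinarith
      _ ≤ _ := by
          have h6 : 0 ≤ c ^ 2 * (b * k) := by positivity
          have h7 : 0 ≤ t * c ^ 2 := by positivity
          nlinarith
  refine (measureReal_mono hsub (measure_ne_top _ _)).trans ((measureReal_biUnion_finset_le _ _).trans ?_)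
  refine (Finset.sum_le_sum hS).trans ?_
  rw [Finset.sum_const, nsmul_eq_mul]
  gcongr
  exact_mod_cast hNc

end Uniform

/-! ### Leave-one-out deviations, counts of atypical noise, exponential moments of the weights. -/

section Events

open scoped RealInnerProductSpace

lemma measureReal_le_of_indepFun {Ω α β : Type*} [MeasurableSpace Ω] [MeasurableSpace α]
    [MeasurableSpace β] {P : Measure Ω} [IsProbabilityMeasure P] {X : Ω → α} {Y : Ω → β}
    (hX : Measurable X) (hY : Measurable Y) (h : IndepFun X Y P) {A : Set (α × β)}
    (hA : MeasurableSet A) {p : ℝ} (hp : ∀ x, P.real {ω | (x, Y ω) ∈ A} ≤ p) :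
    P.real {ω | (X ω, Y ω) ∈ A} ≤ p := by
  have h0 : 0 ≤ p := by
    have : Nonempty Ω := nonempty_of_isProbabilityMeasure P
    exact measureReal_nonneg.trans (hp (X (Classical.arbitrary Ω)))
  have h1 := (indepFun_iff_map_prod_eq_prod_map_map hX.aemeasurable hY.aemeasurable).1 h
  have h2 : P {ω | (X ω, Y ω) ∈ A} = (P.map fun ω => (X ω, Y ω)) A := by
    rw [Measure.map_apply (hX.prodMk hY) hA]; rfl
  have : IsProbabilityMeasure (P.map X) := Measure.isProbabilityMeasure_map hX.aemeasurable
  have : IsProbabilityMeasure (P.map Y) := Measure.isProbabilityMeasure_map hY.aemeasurable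
  have h3 : P {ω | (X ω, Y ω) ∈ A} ≤ ENNReal.ofReal p := by
    rw [h2, h1, Measure.prod_apply hA]
    calc ∫⁻ x, (P.map Y) (Prod.mk x ⁻¹' A) ∂(P.map X) ≤ ∫⁻ x, ENNReal.ofReal p ∂(P.map X) := by
          refine lintegral_mono fun x => ?_
          rw [Measure.map_apply hY (measurable_prodMk_left hA)]
          have := hp x
          rw [measureReal_def] at this
          exact (ENNReal.le_ofReal_iff_toReal_le (measure_ne_top _ _) h0).2 this
      _ = ENNReal.ofReal p := by simp
  exact ENNReal.toReal_le_of_le_ofReal h0 h3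

variable {E : Type*} [NormedAddCommGroup E] [InnerProductSpace ℝ E] [FiniteDimensional ℝ E]
  [MeasurableSpace E] [BorelSpace E]
variable {Ω : Type*} [MeasurableSpace Ω] {P : Measure Ω} [IsProbabilityMeasure P]
  {n : ℕ} {z : Fin n → Ω → E}

lemma integral_affine_sq (c : ℝ) (u : E) :
    ∫ z, (c + ⟪u, z⟫) ^ 2 ∂(stdGaussian E) = c ^ 2 + ‖u‖ ^ 2 := by
  have h : ∀ z : E, (c + ⟪u, z⟫) ^ 2 = 2 * c * ⟪u, z⟫ + (c ^ 2 + ⟪u, z⟫ ^ 2) := by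
    intro z; ring
  simp only [h]
  have i0 : Integrable (fun z : E => ⟪u, z⟫) (stdGaussian E) := by
    simpa using integrable_inner_pow u 1
  have i2 : Integrable (fun z : E => c ^ 2 + ⟪u, z⟫ ^ 2) (stdGaussian E) :=
    (integrable_const _).add (integrable_inner_pow u 2)
  rw [integral_add (i0.const_mul _) i2, integral_add (integrable_const _) (integrable_inner_pow u 2),
    integral_inner_sq, integral_odd_stdGaussian _ (fun z => by simp)]
  simp

/-- The direction v(z_i) is independent of the other noise vectors. Conditionally on z_i it is a
fixed unit direction, so the scalar Bernstein bound applies and no net, hence no dimension factor,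
enters. -/
lemma measureReal_leave_one_out_le (hzm : ∀ i, Measurable (z i)) (hind : iIndepFun z P)
    (hz : ∀ i, HasLaw (z i) (stdGaussian E) P) {v : E → ℝ × E} (hv : Measurable v)
    (hv1 : ∀ x, (v x).1 ^ 2 + ‖(v x).2‖ ^ 2 = 1) {r : ℝ} (hr0 : 0 ≤ r) (hr : r ≤ 128) :
    P.real {ω | ¬ ∀ i, |∑ j ∈ Finset.univ.erase i, ((v (z i ω)).1 + ⟪(v (z i ω)).2, z j ω⟫) ^ 2 -
      ((n - 1 : ℕ) : ℝ)| ≤ ((n - 1 : ℕ) : ℝ) * r} ≤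
      n * (2 * Real.exp (-(((n - 1 : ℕ) : ℝ) * r ^ 2 / 4096))) := by
  classical
  let S : Fin n → Set Ω := fun i => {ω | ((n - 1 : ℕ) : ℝ) * r ≤
    |∑ j ∈ Finset.univ.erase i, ((v (z i ω)).1 + ⟪(v (z i ω)).2, z j ω⟫) ^ 2 -
      ((n - 1 : ℕ) : ℝ)|}
  have hS : ∀ i ∈ (Finset.univ : Finset (Fin n)),
      P.real (S i) ≤ 2 * Real.exp (-(((n - 1 : ℕ) : ℝ) * r ^ 2 / 4096)) := by
    intro i _
    have hdis : Disjoint ({i} : Finset (Fin n)) (Finset.univ.erase i) := by simp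
    have hI := hind.indepFun_finset {i} (Finset.univ.erase i) hdis hzm
    let X : Ω → E := z i
    let Y : Ω → ({j // j ∈ Finset.univ.erase i} → E) := fun ω j => z j ω
    have hXY : IndepFun X Y P := by
      have hev : Measurable fun f : ({j // j ∈ ({i} : Finset (Fin n))} → E) => f ⟨i, by simp⟩ :=
        measurable_pi_apply (X := fun _ : {j // j ∈ ({i} : Finset (Fin n))} => E) ⟨i, by simp⟩
      have := hI.comp (φ := fun f : ({j // j ∈ ({i} : Finset (Fin n))} → E) => f ⟨i, by simp⟩)
        (ψ := id) hev measurable_id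
      exact this
    have hY : Measurable Y := measurable_pi_lambda _ fun j => hzm j
    let A : Set (E × ({j // j ∈ Finset.univ.erase i} → E)) :=
      {p | ((n - 1 : ℕ) : ℝ) * r ≤ |∑ j : {j // j ∈ Finset.univ.erase i},
        ((v p.1).1 + ⟪(v p.1).2, p.2 j⟫) ^ 2 - ((n - 1 : ℕ) : ℝ)|}
    have hA : MeasurableSet A := by
      refine measurableSet_le measurable_const ?_
      fun_prop
    have hSA : S i = {ω | (X ω, Y ω) ∈ A} := by
      ext ω
      simp only [S, A, X, Y, Set.mem_ofPred_eq]
      rw [← Finset.sum_coe_sort (Finset.univ.erase i)]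
    rw [hSA]
    refine measureReal_le_of_indepFun (hzm i) hY hXY hA fun x => ?_
    have hx := hv1 x
    have h1 : |(v x).1| ≤ 1 := by
      rw [abs_le]; constructor <;> nlinarith [sq_nonneg ‖(v x).2‖]
    have h2 : ‖(v x).2‖ ≤ 1 := by nlinarith [sq_nonneg (v x).1, norm_nonneg (v x).2]
    have h3 := measureReal_weighted_sum_ge_le hzm hind hz (a := fun _ => 1) measurable_const
      (by simp) h1 h2 hr0 hr (Finset.univ.erase i) (m := 1) (by
        simp only [one_mul]; rw [integral_affine_sq, hx])
    have hc : (Finset.univ.erase i).card = n - 1 := by simp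
    rw [hc] at h3
    convert h3 using 3
    ext ω
    simp only [A, Y, Set.mem_ofPred_eq, one_mul, mul_one]
    rw [← Finset.sum_coe_sort (Finset.univ.erase i)]
  have hsub : {ω | ¬ ∀ i, |∑ j ∈ Finset.univ.erase i, ((v (z i ω)).1 +
      ⟪(v (z i ω)).2, z j ω⟫) ^ 2 - ((n - 1 : ℕ) : ℝ)| ≤ ((n - 1 : ℕ) : ℝ) * r} ⊆
      ⋃ i ∈ (Finset.univ : Finset (Fin n)), S i := by
    intro ω hω
    simp only [Set.mem_ofPred_eq, not_forall, not_le] at hω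
    obtain ⟨i, hi⟩ := hω
    simp only [Set.mem_iUnion]
    exact ⟨i, Finset.mem_univ i, hi.le⟩
  refine (measureReal_mono hsub (measure_ne_top _ _)).trans
    ((measureReal_biUnion_finset_le _ _).trans ((Finset.sum_le_sum hS).trans ?_))
  simp

lemma measureReal_inner_le_neg_le {e : E} (he : ‖e‖ = 1) {t : ℝ} (ht : 0 ≤ t) :
    (stdGaussian E).real {x | ⟪e, x⟫ ≤ -t} ≤ Real.exp (-(t ^ 2 / 2)) := by
  have hmap : (stdGaussian E).map (fun x => ⟪e, x⟫) = gaussianReal 0 1 := by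
    rw [map_inner_stdGaussian, he]; simp
  have hint : Integrable (fun x => Real.exp (-t * ⟪e, x⟫)) (stdGaussian E) := by
    have := (integrable_comp_inner_stdGaussian e (g := fun x => Real.exp (-t * x))
      (by fun_prop)).2 (by rw [he]; simpa using integrable_exp_mul_gaussianReal (μ := 0) (v := 1) (-t))
    exact this
  have h := measure_le_le_exp_mul_mgf (μ := stdGaussian E) (X := fun x => ⟪e, x⟫) (t := -t) (-t)
    (by linarith) hint
  rw [mgf_gaussianReal hmap, ← Real.exp_add] at h
  refine h.trans (Real.exp_le_exp.2 ?_)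
  simp
  nlinarith

/-- The exponential of an indicator is affine in it with slope e − 1 ≤ 2, which gives a Poisson-type
bound governed by the Gaussian tail. -/
lemma measureReal_count_ge_le (hzm : ∀ i, Measurable (z i)) (hind : iIndepFun z P)
    (hz : ∀ i, HasLaw (z i) (stdGaussian E) P) {e : E} (he : ‖e‖ = 1) {x : ℝ} (hx : 0 ≤ x) (t : ℝ) :
    P.real {ω | t ≤ ((Finset.univ.filter fun i => ⟪e, z i ω⟫ ≤ -x).card : ℝ)} ≤
      Real.exp (-t + 2 * n * Real.exp (-(x ^ 2 / 2))) := by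
  classical
  have hA : MeasurableSet {y : E | ⟪e, y⟫ ≤ -x} := measurableSet_le (by fun_prop) measurable_const
  let g : E → ℝ := Set.indicator {y : E | ⟪e, y⟫ ≤ -x} 1
  have hg : Measurable g := measurable_one.indicator hA
  have hexp : ∀ y, Real.exp (g y) = 1 + (Real.exp 1 - 1) * g y := by
    intro y
    by_cases h : y ∈ {y : E | ⟪e, y⟫ ≤ -x}
    · simp [g, Set.indicator_of_mem h]
    · simp [g, Set.indicator_of_notMem h]
  have hgi : Integrable g (stdGaussian E) := (integrable_const (1 : ℝ)).indicator hA
  have hi : Integrable (fun y => Real.exp (g y)) (stdGaussian E) := by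
    simp only [hexp]
    exact (integrable_const _).add (hgi.const_mul _)
  have hb : ∫ y, Real.exp (g y) ∂(stdGaussian E) ≤ Real.exp (2 * Real.exp (-(x ^ 2 / 2))) := by
    simp only [hexp]
    rw [integral_add (integrable_const _) (hgi.const_mul _), integral_const_mul,
      integral_indicator_one hA]
    simp only [integral_const, probReal_univ, one_smul]
    refine le_trans ?_ (Real.add_one_le_exp _)
    have h1 := measureReal_inner_le_neg_le he hx
    have h2 : Real.exp 1 - 1 ≤ 2 := by linarith [Real.exp_one_lt_d9]
    have h3 : 0 ≤ (stdGaussian E).real {y | ⟪e, y⟫ ≤ -x} := measureReal_nonneg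
    nlinarith [Real.add_one_le_exp (1 : ℝ)]
  have h := measureReal_sum_ge_le hzm hind hz hg hi hb Finset.univ t
  rw [← Real.exp_nat_mul, ← Real.exp_add] at h
  have hset : {ω | t ≤ ((Finset.univ.filter fun i => ⟪e, z i ω⟫ ≤ -x).card : ℝ)} =
      {ω | t ≤ ∑ i, g (z i ω)} := by
    ext ω
    simp only [Set.mem_ofPred_eq, g, Set.indicator_apply, Pi.one_apply]
    rw [Finset.sum_boole]
  rw [hset]
  refine h.trans (le_of_eq ?_)
  simp
  ring

lemma integral_exp_coord_le {e : E} (he : ‖e‖ = 1) {l : ℝ} (hl : |l| ≤ 1 / 16) :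
    Integrable (fun x => Real.exp (l * (⟪e, x⟫ ^ 2 - 1))) (stdGaussian E) ∧
      ∫ x, Real.exp (l * (⟪e, x⟫ ^ 2 - 1)) ∂(stdGaussian E) ≤ Real.exp (1024 * l ^ 2) := by
  obtain ⟨h1, -, h2⟩ := integral_exp_weighted_sq_le (E := E) (a := fun _ => 1) measurable_const
    (by simp) (c := 0) (by simp) he.le hl
  simp only [one_mul, zero_add, integral_inner_sq, he] at h1 h2
  have h3 : ∀ x : E, Real.exp (l * (⟪e, x⟫ ^ 2 - 1)) = Real.exp (-l) * Real.exp (l * ⟪e, x⟫ ^ 2) := by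
    intro x; rw [← Real.exp_add]; congr 1; ring
  simp only [h3]
  refine ⟨h1.const_mul _, ?_⟩
  rw [integral_const_mul]
  calc Real.exp (-l) * _ ≤ Real.exp (-l) * Real.exp (l * 1 ^ 2 + 1024 * l ^ 2) := by gcongr
    _ = _ := by rw [← Real.exp_add]; congr 1; ring

lemma integral_exp_abs_le {A : E → ℝ} (hA : Measurable A) {θ : ℝ}
    (h1 : Integrable (fun x => Real.exp (θ * A x)) (stdGaussian E))
    (h2 : Integrable (fun x => Real.exp (-θ * A x)) (stdGaussian E))
    (h3 : ∫ x, Real.exp (θ * A x) ∂(stdGaussian E) ≤ 2)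
    (h4 : ∫ x, Real.exp (-θ * A x) ∂(stdGaussian E) ≤ 2) (hθ : 0 ≤ θ) :
    Integrable (fun z => Real.exp (θ * |A z|)) (stdGaussian E) ∧
    ∫ z, Real.exp (θ * |A z|) ∂(stdGaussian E) ≤ 4 := by
  have hpt : ∀ x, Real.exp (θ * |A x|) ≤ Real.exp (θ * A x) + Real.exp (-θ * A x) := by
    intro x
    have := Real.exp_abs_le (θ * A x)
    rw [abs_mul, abs_of_nonneg hθ] at this
    simpa using this
  have hi : Integrable (fun z => Real.exp (θ * |A z|)) (stdGaussian E) := by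
    refine (h1.add h2).mono' (by fun_prop) (ae_of_all _ fun x => ?_)
    rw [Real.norm_eq_abs, abs_of_pos (Real.exp_pos _)]
    exact hpt x
  refine ⟨hi, (integral_mono hi (h1.add h2) hpt).trans ?_⟩
  simp only [Pi.add_apply]
  rw [integral_add h1 h2]
  linarith

lemma integral_exp_coord_abs_le {e : E} (he : ‖e‖ = 1) :
    Integrable (fun z => Real.exp (1 / 64 * |⟪e, z⟫ ^ 2 - 1|)) (stdGaussian E) ∧
    ∫ z, Real.exp (1 / 64 * |⟪e, z⟫ ^ 2 - 1|) ∂(stdGaussian E) ≤ 4 := by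
  have hb : Real.exp (1024 * (1 / 64 : ℝ) ^ 2) ≤ 2 := by
    have := Real.exp_bound_div_one_sub_of_interval (x := 1 / 4) (by norm_num) (by norm_num)
    norm_num at this ⊢
    linarith
  obtain ⟨h1, h3⟩ := integral_exp_coord_le he (l := 1 / 64) (by rw [abs_of_pos] <;> norm_num)
  obtain ⟨h2, h4⟩ := integral_exp_coord_le he (l := -(1 / 64)) (by rw [abs_neg, abs_of_pos] <;> norm_num)
  rw [neg_sq] at h4
  exact integral_exp_abs_le (by fun_prop) h1 h2 (h3.trans hb) (h4.trans hb) (by norm_num)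

lemma integral_exp_norm_sq_le {d : ℕ} {l : ℝ} (hl : |l| ≤ 1 / 16) :
    Integrable (fun x : EuclideanSpace ℝ (Fin d) => Real.exp (l * (‖x‖ ^ 2 - d))) (stdGaussian _) ∧
      ∫ x : EuclideanSpace ℝ (Fin d), Real.exp (l * (‖x‖ ^ 2 - d)) ∂(stdGaussian _) ≤
        Real.exp (1024 * l ^ 2 * d) := by
  have h0 := integral_exp_coord_le (E := ℝ) (e := 1) (by simp) hl
  have hid : stdGaussian ℝ = gaussianReal 0 1 := by
    have := map_inner_stdGaussian (1 : ℝ)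
    simpa using this
  rw [hid] at h0
  simp only [RCLike.inner_apply, conj_trivial, mul_one] at h0
  obtain ⟨hi, hle⟩ := h0
  have hpt : ∀ x : Fin d → ℝ, Real.exp (l * (‖WithLp.toLp 2 x‖ ^ 2 - d)) =
      ∏ i, Real.exp (l * (x i ^ 2 - 1)) := by
    intro x
    rw [← Real.exp_sum, EuclideanSpace.real_norm_sq_eq]
    congr 1
    rw [← Finset.mul_sum, Finset.sum_sub_distrib]
    simp
  have hm : Measurable (WithLp.toLp 2 : (Fin d → ℝ) → EuclideanSpace ℝ (Fin d)) := by fun_prop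
  rw [← map_pi_eq_stdGaussian]
  constructor
  · rw [integrable_map_measure (by fun_prop) hm.aemeasurable]
    have : ((fun x : EuclideanSpace ℝ (Fin d) => Real.exp (l * (‖x‖ ^ 2 - d))) ∘ WithLp.toLp 2) =
        fun x : Fin d → ℝ => ∏ i, Real.exp (l * (x i ^ 2 - 1)) := by
      ext x; exact hpt x
    rw [this]
    exact Integrable.fintype_prod (f := fun _ y => Real.exp (l * (y ^ 2 - 1))) fun _ => hi
  · rw [integral_map hm.aemeasurable (by fun_prop)]
    simp only [hpt]
    rw [integral_fintype_prod_eq_pow (fun y => Real.exp (l * (y ^ 2 - 1)))]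
    calc _ ≤ (Real.exp (1024 * l ^ 2)) ^ Fintype.card (Fin d) := by
          gcongr
      _ = _ := by rw [← Real.exp_nat_mul]; congr 1; simp [mul_comm]

/-- The fluctuations of ‖x‖² are of order √d. The rate 1/(64√d) turns the variance factor 1024 θ² d
into 1/4, uniformly in the dimension. -/
lemma integral_exp_norm_sq_abs_le {d : ℕ} (hd : 0 < d) :
    Integrable (fun x : EuclideanSpace ℝ (Fin d) => Real.exp (1 / (64 * √d) * |‖x‖ ^ 2 - d|))
      (stdGaussian _) ∧
    ∫ x : EuclideanSpace ℝ (Fin d), Real.exp (1 / (64 * √d) * |‖x‖ ^ 2 - d|) ∂(stdGaussian _) ≤ 4 := by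
  have hd1 : (1 : ℝ) ≤ d := by exact_mod_cast hd
  have hs : 1 ≤ √(d : ℝ) := Real.one_le_sqrt.2 hd1
  have hs2 : √(d : ℝ) ^ 2 = d := Real.sq_sqrt (by linarith)
  have hl : |1 / (64 * √(d : ℝ))| ≤ 1 / 16 := by
    rw [abs_of_pos (by positivity)]
    apply one_div_le_one_div_of_le <;> linarith
  have hb : Real.exp (1024 * (1 / (64 * √(d : ℝ))) ^ 2 * d) ≤ 2 := by
    have h : 1024 * (1 / (64 * √(d : ℝ))) ^ 2 * d = 1 / 4 := by
      rw [div_pow, mul_pow, hs2]; field_simp; norm_num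
    rw [h]
    have := Real.exp_bound_div_one_sub_of_interval (x := 1 / 4) (by norm_num) (by norm_num)
    norm_num at this ⊢
    linarith
  obtain ⟨h1, h3⟩ := integral_exp_norm_sq_le (d := d) hl
  obtain ⟨h2, h4⟩ := integral_exp_norm_sq_le (d := d) (l := -(1 / (64 * √(d : ℝ)))) (by rwa [abs_neg])
  rw [neg_sq] at h4
  exact integral_exp_abs_le (by fun_prop) h1 h2 (h3.trans hb) (h4.trans hb) (by positivity)

lemma integral_norm_sq_mul {d : ℕ} (c : ℝ) (u : EuclideanSpace ℝ (Fin d)) :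
    Integrable (fun x => (‖x‖ ^ 2 - d) * (c + ⟪u, x⟫) ^ 2) (stdGaussian _) ∧
      ∫ x, (‖x‖ ^ 2 - d) * (c + ⟪u, x⟫) ^ 2 ∂(stdGaussian _) = 2 * ‖u‖ ^ 2 := by
  let b := EuclideanSpace.basisFun (Fin d) ℝ
  have h : ∀ x : EuclideanSpace ℝ (Fin d), (‖x‖ ^ 2 - d) * (c + ⟪u, x⟫) ^ 2 =
      ∑ i, (⟪b i, x⟫ ^ 2 - 1) * (c + ⟪u, x⟫) ^ 2 := by
    intro x
    rw [← Finset.sum_mul, Finset.sum_sub_distrib, b.sum_sq_inner_right]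
    simp
  simp only [h]
  refine ⟨integrable_finsetSum _ fun i _ => integrable_coord_mul _ _ _, ?_⟩
  rw [integral_finsetSum _ fun i _ => integrable_coord_mul _ _ _]
  simp only [fun i => integral_coord_mul (b.norm_eq_one i) c u]
  rw [← Finset.mul_sum, b.sum_sq_inner_right]

end Events

/-! ### The least squares step under regular noise. -/

section Deterministic

open scoped RealInnerProductSpace

variable {E : Type*} [NormedAddCommGroup E] [InnerProductSpace ℝ E] {n : ℕ}

/-- The empirical second moments of the functionals `c + ⟪u, z i⟫` are within relative error `ε`
of their expectation under the standard Gaussian law. -/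
def CovClose (z : Fin n → E) (ε : ℝ) : Prop :=
  ∀ (c : ℝ) (u : E), |(n : ℝ)⁻¹ * ∑ i, (c + ⟪u, z i⟫) ^ 2 - (c ^ 2 + ‖u‖ ^ 2)| ≤
    ε * (c ^ 2 + ‖u‖ ^ 2)

/-- Over at most `k` indices, the sum of the squares of the functionals `c + ⟪u, z i⟫` is at most
`σ n (c² + ‖u‖²)`. -/
def SubsetBound (z : Fin n → E) (k : ℕ) (σ : ℝ) : Prop :=
  ∀ s : Finset (Fin n), s.card ≤ k → ∀ (c : ℝ) (u : E),
    ∑ i ∈ s, (c + ⟪u, z i⟫) ^ 2 ≤ σ * n * (c ^ 2 + ‖u‖ ^ 2)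

/-- The values at the (whitened, sign-corrected) samples `m e + z i` of the linear functional
given by `b`. -/
noncomputable def fitted (e : E) (m : ℝ) (z : Fin n → E) (b : E) (i : Fin n) : ℝ :=
  m * ⟪e, b⟫ + ⟪b, z i⟫

/-- The population second moment `‖b‖² + m² ⟪e, b⟫²` of `fitted`. -/
noncomputable def energy (e : E) (m : ℝ) (b : E) : ℝ := (m * ⟪e, b⟫) ^ 2 + ‖b‖ ^ 2

lemma energy_nonneg (e : E) (m : ℝ) (b : E) : 0 ≤ energy e m b := by
  unfold energy; positivity

lemma fitted_sub (e : E) (m : ℝ) (z : Fin n → E) (a b : E) (i : Fin n) :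
    fitted e m z (a - b) i = fitted e m z a i - fitted e m z b i := by
  simp only [fitted, inner_sub_left, inner_sub_right]; ring

lemma fitted_smul (e : E) (m : ℝ) (z : Fin n → E) (t : ℝ) (b : E) (i : Fin n) :
    fitted e m z (t • b) i = t * fitted e m z b i := by
  simp only [fitted, real_inner_smul_left, real_inner_smul_right]; ring

lemma fitted_direction {e : E} (he : ‖e‖ = 1) (m : ℝ) (z : Fin n → E) (i : Fin n) :
    fitted e m z e i = m + ⟪e, z i⟫ := by
  simp [fitted, he]

variable {z : Fin n → E} {ε : ℝ}

lemma CovClose.bilin (h : CovClose z ε) (c : ℝ) (u : E) (c' : ℝ) (u' : E)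
    (h1 : c ^ 2 + ‖u‖ ^ 2 ≤ 1) :
    |(n : ℝ)⁻¹ * ∑ i, (c + ⟪u, z i⟫) * (c' + ⟪u', z i⟫) - (c * c' + ⟪u, u'⟫)| ≤
      ε * √(c' ^ 2 + ‖u'‖ ^ 2) := by
  set X := √(c' ^ 2 + ‖u'‖ ^ 2) with hX
  have hX2 : X ^ 2 = c' ^ 2 + ‖u'‖ ^ 2 := Real.sq_sqrt (by positivity)
  have hX0 : 0 ≤ X := Real.sqrt_nonneg _
  have hε : 0 ≤ ε := by
    have := (abs_nonneg _).trans (h 1 0)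
    simpa using this
  rcases hX0.eq_or_lt with hX0 | hX0
  · rw [← hX0] at hX2
    have hc : c' = 0 := by nlinarith [sq_nonneg c', sq_nonneg ‖u'‖]
    have hu : u' = 0 := by
      rw [← norm_eq_zero]; nlinarith [sq_nonneg c', sq_nonneg ‖u'‖]
    simp [hc, hu, ← hX0]
  -- Scaling (c, u) by X balances the two arguments before polarizing, so that the error is linear
  -- in the norm X of the second one.
  have hp := h (X * c + c') (X • u + u')
  have hm := h (X * c - c') (X • u - u')
  have hpol : 4 * X * ((n : ℝ)⁻¹ * ∑ i, (c + ⟪u, z i⟫) * (c' + ⟪u', z i⟫) - (c * c' + ⟪u, u'⟫)) =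
      ((n : ℝ)⁻¹ * ∑ i, (X * c + c' + ⟪X • u + u', z i⟫) ^ 2 -
        ((X * c + c') ^ 2 + ‖X • u + u'‖ ^ 2)) -
      ((n : ℝ)⁻¹ * ∑ i, (X * c - c' + ⟪X • u - u', z i⟫) ^ 2 -
        ((X * c - c') ^ 2 + ‖X • u - u'‖ ^ 2)) := by
    have hs : ∑ i, (X * c + c' + ⟪X • u + u', z i⟫) ^ 2 -
        ∑ i, (X * c - c' + ⟪X • u - u', z i⟫) ^ 2 =
        4 * X * ∑ i, (c + ⟪u, z i⟫) * (c' + ⟪u', z i⟫) := by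
      rw [← Finset.sum_sub_distrib, Finset.mul_sum]
      refine Finset.sum_congr rfl fun i _ => ?_
      simp only [inner_add_left, inner_sub_left, real_inner_smul_left]
      ring
    rw [norm_add_sq_real, norm_sub_sq_real, real_inner_smul_left]
    linear_combination -(n : ℝ)⁻¹ * hs
  have hsum : (X * c + c') ^ 2 + ‖X • u + u'‖ ^ 2 + ((X * c - c') ^ 2 + ‖X • u - u'‖ ^ 2) ≤
      4 * X ^ 2 := by
    rw [norm_add_sq_real, norm_sub_sq_real, norm_smul, Real.norm_of_nonneg hX0.le]
    nlinarith [sq_nonneg X]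
  have habs : 4 * X * |(n : ℝ)⁻¹ * ∑ i, (c + ⟪u, z i⟫) * (c' + ⟪u', z i⟫) - (c * c' + ⟪u, u'⟫)| ≤
      ε * (4 * X ^ 2) := by
    rw [← abs_of_pos (by positivity : 0 < 4 * X), ← abs_mul, hpol]
    refine (abs_sub _ _).trans ?_
    calc _ ≤ _ := add_le_add hp hm
      _ = ε * ((X * c + c') ^ 2 + ‖X • u + u'‖ ^ 2 + ((X * c - c') ^ 2 + ‖X • u - u'‖ ^ 2)) := by ring
      _ ≤ _ := by gcongr
  nlinarith

variable {e : E} {m : ℝ}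

lemma CovClose.fitted_sq (h : CovClose z ε) (b : E) :
    |(n : ℝ)⁻¹ * ∑ i, fitted e m z b i ^ 2 - energy e m b| ≤ ε * energy e m b :=
  h (m * ⟪e, b⟫) b

/-- The least squares fit to a sign pattern with `-1` on `B` and `1` elsewhere is close to the
population direction. -/
lemma energy_fit_sub_le (hn : 0 < n) (he : ‖e‖ = 1) (hcov : CovClose z ε)
    (hε : ε ≤ 1 / 4) {B : Finset (Fin n)} {σ : ℝ} (hσ : 0 ≤ σ)
    (hsub : ∀ (c : ℝ) (u : E), ∑ i ∈ B, (c + ⟪u, z i⟫) ^ 2 ≤ σ * n * (c ^ 2 + ‖u‖ ^ 2))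
    {b : E} (hb : ∀ u, ∑ i, (fitted e m z b i - if i ∈ B then -1 else 1) * fitted e m z u i = 0) :
    energy e m (b - (m / (1 + m ^ 2)) • e) ≤ 4 * ε ^ 2 + 16 * (B.card / n) * σ := by
  have hn' : (0 : ℝ) < n := by exact_mod_cast hn
  -- The population coefficient in the regression of the constant 1 on m + ⟪e,z⟫; the identity `htm`
  -- is its normal equation.
  set t := m / (1 + m ^ 2) with ht
  set θ := b - t • e with hθ
  have htm : t * (1 + m ^ 2) = m := by rw [ht]; field_simp
  set X := √(energy e m θ) with hX
  have hX2 : X ^ 2 = energy e m θ := Real.sq_sqrt (energy_nonneg _ _ _)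
  have hX0 : 0 ≤ X := Real.sqrt_nonneg _
  have hε0 : 0 ≤ ε := by
    have := (abs_nonneg _).trans (hcov 1 0)
    simpa using this
  have hbθ : ∀ i, fitted e m z b i = t * (m + ⟪e, z i⟫) + fitted e m z θ i := by
    intro i
    rw [hθ, fitted_sub, fitted_smul, fitted_direction he]; ring
  -- The normal equations tested against the error θ itself, with the target written as 1 − 2·1_B.
  have hvar : (n : ℝ)⁻¹ * ∑ i, fitted e m z θ i ^ 2 =
      (n : ℝ)⁻¹ * ∑ i, ((1 - m * t) + ⟪-(t • e), z i⟫) * (m * ⟪e, θ⟫ + ⟪θ, z i⟫) -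
        2 * ((n : ℝ)⁻¹ * ∑ i ∈ B, fitted e m z θ i) := by
    have h1 := hb θ
    have h2 : ∑ i ∈ B, fitted e m z θ i = ∑ i, (if i ∈ B then fitted e m z θ i else 0) := by
      rw [Finset.sum_ite_mem, Finset.univ_inter]
    rw [h2]
    have h3 : ∑ i, fitted e m z θ i ^ 2 =
        ∑ i, ((1 - m * t) + ⟪-(t • e), z i⟫) * (m * ⟪e, θ⟫ + ⟪θ, z i⟫) -
        2 * ∑ i, (if i ∈ B then fitted e m z θ i else 0) := by
      rw [Finset.mul_sum, ← Finset.sum_sub_distrib, ← sub_eq_zero, ← Finset.sum_sub_distrib]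
      refine (Finset.sum_congr rfl fun i _ => ?_).trans h1
      rw [hbθ i, inner_neg_left, real_inner_smul_left]
      rw [show m * ⟪e, θ⟫ + ⟪θ, z i⟫ = fitted e m z θ i from rfl]
      split_ifs <;> ring
    rw [h3]; ring
  have hbil := hcov.bilin (1 - m * t) (-(t • e)) (m * ⟪e, θ⟫) θ (by
    rw [norm_neg, norm_smul, he, mul_one, Real.norm_eq_abs, sq_abs]
    have h1 : 1 - m * t = 1 / (1 + m ^ 2) := by rw [ht]; field_simp; ring
    have h2 : (1 - m * t) ^ 2 + t ^ 2 = 1 / (1 + m ^ 2) := by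
      rw [h1, ht]; field_simp
    rw [h2, div_le_one (by positivity)]
    nlinarith [sq_nonneg m])
  -- The population residual 1 − t(m + ⟪e,z⟫) is uncorrelated with every fit, so its empirical
  -- covariance with θ is pure fluctuation of order ε.
  have hzero : (1 - m * t) * (m * ⟪e, θ⟫) + ⟪-(t • e), θ⟫ = 0 := by
    rw [inner_neg_left, real_inner_smul_left]
    linear_combination (-⟪e, θ⟫) * htm
  rw [hzero, sub_zero] at hbil
  have hXe : √((m * ⟪e, θ⟫) ^ 2 + ‖θ‖ ^ 2) = X := rfl
  rw [hXe] at hbil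
  have hlow := (abs_le.1 (hcov.fitted_sq (e := e) (m := m) θ)).1
  set y := √((B.card / n : ℝ) * σ) with hy
  have hy0 : 0 ≤ y := Real.sqrt_nonneg _
  have hy2 : y ^ 2 = (B.card / n : ℝ) * σ := Real.sq_sqrt (by positivity)
  -- Cauchy–Schwarz on B alone: the wrong labels enter through |B|/n times the second moment that B
  -- can carry, which is what makes the iteration contract.
  have hBsum : |(n : ℝ)⁻¹ * ∑ i ∈ B, fitted e m z θ i| ≤ y * X := by
    apply abs_le_of_sq_le_sq _ (by positivity)
    have h1 := sq_sum_le_card_mul_sum_sq (s := B) (f := fun i => fitted e m z θ i)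
    have h2 : ∑ i ∈ B, fitted e m z θ i ^ 2 ≤ σ * n * X ^ 2 := by
      rw [hX2]; exact hsub _ _
    have h3 : (B.card : ℝ) * ∑ i ∈ B, fitted e m z θ i ^ 2 ≤ B.card * (σ * n * X ^ 2) := by gcongr
    calc ((n : ℝ)⁻¹ * ∑ i ∈ B, fitted e m z θ i) ^ 2 =
          ((n : ℝ)⁻¹) ^ 2 * (∑ i ∈ B, fitted e m z θ i) ^ 2 := by ring
      _ ≤ ((n : ℝ)⁻¹) ^ 2 * (B.card * (σ * n * X ^ 2)) := by gcongr; exact h1.trans h3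
      _ = (y * X) ^ 2 := by rw [mul_pow, hy2]; field_simp
  have hmain : 3 / 4 * X ^ 2 ≤ (ε + 2 * y) * X := by
    have h1 := (abs_le.1 hbil).2
    have h2 := (abs_le.1 hBsum).1
    rw [← hX2] at hlow
    nlinarith [sq_nonneg X]
  rw [← hX2]
  rcases hX0.eq_or_lt with hX0 | hX0
  · rw [← hX0]
    have : 0 ≤ 16 * (B.card / n : ℝ) * σ := by positivity
    nlinarith [sq_nonneg ε]
  have hXle : X ≤ 4 / 3 * (ε + 2 * y) := by nlinarith
  have : X ^ 2 ≤ (4 / 3 * (ε + 2 * y)) ^ 2 := by gcongr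
  nlinarith [sq_nonneg (ε - 2 * y), sq_nonneg ε, sq_nonneg y]

lemma fitted_eq_main_add (he : ‖e‖ = 1) (b : E) (t : ℝ) (i : Fin n) :
    fitted e m z b i = t * (m + ⟪e, z i⟫) + fitted e m z (b - t • e) i := by
  rw [fitted_sub, fitted_smul, fitted_direction he]; ring

/-- As tm ≥ 1/2 for t = m/(1 + m²), a noise margin δm leaves a main part t(m + ⟪e,z_i⟫) above δ/2.
Only a residual of at least that size can then make the fit nonpositive. -/
lemma noise_le_or_residual_ge (he : ‖e‖ = 1) (hm : 1 ≤ m) {δ : ℝ} (hδ : 0 < δ) {b : E} {i : Fin n}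
    (h : fitted e m z b i ≤ 0) :
    ⟪e, z i⟫ ≤ -((1 - δ) * m) ∨ δ ^ 2 / 4 ≤ fitted e m z (b - (m / (1 + m ^ 2)) • e) i ^ 2 := by
  rw [fitted_eq_main_add he b (m / (1 + m ^ 2))] at h
  by_contra! hcon
  obtain ⟨h1, h2⟩ := hcon
  set w := fitted e m z (b - (m / (1 + m ^ 2)) • e) i
  have ht : 1 / 2 ≤ m / (1 + m ^ 2) * m := by
    rw [div_mul_eq_mul_div, le_div_iff₀ (by positivity)]; nlinarith
  have ht0 : 0 < m / (1 + m ^ 2) := by positivity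
  have h3 : m / (1 + m ^ 2) * (δ * m) < m / (1 + m ^ 2) * (m + ⟪e, z i⟫) := by
    gcongr; linarith
  have h4 : δ / 2 < -w := by nlinarith
  nlinarith

/-- Large residuals are counted by Markov's inequality on their mean square. This control on average
is enough for contraction but leaves an error floor. -/
lemma card_fitted_nonpos_le (hn : 0 < n) (he : ‖e‖ = 1) (hm : 1 ≤ m) (hcov : CovClose z ε)
    (hε : ε ≤ 1 / 4) {δ : ℝ} (hδ : 0 < δ) {b : E} {κ : ℝ}
    (hκ : energy e m (b - (m / (1 + m ^ 2)) • e) ≤ κ) :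
    ((Finset.univ.filter fun i => fitted e m z b i ≤ 0).card : ℝ) ≤
      (Finset.univ.filter fun i => ⟪e, z i⟫ ≤ -((1 - δ) * m)).card + 5 / δ ^ 2 * κ * n := by
  classical
  have hn' : (0 : ℝ) < n := by exact_mod_cast hn
  set θ := b - (m / (1 + m ^ 2)) • e with hθ
  have hsub : (Finset.univ.filter fun i => fitted e m z b i ≤ 0) ⊆
      (Finset.univ.filter fun i => ⟪e, z i⟫ ≤ -((1 - δ) * m)) ∪
      (Finset.univ.filter fun i => δ ^ 2 / 4 ≤ fitted e m z θ i ^ 2) := by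
    intro i hi
    simp only [Finset.mem_union, Finset.mem_filter, Finset.mem_univ, true_and] at hi ⊢
    exact noise_le_or_residual_ge he hm hδ hi
  have h1 := (Finset.card_le_card hsub).trans (Finset.card_union_le _ _)
  have h2 : ((Finset.univ.filter fun i => δ ^ 2 / 4 ≤ fitted e m z θ i ^ 2).card : ℝ) * (δ ^ 2 / 4) ≤
      ∑ i, fitted e m z θ i ^ 2 := by
    rw [← nsmul_eq_mul]
    refine (Finset.card_nsmul_le_sum _ _ _ fun i hi => (Finset.mem_filter.1 hi).2).trans ?_
    exact Finset.sum_le_sum_of_subset_of_nonneg (Finset.filter_subset _ _) fun i _ _ => sq_nonneg _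
  have h3 := (abs_le.1 (hcov.fitted_sq (e := e) (m := m) θ)).2
  have h4 : (n : ℝ)⁻¹ * ∑ i, fitted e m z θ i ^ 2 ≤ 5 / 4 * κ := by
    nlinarith [energy_nonneg e m θ]
  have h5 : ∑ i, fitted e m z θ i ^ 2 ≤ 5 / 4 * κ * n := by
    rw [inv_mul_le_iff₀ hn'] at h4; linarith
  have h6 : ((Finset.univ.filter fun i => δ ^ 2 / 4 ≤ fitted e m z θ i ^ 2).card : ℝ) ≤
      5 / δ ^ 2 * κ * n := by
    have h7 := h2.trans h5
    rw [← le_div_iff₀ (by positivity)] at h7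
    refine h7.trans (le_of_eq ?_)
    field_simp
  have h8 : ((Finset.univ.filter fun i => fitted e m z b i ≤ 0).card : ℝ) ≤
      (Finset.univ.filter fun i => ⟪e, z i⟫ ≤ -((1 - δ) * m)).card +
      (Finset.univ.filter fun i => δ ^ 2 / 4 ≤ fitted e m z θ i ^ 2).card := by exact_mod_cast h1
  linarith

lemma fitted_sq_le {ρ : ℝ} {i : Fin n} (hρ : ‖z i‖ ^ 2 ≤ ρ) (b : E) :
    fitted e m z b i ^ 2 ≤ 2 * (1 + ρ) * energy e m b := by
  have h1 : ⟪b, z i⟫ ^ 2 ≤ ‖b‖ ^ 2 * ‖z i‖ ^ 2 := by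
    rw [← mul_pow, ← sq_abs]
    gcongr
    exact abs_real_inner_le_norm b (z i)
  have h2 : ‖b‖ ^ 2 * ‖z i‖ ^ 2 ≤ ‖b‖ ^ 2 * ρ := by gcongr
  have h3 : 0 ≤ ρ := (sq_nonneg _).trans hρ
  unfold fitted energy
  nlinarith [sq_nonneg (m * ⟪e, b⟫ - ⟪b, z i⟫), mul_nonneg h3 (sq_nonneg (m * ⟪e, b⟫)),
    sq_nonneg ‖b‖]

/-- Residuals are bounded one by one through ‖z_i‖² instead of on average. Once all are below δ/2,
the floor disappears. -/
lemma card_fitted_nonpos_le_of_small (he : ‖e‖ = 1) (hm : 1 ≤ m) {δ : ℝ} (hδ : 0 < δ)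
    {b : E} {ρ : ℝ} (hρ : ∀ i, ‖z i‖ ^ 2 ≤ ρ)
    (hκ : 2 * (1 + ρ) * energy e m (b - (m / (1 + m ^ 2)) • e) < δ ^ 2 / 4) :
    (Finset.univ.filter fun i => fitted e m z b i ≤ 0).card ≤
      (Finset.univ.filter fun i => ⟪e, z i⟫ ≤ -((1 - δ) * m)).card := by
  refine Finset.card_le_card fun i hi => ?_
  simp only [Finset.mem_filter, Finset.mem_univ, true_and] at hi ⊢
  refine (noise_le_or_residual_ge he hm hδ hi).resolve_right fun h => ?_
  exact absurd (h.trans (fitted_sq_le (hρ i) _)) (not_le.2 hκ)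

end Deterministic

/-! ### The spectral initialization: leverage scores and the Rayleigh quotient. -/

section Spectral

open scoped RealInnerProductSpace

variable {E : Type*} [NormedAddCommGroup E] [InnerProductSpace ℝ E] {n : ℕ}
variable {z : Fin n → E} {ε : ℝ} {e : E} {m : ℝ}

/-- The squared norm of the sample `m e + x` after whitening by its population covariance. -/
noncomputable def whitenedSq (e : E) (m : ℝ) (x : E) : ℝ :=
  ‖x‖ ^ 2 - ⟪e, x⟫ ^ 2 + (m + ⟪e, x⟫) ^ 2 / (1 + m ^ 2)

/-- The sample `m e + x` multiplied by the inverse of its population covariance. -/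
noncomputable def precisionVec (e : E) (m : ℝ) (x : E) : E :=
  x + ((m + ⟪e, x⟫) / (1 + m ^ 2) - ⟪e, x⟫) • e

lemma inner_precisionVec (he : ‖e‖ = 1) (x : E) :
    ⟪e, precisionVec e m x⟫ = (m + ⟪e, x⟫) / (1 + m ^ 2) := by
  rw [precisionVec, inner_add_right, real_inner_smul_right, real_inner_self_eq_norm_sq, he]
  ring

/-- For the bilinear form attached to `energy`, `precisionVec` is the Riesz representer of
evaluation at the i-th sample. Hence its energy and its own value at i are both `whitenedSq`, the
population leverage. -/
lemma fitted_eq_inner_precisionVec (he : ‖e‖ = 1) (b : E) (i : Fin n) :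
    fitted e m z b i = m * ⟪e, precisionVec e m (z i)⟫ * (m * ⟪e, b⟫) +
      ⟪precisionVec e m (z i), b⟫ := by
  rw [inner_precisionVec he, precisionVec, inner_add_left, real_inner_smul_left, fitted,
    real_inner_comm b (z i)]
  field_simp
  ring

lemma energy_precisionVec (he : ‖e‖ = 1) (x : E) :
    energy e m (precisionVec e m x) = whitenedSq e m x := by
  rw [energy, inner_precisionVec he, precisionVec, norm_add_sq_real, norm_smul, he,
    real_inner_smul_right, real_inner_comm e x, whitenedSq, mul_one, Real.norm_eq_abs, sq_abs]
  field_simp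
  ring

lemma fitted_precisionVec_self (he : ‖e‖ = 1) (i : Fin n) :
    fitted e m z (precisionVec e m (z i)) i = whitenedSq e m (z i) := by
  rw [fitted_eq_inner_precisionVec he, ← energy_precisionVec he, energy,
    real_inner_self_eq_norm_sq]
  ring

lemma whitenedSq_le (x : E) : whitenedSq e m x ≤ ‖x‖ ^ 2 + 1 := by
  have : (m + ⟪e, x⟫) ^ 2 / (1 + m ^ 2) ≤ 1 + ⟪e, x⟫ ^ 2 := by
    rw [div_le_iff₀ (by positivity)]
    nlinarith [sq_nonneg (m * ⟪e, x⟫ - 1)]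
  unfold whitenedSq
  linarith

lemma whitenedSq_nonneg (he : ‖e‖ = 1) (x : E) : 0 ≤ whitenedSq e m x := by
  rw [← energy_precisionVec he]; exact energy_nonneg _ _ _

/-- A leverage score `f θ i`, given by its reproducing property, is close to its population
counterpart. -/
lemma abs_leverage_sub_le (hn : 0 < n) (he : ‖e‖ = 1) (hcov : CovClose z ε) (hε : ε ≤ 1 / 4)
    {r : ℝ} {i : Fin n}
    (hloo : |∑ j ∈ Finset.univ.erase i, fitted e m z (precisionVec e m (z i)) j ^ 2 -
      (n - 1 : ℝ) * whitenedSq e m (z i)| ≤ (n - 1 : ℝ) * r * whitenedSq e m (z i)) (hr : 0 ≤ r)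
    {θ : E} (hθ : ∀ u, (n : ℝ)⁻¹ * ∑ j, fitted e m z θ j * fitted e m z u j = fitted e m z u i) :
    |fitted e m z θ i - whitenedSq e m (z i)| ≤
      whitenedSq e m (z i) ^ 2 / n + whitenedSq e m (z i) / n + r * whitenedSq e m (z i) +
        2 * ε ^ 2 * whitenedSq e m (z i) := by
  have hn' : (0 : ℝ) < n := by exact_mod_cast hn
  have hε0 : 0 ≤ ε := by
    have := (abs_nonneg _).trans (hcov 1 0)
    simpa using this
  set g := precisionVec e m (z i) with hg
  set l := whitenedSq e m (z i) with hl
  have hl0 : 0 ≤ l := whitenedSq_nonneg he _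
  have hgi : fitted e m z g i = l := fitted_precisionVec_self he i
  have hgl : energy e m g = l := energy_precisionVec he _
  set M := (n : ℝ)⁻¹ * ∑ j, fitted e m z g j ^ 2 with hM
  -- The i-th term of M is the only one whose sample also determines g. It contributes l²/n; the
  -- other n − 1 terms are covered by the leave-one-out hypothesis.
  have hMe : |M - l| ≤ l ^ 2 / n + l / n + r * l := by
    have h1 : M - l = l ^ 2 / n - l / n +
        (n : ℝ)⁻¹ * (∑ j ∈ Finset.univ.erase i, fitted e m z g j ^ 2 - (n - 1 : ℝ) * l) := by
      rw [hM, ← Finset.add_sum_erase _ _ (Finset.mem_univ i), hgi]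
      field_simp
      ring
    have h2 : |(n : ℝ)⁻¹ * (∑ j ∈ Finset.univ.erase i, fitted e m z g j ^ 2 - (n - 1 : ℝ) * l)| ≤
        r * l := by
      rw [abs_mul, abs_of_pos (by positivity), inv_mul_le_iff₀ hn']
      refine hloo.trans ?_
      nlinarith [mul_nonneg hr hl0]
    rw [h1]
    refine (abs_add_le _ _).trans (add_le_add ((abs_sub _ _).trans ?_) h2)
    rw [abs_of_nonneg (by positivity), abs_of_nonneg (by positivity)]
  set D := fitted e m z θ i with hD
  set w := θ - g with hw
  -- Expanding the empirical energy of θ − g by the reproducing property gives D = 2l − M up to a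
  -- square. The covariance error therefore enters as ε² l, not ε l.
  have hDD : (n : ℝ)⁻¹ * ∑ j, fitted e m z w j ^ 2 = D - 2 * l + M := by
    have h1 := hθ θ
    have h2 := hθ g
    rw [hgi] at h2
    have h3 : ∑ j, fitted e m z w j ^ 2 = ∑ j, fitted e m z θ j * fitted e m z θ j -
        2 * ∑ j, fitted e m z θ j * fitted e m z g j + ∑ j, fitted e m z g j ^ 2 := by
      rw [Finset.mul_sum, ← Finset.sum_sub_distrib, ← Finset.sum_add_distrib]
      refine Finset.sum_congr rfl fun j _ => ?_
      rw [hw, fitted_sub]; ring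
    rw [h3, mul_add, mul_sub, h1, mul_left_comm, h2]
  have hDlow : 0 ≤ D - 2 * l + M := by
    rw [← hDD]; positivity
  set X := √(energy e m w) with hX
  have hX2 : X ^ 2 = energy e m w := Real.sq_sqrt (energy_nonneg _ _ _)
  have hX0 : 0 ≤ X := Real.sqrt_nonneg _
  set Y := √l with hY
  have hY2 : Y ^ 2 = l := Real.sq_sqrt hl0
  have hY0 : 0 ≤ Y := Real.sqrt_nonneg _
  -- Pairing θ with w empirically evaluates w at i, which is also the population pairing of g with
  -- w. So the energy of w is the gap between the population and the empirical pairing of g with w.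
  have hcross : |(n : ℝ)⁻¹ * ∑ j, fitted e m z w j ^ 2| ≤ ε * Y * X := by
    have h1 := hθ w
    have h3 : (n : ℝ)⁻¹ * ∑ j, fitted e m z w j ^ 2 =
        fitted e m z w i - (n : ℝ)⁻¹ * ∑ j, fitted e m z g j * fitted e m z w j := by
      rw [← h1, ← mul_sub, ← Finset.sum_sub_distrib]
      congr 1
      refine Finset.sum_congr rfl fun j _ => ?_
      rw [← sub_mul, ← fitted_sub, ← hw]; ring
    rcases hY0.eq_or_lt with hY0 | hY0
    · have hg0 : energy e m g = 0 := by rw [hgl, ← hY2, ← hY0]; ring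
      have hg00 : g = 0 := by
        rw [← norm_eq_zero]
        unfold energy at hg0
        nlinarith [sq_nonneg (m * ⟪e, g⟫), sq_nonneg ‖g‖]
      rw [h3, fitted_eq_inner_precisionVec he]
      simp [← hg, hg00, fitted]
      positivity
    · have hb := hcov.bilin (Y⁻¹ * (m * ⟪e, g⟫)) (Y⁻¹ • g) (m * ⟪e, w⟫) w (by
        rw [norm_smul, norm_inv, Real.norm_of_nonneg hY0.le]
        have : (Y⁻¹ * (m * ⟪e, g⟫)) ^ 2 + (Y⁻¹ * ‖g‖) ^ 2 = (Y⁻¹) ^ 2 * energy e m g := by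
          rw [energy]; ring
        rw [this, hgl, ← hY2]
        apply le_of_eq
        field_simp)
      have h4 : (n : ℝ)⁻¹ * ∑ j, (Y⁻¹ * (m * ⟪e, g⟫) + ⟪Y⁻¹ • g, z j⟫) * (m * ⟪e, w⟫ + ⟪w, z j⟫) -
          (Y⁻¹ * (m * ⟪e, g⟫) * (m * ⟪e, w⟫) + ⟪Y⁻¹ • g, w⟫) =
          -(Y⁻¹ * ((n : ℝ)⁻¹ * ∑ j, fitted e m z w j ^ 2)) := by
        rw [h3, fitted_eq_inner_precisionVec he w i, ← hg, real_inner_smul_left]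
        have : ∑ j, (Y⁻¹ * (m * ⟪e, g⟫) + ⟪Y⁻¹ • g, z j⟫) * (m * ⟪e, w⟫ + ⟪w, z j⟫) =
            Y⁻¹ * ∑ j, fitted e m z g j * fitted e m z w j := by
          rw [Finset.mul_sum]
          refine Finset.sum_congr rfl fun j _ => ?_
          rw [real_inner_smul_left, fitted, fitted]; ring
        rw [this]; ring
      rw [h4, abs_neg, abs_mul, abs_of_pos (by positivity), inv_mul_le_iff₀ hY0] at hb
      calc _ ≤ _ := hb
        _ = ε * Y * X := by rw [hX, energy]; ring
  have hlow := (abs_le.1 (hcov.fitted_sq (e := e) (m := m) w)).1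
  have hup : D - 2 * l + M ≤ 2 * ε ^ 2 * l := by
    rw [← hDD]
    have h1 := (le_abs_self _).trans hcross
    set S := (n : ℝ)⁻¹ * ∑ j, fitted e m z w j ^ 2
    rw [← hX2] at hlow
    have h2 : 3 / 4 * X ^ 2 ≤ ε * Y * X := by nlinarith [sq_nonneg X]
    rcases hX0.eq_or_lt with hX0 | hX0
    · rw [← hX0, mul_zero] at h1
      exact h1.trans (by positivity)
    have h3 : X ≤ 4 / 3 * (ε * Y) := by nlinarith
    have h4 : 0 ≤ ε * Y := by positivity
    calc S ≤ ε * Y * X := h1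
      _ ≤ ε * Y * (4 / 3 * (ε * Y)) := by gcongr
      _ = 4 / 3 * ε ^ 2 * Y ^ 2 := by ring
      _ ≤ 2 * ε ^ 2 * l := by rw [hY2]; gcongr; norm_num
  rw [abs_le] at hMe ⊢
  have : 0 ≤ 2 * ε ^ 2 * l := by positivity
  constructor <;> linarith [hMe.1, hMe.2]

/-- The empirical moments weighted by `‖z i‖² - d` and `⟪e, z i⟫² - 1` are close to their
expectations. -/
structure WeightedClose (e : E) (z : Fin n → E) (d η : ℝ) : Prop where
  norm_sq : ∀ (c : ℝ) (u : E), |(n : ℝ)⁻¹ * ∑ i, (‖z i‖ ^ 2 - d) * (c + ⟪u, z i⟫) ^ 2 -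
    2 * ‖u‖ ^ 2| ≤ η * (c ^ 2 + ‖u‖ ^ 2)
  coord : ∀ (c : ℝ) (u : E), |(n : ℝ)⁻¹ * ∑ i, (⟪e, z i⟫ ^ 2 - 1) * (c + ⟪u, z i⟫) ^ 2 -
    2 * ⟪e, u⟫ ^ 2| ≤ η * (c ^ 2 + ‖u‖ ^ 2)

lemma fitted_eq_perp (b : E) (i : Fin n) :
    fitted e m z b i = ⟪e, b⟫ * (m + ⟪e, z i⟫) + (0 + ⟪b - ⟪e, b⟫ • e, z i⟫) := by
  rw [fitted, inner_sub_left, real_inner_smul_left]; ring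

lemma norm_sub_proj_sq (he : ‖e‖ = 1) (b : E) :
    ‖b - ⟪e, b⟫ • e‖ ^ 2 = ‖b‖ ^ 2 - ⟪e, b⟫ ^ 2 := by
  rw [norm_sub_sq_real, norm_smul, he, real_inner_smul_right, real_inner_comm e b, mul_one,
    Real.norm_eq_abs, sq_abs]
  ring

lemma card_le_of_sq_ge (hn : 0 < n) (hcov : CovClose z ε) (hε : ε ≤ 1 / 4) (u : E) {t : ℝ}
    (ht : 0 < t) (s : Finset (Fin n)) (hs : ∀ i ∈ s, t ≤ ⟪u, z i⟫ ^ 2) :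
    (s.card : ℝ) ≤ 5 / 4 * ‖u‖ ^ 2 / t * n := by
  have hn' : (0 : ℝ) < n := by exact_mod_cast hn
  have h1 : (s.card : ℝ) * t ≤ ∑ i, ⟪u, z i⟫ ^ 2 := by
    rw [← nsmul_eq_mul]
    refine (Finset.card_nsmul_le_sum _ _ _ hs).trans ?_
    exact Finset.sum_le_sum_of_subset_of_nonneg (Finset.subset_univ _) fun i _ _ => sq_nonneg _
  have h2 := (abs_le.1 (hcov 0 u)).2
  simp only [zero_add, ne_eq, OfNat.ofNat_ne_zero, not_false_eq_true, zero_pow] at h2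
  have h3 : (n : ℝ)⁻¹ * ∑ i, ⟪u, z i⟫ ^ 2 ≤ 5 / 4 * ‖u‖ ^ 2 := by nlinarith [sq_nonneg ‖u‖]
  rw [inv_mul_le_iff₀ hn'] at h3
  rw [div_mul_eq_mul_div, le_div_iff₀ ht]
  linarith

/-- The left side vanishes at x = 0 up to a negative term, and its excess is of order m, while the
energy of the direction e is of order m². In the Rayleigh quotient of e this term is O(1/m). -/
lemma test_direction_bound {x m : ℝ} (hm : 1 ≤ m) :
    ((m + x) ^ 2 / (1 + m ^ 2) - 1) * (m + x) ^ 2 ≤ m * (12 * (1 + x ^ 4)) := by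
  have h1 : ((m + x) ^ 2 / (1 + m ^ 2) - 1) * (m + x) ^ 2 =
      (m + x) ^ 2 * (2 * m * x + x ^ 2 - 1) / (1 + m ^ 2) := by
    field_simp; ring
  rw [h1, div_le_iff₀ (by positivity)]
  have hx : |x| ≤ 1 + x ^ 4 := by
    have := sq_abs x
    have h4 : x ^ 4 = |x| ^ 4 := by rw [← abs_pow, abs_of_nonneg (by positivity)]
    rw [h4]
    nlinarith [sq_nonneg (|x| - 1), sq_nonneg (|x| ^ 2 - 1), abs_nonneg x]
  have hx2 : x ^ 2 ≤ 1 + x ^ 4 := by nlinarith [sq_nonneg (x ^ 2 - 1)]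
  have hx3 : |x| * x ^ 2 ≤ 1 + x ^ 4 := by
    have := sq_abs x
    nlinarith [sq_nonneg (|x| - x ^ 2), sq_nonneg (x ^ 2 - 1)]
  have hxx : x ≤ |x| := le_abs_self x
  calc (m + x) ^ 2 * (2 * m * x + x ^ 2 - 1) ≤ (m + x) ^ 2 * (2 * m * |x| + x ^ 2) := by
        gcongr
        nlinarith
    _ ≤ (2 * m ^ 2 + 2 * x ^ 2) * (2 * m * |x| + x ^ 2) := by
        gcongr
        nlinarith [sq_nonneg (m - x)]
    _ = 4 * m ^ 3 * |x| + 2 * m ^ 2 * x ^ 2 + 4 * m * (|x| * x ^ 2) + 2 * x ^ 4 := by ring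
    _ ≤ 4 * m ^ 3 * (1 + x ^ 4) + 2 * m ^ 3 * (1 + x ^ 4) + 4 * m ^ 3 * (1 + x ^ 4) +
        2 * m ^ 3 * (1 + x ^ 4) := by
        have hm23 : m ^ 2 ≤ m ^ 3 := by gcongr; norm_num
        have hm13 : m ≤ m ^ 3 := by nlinarith [sq_nonneg m]
        have hm03 : 1 ≤ m ^ 3 := by nlinarith
        have : x ^ 4 ≤ 1 + x ^ 4 := by linarith
        have h5 : 2 * x ^ 4 ≤ 2 * m ^ 3 * (1 + x ^ 4) := by nlinarith [sq_nonneg (x ^ 2)]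
        have h6 : 0 ≤ |x| * x ^ 2 := by positivity
        gcongr
    _ ≤ m * (12 * (1 + x ^ 4)) * (1 + m ^ 2) := by
        have : 0 ≤ 12 * (1 + x ^ 4) * m := by positivity
        nlinarith

lemma WeightedClose.sub_coord {d η : ℝ} (hw : WeightedClose e z d η) (c : ℝ) (u : E) :
    |(n : ℝ)⁻¹ * ∑ i, ((‖z i‖ ^ 2 - d) - (⟪e, z i⟫ ^ 2 - 1)) * (c + ⟪u, z i⟫) ^ 2 -
      (2 * ‖u‖ ^ 2 - 2 * ⟪e, u⟫ ^ 2)| ≤ 2 * η * (c ^ 2 + ‖u‖ ^ 2) := by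
  have h1 : ∑ i, ((‖z i‖ ^ 2 - d) - (⟪e, z i⟫ ^ 2 - 1)) * (c + ⟪u, z i⟫) ^ 2 =
      ∑ i, (‖z i‖ ^ 2 - d) * (c + ⟪u, z i⟫) ^ 2 -
      ∑ i, (⟪e, z i⟫ ^ 2 - 1) * (c + ⟪u, z i⟫) ^ 2 := by
    rw [← Finset.sum_sub_distrib]
    exact Finset.sum_congr rfl fun i _ => by ring
  have h2 := abs_le.1 (hw.norm_sq c u)
  have h3 := abs_le.1 (hw.coord c u)
  rw [h1, mul_sub, abs_le]
  constructor <;> linarith [h2.1, h2.2, h3.1, h3.2]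

lemma neg_three_mul_le {η x : ℝ} (hη0 : 0 < η) (hη : η ≤ 1 / 24) (hm : 1 ≤ m)
    (hmη : 96 ≤ m * η) (hx : -(η * m) < x) :
    -(3 * η) ≤ (m + x) ^ 2 / (1 + m ^ 2) - 1 := by
  rw [neg_le_sub_iff_le_add, ← sub_le_iff_le_add, le_div_iff₀ (by positivity)]
  have h8 : (1 - η) * m ≤ m + x := by linarith
  have h9 : ((1 - η) * m) ^ 2 ≤ (m + x) ^ 2 := by
    have : 0 ≤ (1 - η) * m := mul_nonneg (by linarith) (by linarith)
    gcongr
  have h10 : 1 ≤ η * m ^ 2 := by nlinarith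
  nlinarith [sq_nonneg η]

lemma spectral_objective_ge (hn : 0 < n) (he : ‖e‖ = 1) {η d : ℝ} (hη0 : 0 < η)
    (hη : η ≤ 1 / 24) (hm : 96 / η ≤ m) (hcov : CovClose z ε) (hε : ε ≤ 1 / 4)
    (hw : WeightedClose e z d η) {k : ℕ} (hk : 2 / (η * m) ^ 2 * n ≤ k) (hsub : SubsetBound z k η)
    {D : Fin n → ℝ} (hD : ∀ i, |D i - (whitenedSq e m (z i) - d)| ≤ η)
    {b : E} (hb : ∑ i, fitted e m z b i ^ 2 = n) :
    2 * (‖b‖ ^ 2 - ⟪e, b⟫ ^ 2) - 8 * η ≤ (n : ℝ)⁻¹ * ∑ i, D i * fitted e m z b i ^ 2 := by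
  classical
  have hn' : (0 : ℝ) < n := by exact_mod_cast hn
  have hm1 : 1 ≤ m := by
    refine le_trans ?_ hm
    rw [le_div_iff₀ hη0]; linarith
  have hm0 : 0 < m := by linarith
  have hmη : 96 ≤ m * η := by rwa [div_le_iff₀ hη0] at hm
  set ρ : Fin n → ℝ := fun i => (m + ⟪e, z i⟫) ^ 2 / (1 + m ^ 2) - 1 with hρ
  set a : Fin n → ℝ := fun i => (‖z i‖ ^ 2 - d) - (⟪e, z i⟫ ^ 2 - 1) with ha
  have hDi : ∀ i, |D i - (a i + ρ i)| ≤ η := by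
    intro i
    have h1 : a i + ρ i = whitenedSq e m (z i) - d := by
      simp only [ha, hρ, whitenedSq]; ring
    rw [h1]; exact hD i
  have hasum : ∀ (c : ℝ) (u : E), |(n : ℝ)⁻¹ * ∑ i, a i * (c + ⟪u, z i⟫) ^ 2 -
      (2 * ‖u‖ ^ 2 - 2 * ⟪e, u⟫ ^ 2)| ≤ 2 * η * (c ^ 2 + ‖u‖ ^ 2) := hw.sub_coord
  set N := energy e m b with hN
  have hN0 : 0 ≤ N := energy_nonneg _ _ _
  have hNb := abs_le.1 (hcov.fitted_sq (e := e) (m := m) b)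
  rw [hb, inv_mul_cancel₀ hn'.ne', ← hN] at hNb
  have hNu : N ≤ 4 / 3 := by nlinarith [hNb.1]
  set p := ‖b‖ ^ 2 - ⟪e, b⟫ ^ 2 with hp
  set SD := (n : ℝ)⁻¹ * ∑ i, D i * fitted e m z b i ^ 2 with hSD
  have h1 := (abs_le.1 (hasum (m * ⟪e, b⟫) b)).1
  have hE : (m * ⟪e, b⟫) ^ 2 + ‖b‖ ^ 2 = N := rfl
  rw [hE] at h1
  -- Off B the correction ρ is at least −3η. On B only ρ ≥ −1 is available, but B has at most k
  -- elements, so `hsub` makes its contribution at most η times the energy of b.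
  set B := Finset.univ.filter fun i => ⟪e, z i⟫ ≤ -(η * m) with hB
  have hBk : B.card ≤ k := by
    have h2 := card_le_of_sq_ge hn hcov hε e (t := (η * m) ^ 2) (by positivity) B (fun i hi => by
      have h3 := (Finset.mem_filter.1 hi).2
      have h4 : 0 < η * m := by positivity
      nlinarith)
    rw [he] at h2
    have h3 : 5 / 4 * (1 : ℝ) ^ 2 / (η * m) ^ 2 * n ≤ 2 / (η * m) ^ 2 * n := by
      gcongr; norm_num
    exact_mod_cast (h2.trans h3).trans hk
  have h2 : ∑ i ∈ B, fitted e m z b i ^ 2 ≤ η * n * N := hsub B hBk _ _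
  have h3 : ∀ i, (a i * fitted e m z b i ^ 2 - 3 * η * fitted e m z b i ^ 2 -
      (if i ∈ B then fitted e m z b i ^ 2 else 0) - η * fitted e m z b i ^ 2) ≤
      D i * fitted e m z b i ^ 2 := by
    intro i
    have h4 := (abs_le.1 (hDi i)).1
    have h5 : 0 ≤ fitted e m z b i ^ 2 := sq_nonneg _
    by_cases hi : i ∈ B
    · rw [if_pos hi]
      have h6 : -1 ≤ ρ i := by
        have : 0 ≤ (m + ⟪e, z i⟫) ^ 2 / (1 + m ^ 2) := by positivity
        simp only [hρ]; linarith
      have h7 := mul_nonneg (show 0 ≤ D i - a i + 1 + 4 * η by linarith) h5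
      linarith
    · rw [if_neg hi]
      have h6 : -(η * m) < ⟪e, z i⟫ := by
        by_contra! h
        exact hi (Finset.mem_filter.2 ⟨Finset.mem_univ i, h⟩)
      have h7 : -(3 * η) ≤ ρ i := neg_three_mul_le hη0 hη hm1 hmη h6
      have h8 := mul_nonneg (show 0 ≤ D i - a i + 4 * η by linarith) h5
      linarith
  have h4 : ∑ i, a i * fitted e m z b i ^ 2 - 3 * η * n - η * n * N - η * n ≤
      ∑ i, D i * fitted e m z b i ^ 2 := by
    refine le_trans ?_ (Finset.sum_le_sum fun i _ => h3 i)
    rw [Finset.sum_sub_distrib, Finset.sum_sub_distrib, Finset.sum_sub_distrib,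
      ← Finset.mul_sum, ← Finset.mul_sum, hb, Finset.sum_ite_mem, Finset.univ_inter]
    linarith
  have h5 : (n : ℝ)⁻¹ * (∑ i, a i * fitted e m z b i ^ 2 - 3 * η * n - η * n * N - η * n) ≤ SD := by
    rw [hSD]; gcongr
  have h6 : (n : ℝ)⁻¹ * (∑ i, a i * fitted e m z b i ^ 2 - 3 * η * n - η * n * N - η * n) =
      (n : ℝ)⁻¹ * ∑ i, a i * fitted e m z b i ^ 2 - 3 * η - η * N - η := by field_simp
  rw [h6] at h5
  have h7 : (n : ℝ)⁻¹ * ∑ i, a i * fitted e m z b i ^ 2 =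
    (n : ℝ)⁻¹ * ∑ i, a i * (m * ⟪e, b⟫ + ⟪b, z i⟫) ^ 2 := rfl
  rw [h7] at h5
  nlinarith

lemma spectral_objective_le (hn : 0 < n) (he : ‖e‖ = 1) {η d : ℝ} (hη0 : 0 < η)
    (hη : η ≤ 1 / 24) (hm : 96 / η ≤ m) (hcov : CovClose z ε) (hε : ε ≤ 1 / 4)
    (hw : WeightedClose e z d η)
    {D : Fin n → ℝ} (hD : ∀ i, |D i - (whitenedSq e m (z i) - d)| ≤ η) {b : E}
    (hmin : ∀ u, (∑ i, D i * fitted e m z b i ^ 2) * ∑ i, fitted e m z u i ^ 2 ≤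
      n * ∑ i, D i * fitted e m z u i ^ 2) :
    (n : ℝ)⁻¹ * ∑ i, D i * fitted e m z b i ^ 2 ≤ 5 * η := by
  have hn' : (0 : ℝ) < n := by exact_mod_cast hn
  have hm1 : 1 ≤ m := by
    refine le_trans ?_ hm
    rw [le_div_iff₀ hη0]; linarith
  have hm0 : 0 < m := by linarith
  have hmη : 96 ≤ m * η := by rwa [div_le_iff₀ hη0] at hm
  set ρ : Fin n → ℝ := fun i => (m + ⟪e, z i⟫) ^ 2 / (1 + m ^ 2) - 1 with hρ
  set a : Fin n → ℝ := fun i => (‖z i‖ ^ 2 - d) - (⟪e, z i⟫ ^ 2 - 1) with ha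
  have hDi : ∀ i, |D i - (a i + ρ i)| ≤ η := by
    intro i
    have h1 : a i + ρ i = whitenedSq e m (z i) - d := by
      simp only [ha, hρ, whitenedSq]; ring
    rw [h1]; exact hD i
  have hasum : ∀ (c : ℝ) (u : E), |(n : ℝ)⁻¹ * ∑ i, a i * (c + ⟪u, z i⟫) ^ 2 -
      (2 * ‖u‖ ^ 2 - 2 * ⟪e, u⟫ ^ 2)| ≤ 2 * η * (c ^ 2 + ‖u‖ ^ 2) := hw.sub_coord
  set SD := (n : ℝ)⁻¹ * ∑ i, D i * fitted e m z b i ^ 2 with hSD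
  -- The direction e is the competitor: its orthogonal part is zero, so only error terms remain in
  -- its objective.
  have h1 := hmin e
  simp only [fitted_direction he] at h1
  set R := (n : ℝ)⁻¹ * ∑ i, (m + ⟪e, z i⟫) ^ 2 with hR
  have hRl : 3 / 4 * (m ^ 2 + 1) ≤ R := by
    have h2 := (abs_le.1 (hcov m e)).1
    rw [he, one_pow] at h2
    nlinarith [sq_nonneg m]
  have h2 : SD * R ≤ (n : ℝ)⁻¹ * ∑ i, D i * (m + ⟪e, z i⟫) ^ 2 := by
    have : SD * R = (n : ℝ)⁻¹ * ((n : ℝ)⁻¹ * ((∑ i, D i * fitted e m z b i ^ 2) *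
        ∑ i, (m + ⟪e, z i⟫) ^ 2)) := by rw [hSD, hR]; ring
    rw [this]
    gcongr
    rw [inv_mul_le_iff₀ hn']
    exact h1
  have h3 : ∀ i, D i * (m + ⟪e, z i⟫) ^ 2 ≤ η * (m + ⟪e, z i⟫) ^ 2 + a i * (m + ⟪e, z i⟫) ^ 2 +
      m * (12 * (1 + ⟪e, z i⟫ ^ 4)) := by
    intro i
    have h4 := (abs_le.1 (hDi i)).2
    have h5 : ρ i * (m + ⟪e, z i⟫) ^ 2 ≤ m * (12 * (1 + ⟪e, z i⟫ ^ 4)) :=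
      test_direction_bound hm1
    nlinarith [sq_nonneg (m + ⟪e, z i⟫)]
  have h4 : (n : ℝ)⁻¹ * ∑ i, D i * (m + ⟪e, z i⟫) ^ 2 ≤ η * R +
      (n : ℝ)⁻¹ * ∑ i, a i * (m + ⟪e, z i⟫) ^ 2 +
      m * (12 * (1 + (n : ℝ)⁻¹ * ∑ i, ⟪e, z i⟫ ^ 4)) := by
    calc (n : ℝ)⁻¹ * ∑ i, D i * (m + ⟪e, z i⟫) ^ 2 ≤ (n : ℝ)⁻¹ * ∑ i, (η * (m + ⟪e, z i⟫) ^ 2 +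
          a i * (m + ⟪e, z i⟫) ^ 2 + m * (12 * (1 + ⟪e, z i⟫ ^ 4))) := by
          gcongr with i _; exact h3 i
      _ = _ := by
          rw [Finset.sum_add_distrib, Finset.sum_add_distrib, ← Finset.mul_sum, ← Finset.mul_sum,
            ← Finset.mul_sum, Finset.sum_add_distrib, hR]
          simp only [Finset.sum_const, Finset.card_univ, Fintype.card_fin, nsmul_eq_mul, mul_one]
          field_simp
  -- Since x⁴ = (x² − 1)x² + x², the fourth moment is controlled by the moments weighted by ⟪e,z_i⟫²
  -- − 1 and by the covariance.
  have h5 : (n : ℝ)⁻¹ * ∑ i, ⟪e, z i⟫ ^ 4 ≤ 5 := by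
    have h6 := (abs_le.1 (hw.coord 0 e)).2
    have h7 := (abs_le.1 (hcov 0 e)).2
    rw [he, real_inner_self_eq_norm_sq, he] at h6
    rw [he] at h7
    simp only [zero_add] at h6 h7
    have h8 : (n : ℝ)⁻¹ * ∑ i, ⟪e, z i⟫ ^ 4 = (n : ℝ)⁻¹ * ∑ i, (⟪e, z i⟫ ^ 2 - 1) * ⟪e, z i⟫ ^ 2 +
        (n : ℝ)⁻¹ * ∑ i, ⟪e, z i⟫ ^ 2 := by
      rw [← mul_add, ← Finset.sum_add_distrib]
      congr 1
      refine Finset.sum_congr rfl fun i _ => by ring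
    rw [h8]
    norm_num at h6 h7
    linarith
  have h6 := (abs_le.1 (hasum m e)).2
  rw [he, real_inner_self_eq_norm_sq, he] at h6
  have h7 : SD * R ≤ η * R + 2 * η * (m ^ 2 + 1) + 72 * m := by
    have : m * (12 * (1 + (n : ℝ)⁻¹ * ∑ i, ⟪e, z i⟫ ^ 4)) ≤ m * (12 * (1 + 5)) := by gcongr
    linarith
  -- With R ≥ 3m²/4 this is exactly what 96 ≤ mη provides.
  have h8 : 72 * m ≤ η * R := by nlinarith
  have h9 : SD * R ≤ 5 * η * R := by nlinarith
  have hRpos : 0 < R := by nlinarith [sq_nonneg m]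
  exact le_of_mul_le_mul_right h9 hRpos

/-- The spectral initialization is correct, up to a global sign, outside a small proportion. -/
lemma exists_sign_card_spectral_le (hn : 0 < n) (he : ‖e‖ = 1) {η d : ℝ} (hη0 : 0 < η)
    (hη : η ≤ 1 / 24) (hm : 96 / η ≤ m) (hcov : CovClose z ε) (hε : ε ≤ 1 / 4)
    (hw : WeightedClose e z d η) {k : ℕ} (hk : 2 / (η * m) ^ 2 * n ≤ k) (hsub : SubsetBound z k η)
    {D : Fin n → ℝ} (hD : ∀ i, |D i - (whitenedSq e m (z i) - d)| ≤ η)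
    {b : E} (hb : ∑ i, fitted e m z b i ^ 2 = n)
    (hmin : ∀ u, (∑ i, D i * fitted e m z b i ^ 2) * ∑ i, fitted e m z u i ^ 2 ≤
      n * ∑ i, D i * fitted e m z u i ^ 2) :
    ∃ s : ℝ, (s = 1 ∨ s = -1) ∧
      ((Finset.univ.filter fun i => s * fitted e m z b i ≤ 0).card : ℝ) ≤
        (140 * η + 5 / m ^ 2) * n := by
  classical
  have hn' : (0 : ℝ) < n := by exact_mod_cast hn
  have hm1 : 1 ≤ m := by
    refine le_trans ?_ hm
    rw [le_div_iff₀ hη0]; linarith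
  have hm0 : 0 < m := by linarith
  have hmη : 96 ≤ m * η := by rwa [div_le_iff₀ hη0] at hm
  set N := energy e m b with hN
  have hN0 : 0 ≤ N := energy_nonneg _ _ _
  have hNb := abs_le.1 (hcov.fitted_sq (e := e) (m := m) b)
  rw [hb, inv_mul_cancel₀ hn'.ne', ← hN] at hNb
  have hNu : N ≤ 4 / 3 := by nlinarith [hNb.1]
  have hNl : 4 / 5 ≤ N := by nlinarith [hNb.2]
  have hlow := spectral_objective_ge hn he hη0 hη hm hcov hε hw hk hsub hD hb
  have hup := spectral_objective_le hn he hη0 hη hm hcov hε hw hD hmin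
  set p := ‖b‖ ^ 2 - ⟪e, b⟫ ^ 2 with hp
  -- The two estimates of the objective give 2p − 8η ≤ 5η.
  have hp7 : p ≤ 7 * η := by linarith
  have hp0 : 0 ≤ p := by rw [hp, ← norm_sub_proj_sq he]; positivity
  have hNp : N = (m ^ 2 + 1) * ⟪e, b⟫ ^ 2 + p := by rw [hN, energy, hp]; ring
  have hbe : 1 / 4 ≤ (m * ⟪e, b⟫) ^ 2 := by nlinarith [sq_nonneg ⟪e, b⟫]
  have hbe2 : 1 / 2 ≤ m * |⟪e, b⟫| := by
    rw [← sq_abs, abs_mul, abs_of_pos hm0] at hbe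
    have : 0 ≤ m * |⟪e, b⟫| := by positivity
    nlinarith
  set u := b - ⟪e, b⟫ • e with hu
  have hup2 : ‖u‖ ^ 2 = p := norm_sub_proj_sq he b
  obtain ⟨s, hs, hse⟩ : ∃ s : ℝ, (s = 1 ∨ s = -1) ∧ s * ⟪e, b⟫ = |⟪e, b⟫| := by
    rcases le_total 0 ⟪e, b⟫ with h | h
    · exact ⟨1, Or.inl rfl, by rw [abs_of_nonneg h, one_mul]⟩
    · exact ⟨-1, Or.inr rfl, by rw [abs_of_nonpos h]; ring⟩
  refine ⟨s, hs, ?_⟩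
  have hs2 : s ^ 2 = 1 := by rcases hs with rfl | rfl <;> norm_num
  -- Since m|⟪e,b⟫| ≥ 1/2, the part of the fit along e is at least 1/4 unless |⟪e,z_i⟫| ≥ m/2. A
  -- wrong sign then requires an orthogonal part of size at least 1/4.
  have hsub' : (Finset.univ.filter fun i => s * fitted e m z b i ≤ 0) ⊆
      (Finset.univ.filter fun i => (m / 2) ^ 2 ≤ ⟪e, z i⟫ ^ 2) ∪
      (Finset.univ.filter fun i => 1 / 16 ≤ ⟪u, z i⟫ ^ 2) := by
    intro i hi
    simp only [Finset.mem_union, Finset.mem_filter, Finset.mem_univ, true_and] at hi ⊢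
    by_contra! hcon
    obtain ⟨h1, h2⟩ := hcon
    rw [fitted_eq_perp, zero_add, ← hu, mul_add, ← mul_assoc, hse] at hi
    have h3 : -(m / 2) < ⟪e, z i⟫ := (abs_lt_of_sq_lt_sq' h1 (by positivity)).1
    have h4 : 1 / 4 ≤ |⟪e, b⟫| * (m + ⟪e, z i⟫) := by nlinarith [abs_nonneg ⟪e, b⟫]
    have h5 : (s * ⟪u, z i⟫) ^ 2 < 1 / 16 := by rw [mul_pow, hs2, one_mul]; exact h2
    nlinarith
  have h1 := (Finset.card_le_card hsub').trans (Finset.card_union_le _ _)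
  have h2 := card_le_of_sq_ge hn hcov hε e (t := (m / 2) ^ 2) (by positivity)
    (Finset.univ.filter fun i => (m / 2) ^ 2 ≤ ⟪e, z i⟫ ^ 2) (fun i hi => (Finset.mem_filter.1 hi).2)
  have h3 := card_le_of_sq_ge hn hcov hε u (t := 1 / 16) (by positivity)
    (Finset.univ.filter fun i => 1 / 16 ≤ ⟪u, z i⟫ ^ 2) (fun i hi => (Finset.mem_filter.1 hi).2)
  have h4 : ((Finset.univ.filter fun i => s * fitted e m z b i ≤ 0).card : ℝ) ≤
      (Finset.univ.filter fun i => (m / 2) ^ 2 ≤ ⟪e, z i⟫ ^ 2).card +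
      (Finset.univ.filter fun i => 1 / 16 ≤ ⟪u, z i⟫ ^ 2).card := by exact_mod_cast h1
  rw [hup2] at h3
  rw [he] at h2
  have h5 : 5 / 4 * (1 : ℝ) ^ 2 / (m / 2) ^ 2 * n = 5 / m ^ 2 * n := by field_simp; norm_num
  have h6 : 5 / 4 * p / (1 / 16) * n ≤ 140 * η * n := by
    gcongr
    linarith
  linarith

end Spectral

/-! ### The algorithm in terms of least squares and a variational problem. -/

section Algorithm

open Matrix
open scoped MatrixOrder

variable {n d : ℕ} {X : Matrix (Fin n) (Fin d) ℝ}

lemma gram_posDef (h : ∀ u : Fin d → ℝ, X *ᵥ u = 0 → u = 0) : (Xᵀ * X).PosDef := by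
  have := Matrix.PosDef.conjTranspose_mul_self X (fun u v huv => by
    have := h (u - v) (by rw [Matrix.mulVec_sub]; exact sub_eq_zero.2 huv)
    exact sub_eq_zero.1 this)
  simpa using this

lemma dotProduct_mulVec_mulVec (X : Matrix (Fin n) (Fin d) ℝ) (y : Fin n → ℝ) (u : Fin d → ℝ) :
    y ⬝ᵥ X *ᵥ u = (Xᵀ *ᵥ y) ⬝ᵥ u := by
  rw [dotProduct_mulVec, ← Matrix.mulVec_transpose]

/-- A step of the projected power iteration takes the signs of a least squares fit. -/
lemma exists_ppiStep_eq (h : IsUnit (Xᵀ * X).det) (y : Fin n → ℝ) :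
    ∃ b : Fin d → ℝ, ppiStep X y = (fun i => sgn ((X *ᵥ b) i)) ∧
      ∀ u, ∑ i, ((X *ᵥ b) i - y i) * (X *ᵥ u) i = 0 := by
  refine ⟨(Xᵀ * X)⁻¹ *ᵥ (Xᵀ *ᵥ y), ?_, fun u => ?_⟩
  · funext i
    simp only [ppiStep, Matrix.mulVec_mulVec, Matrix.mul_assoc]
  · change ((X *ᵥ ((Xᵀ * X)⁻¹ *ᵥ (Xᵀ *ᵥ y))) - y) ⬝ᵥ (X *ᵥ u) = 0
    rw [dotProduct_mulVec_mulVec, Matrix.mulVec_sub, Matrix.mulVec_mulVec, Matrix.mulVec_mulVec,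
      Matrix.mul_nonsing_inv _ h, Matrix.one_mulVec, sub_self, zero_dotProduct]

/-- The Rayleigh quotient is at least the smallest eigenvalue. -/
lemma le_dotProduct_mulVec_of_isLeast {S : Matrix (Fin d) (Fin d) ℝ} (hS : S.IsHermitian) {l : ℝ}
    (hl : l ∈ lowerBounds {r : ℝ | Module.End.HasEigenvalue (Matrix.toLin' S) r})
    (u : Fin d → ℝ) : l * (u ⬝ᵥ u) ≤ u ⬝ᵥ S *ᵥ u := by
  have hS' : (S - l • (1 : Matrix (Fin d) (Fin d) ℝ)).IsHermitian := by
    refine hS.sub ?_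
    rw [Matrix.IsHermitian, Matrix.conjTranspose_smul, Matrix.conjTranspose_one]
    simp
  have hpos : (S - l • (1 : Matrix (Fin d) (Fin d) ℝ)).PosSemidef := by
    rw [hS'.posSemidef_iff_eigenvalues_nonneg]
    intro j
    have h1 := hS'.mulVec_eigenvectorBasis j
    set w := (hS'.eigenvectorBasis j).ofLp with hw
    have hw0 : w ≠ 0 := by
      intro h0
      have : hS'.eigenvectorBasis j = 0 := by
        ext i; exact congrFun h0 i
      have h2 := hS'.eigenvectorBasis.orthonormal.ne_zero j
      exact h2 this
    rw [Matrix.sub_mulVec, Matrix.smul_mulVec, Matrix.one_mulVec, sub_eq_iff_eq_add,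
      ← add_smul] at h1
    have h3 : Module.End.HasEigenvalue (Matrix.toLin' S) (hS'.eigenvalues j + l) :=
      Module.End.hasEigenvalue_of_hasEigenvector (x := w)
        ⟨Module.End.mem_eigenspace_iff.2 (by rw [Matrix.toLin'_apply]; exact h1), hw0⟩
    have := hl h3
    simp only [Pi.zero_apply]
    linarith
  have h1 := hpos.dotProduct_mulVec_nonneg u
  rw [Matrix.sub_mulVec, Matrix.smul_mulVec, Matrix.one_mulVec, dotProduct_sub,
    dotProduct_smul, star_trivial, smul_eq_mul] at h1
  linarith

lemma weightedCov_isHermitian (W : Matrix (Fin n) (Fin d) ℝ) : (weightedCov W).IsHermitian := by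
  unfold weightedCov
  ext i j
  simp only [conjTranspose_apply, Matrix.smul_apply, Matrix.sum_apply, Matrix.vecMulVec_apply,
    smul_eq_mul, star_trivial]
  congr 1
  exact Finset.sum_congr rfl fun k _ => by ring

lemma dotProduct_weightedCov_mulVec (W : Matrix (Fin n) (Fin d) ℝ) (u : Fin d → ℝ) :
    u ⬝ᵥ weightedCov W *ᵥ u = (n : ℝ)⁻¹ * ∑ i, (W i ⬝ᵥ W i - d) * (W *ᵥ u) i ^ 2 := by
  unfold weightedCov
  rw [Matrix.smul_mulVec, dotProduct_smul, Matrix.sum_mulVec, dotProduct_sum, smul_eq_mul]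
  congr 1
  refine Finset.sum_congr rfl fun i _ => ?_
  rw [Matrix.smul_mulVec, dotProduct_smul, Matrix.vecMulVec_mulVec, smul_eq_mul]
  congr 1
  rw [dotProduct_smul, sq, Matrix.mulVec, dotProduct_comm u]
  simp

/-- The spectral initialization in terms of fits in the original coordinates. -/
lemma IsSpectralOutput.exists_fit (hn : 0 < n) (hX : (Xᵀ * X).PosDef) {y : Fin n → ℝ}
    (hy : IsSpectralOutput X y) :
    ∃ (b : Fin d → ℝ) (h : Fin n → ℝ) (g : Fin n → Fin d → ℝ),
      y = (fun i => sgn ((X *ᵥ b) i)) ∧ ∑ i, (X *ᵥ b) i ^ 2 = n ∧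
      (∀ i, (X *ᵥ g i) i = h i) ∧
      (∀ i u, (n : ℝ)⁻¹ * ∑ j, (X *ᵥ g i) j * (X *ᵥ u) j = (X *ᵥ u) i) ∧
      ∀ u, (∑ i, (h i - d) * (X *ᵥ b) i ^ 2) * ∑ i, (X *ᵥ u) i ^ 2 ≤
        n * ∑ i, (h i - d) * (X *ᵥ u) i ^ 2 := by
  have hn' : (0 : ℝ) < n := by exact_mod_cast hn
  have hdet : IsUnit (Xᵀ * X).det := hX.isUnit.map Matrix.detMonoidHom
  obtain ⟨v, ⟨hv1, l, hl, hvl⟩, rfl⟩ := hy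
  set M := Xᵀ * X with hM
  set B := CFC.sqrt M⁻¹ with hB
  have hBB : B * B = M⁻¹ := CFC.sqrt_mul_sqrt_self _ (Matrix.nonneg_iff_posSemidef.2 hX.inv.posSemidef)
  have hBt : Bᵀ = B := by
    have : B.PosSemidef := Matrix.nonneg_iff_posSemidef.1 (CFC.sqrt_nonneg _)
    simpa using this.1.eq
  have hBBM : B * (B * M) = 1 := by rw [← mul_assoc, hBB, Matrix.nonsing_inv_mul _ hdet]
  have hBMB : B * M * B = 1 := mul_eq_one_comm.1 hBBM
  set W := whiten X with hW
  have hWe : W = √n • (X * B) := rfl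
  have hs : √(n : ℝ) * √n = n := Real.mul_self_sqrt hn'.le
  have hs0 : √(n : ℝ) ≠ 0 := (Real.sqrt_pos.2 hn').ne'
  have hWu : ∀ u, W *ᵥ u = X *ᵥ (√n • B *ᵥ u) := by
    intro u
    rw [hWe, Matrix.smul_mulVec, Matrix.mulVec_smul, Matrix.mulVec_mulVec]
  have hXu : ∀ u, X *ᵥ u = W *ᵥ ((√n)⁻¹ • (B * M) *ᵥ u) := by
    intro u
    rw [hWu, Matrix.mulVec_smul B, smul_smul, mul_inv_cancel₀ hs0, one_smul, Matrix.mulVec_mulVec,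
      Matrix.mulVec_mulVec, Matrix.mul_assoc, hBBM, Matrix.mul_one]
  have hWW : Wᵀ * W = (n : ℝ) • (1 : Matrix (Fin d) (Fin d) ℝ) := by
    rw [hWe, Matrix.transpose_smul, Matrix.smul_mul, Matrix.mul_smul, smul_smul, hs,
      Matrix.transpose_mul, hBt, Matrix.mul_assoc, ← Matrix.mul_assoc Xᵀ, ← hM, ← Matrix.mul_assoc,
      hBMB]
  have hWsq : ∀ u, ∑ i, (W *ᵥ u) i ^ 2 = n * (u ⬝ᵥ u) := by
    intro u
    have : ∑ i, (W *ᵥ u) i ^ 2 = (W *ᵥ u) ⬝ᵥ (W *ᵥ u) := by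
      simp only [dotProduct, sq]
    rw [this, dotProduct_mulVec_mulVec, Matrix.mulVec_mulVec, hWW, Matrix.smul_mulVec,
      Matrix.one_mulVec, smul_dotProduct, smul_eq_mul]
  have hWi : ∀ i, W i = √n • B *ᵥ X i := by
    intro i
    rw [← Matrix.vecMul_transpose, hBt]
    rfl
  -- The vector n(XᵀX)⁻¹x_i represents evaluation at row i for the empirical form, and its value at
  -- i is ‖w_i‖². This description of the weights is free of the matrix square root.
  have hgi : ∀ i u, (n : ℝ)⁻¹ * ((X *ᵥ ((n : ℝ) • M⁻¹ *ᵥ X i)) ⬝ᵥ (X *ᵥ u)) = (X *ᵥ u) i := by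
    intro i u
    rw [dotProduct_mulVec_mulVec, Matrix.mulVec_mulVec, ← hM, Matrix.mulVec_smul,
      Matrix.mulVec_mulVec, Matrix.mul_nonsing_inv _ hdet, Matrix.one_mulVec, smul_dotProduct,
      smul_eq_mul, ← mul_assoc, inv_mul_cancel₀ hn'.ne', one_mul]
    rfl
  refine ⟨√n • B *ᵥ v, fun i => W i ⬝ᵥ W i, fun i => (n : ℝ) • M⁻¹ *ᵥ X i, ?_, ?_, ?_, hgi, ?_⟩
  · rw [← hWu]
  · rw [← hWu, hWsq, hv1, mul_one]
  · intro i
    change X i ⬝ᵥ ((n : ℝ) • M⁻¹ *ᵥ X i) = W i ⬝ᵥ W i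
    rw [hWi, smul_dotProduct, dotProduct_smul, dotProduct_smul, smul_smul, hs,
      dotProduct_comm, dotProduct_mulVec_mulVec B, hBt, Matrix.mulVec_mulVec, hBB]
  · intro u
    rw [← hWu, hXu u, hWsq]
    set u' := (√(n : ℝ))⁻¹ • (B * M) *ᵥ u
    have h1 := le_dotProduct_mulVec_of_isLeast (weightedCov_isHermitian W) hl.2 u'
    have h2 := dotProduct_weightedCov_mulVec W v
    rw [hvl, dotProduct_smul, hv1, smul_eq_mul, mul_one] at h2
    rw [dotProduct_weightedCov_mulVec] at h1
    have h3 : ∑ i, (W i ⬝ᵥ W i - (d : ℝ)) * (W *ᵥ v) i ^ 2 = n * l := by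
      rw [h2]; field_simp
    rw [h3]
    rw [le_inv_mul_iff₀ hn'] at h1
    calc (n : ℝ) * l * (n * (u' ⬝ᵥ u')) = n * (n * (l * (u' ⬝ᵥ u'))) := by ring
      _ ≤ _ := by gcongr

end Algorithm

/-! ### Contraction of the projected power iteration. -/

section Iteration

open Matrix
open scoped RealInnerProductSpace

lemma sgn_eq_one_or (t : ℝ) : sgn t = 1 ∨ sgn t = -1 := by
  unfold sgn; split_ifs <;> simp

/-- The indices at which `s • yhat` differs from `y`. -/
noncomputable def wrongSet {n : ℕ} (y : Fin n → ℝ) (s : ℝ) (yhat : Fin n → ℝ) : Finset (Fin n) :=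
  Finset.univ.filter fun i => s * yhat i ≠ y i

lemma misclass_le {n : ℕ} {y yhat : Fin n → ℝ} {s : ℝ} (hs : s = 1 ∨ s = -1) :
    misclass yhat y ≤ (wrongSet y s yhat).card / n := by
  unfold misclass wrongSet
  gcongr
  rcases hs with rfl | rfl
  · simp only [one_mul]; exact min_le_left _ _
  · simp only [neg_mul, one_mul]; exact min_le_right _ _

/-- The rows of `X` are the samples `y i (m e + z i)` in the coordinates given by `A`. -/
structure IsWhitenedModel {E : Type*} [NormedAddCommGroup E] [InnerProductSpace ℝ E] {n d : ℕ}
    (X : Matrix (Fin n) (Fin d) ℝ) (y : Fin n → ℝ) (A : (Fin d → ℝ) ≃ₗ[ℝ] E) (e : E) (m : ℝ)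
    (z : Fin n → E) : Prop where
  label : ∀ i, y i = 1 ∨ y i = -1
  mulVec : ∀ u i, (X *ᵥ u) i = y i * fitted e m z (A u) i

variable {E : Type*} [NormedAddCommGroup E] [InnerProductSpace ℝ E] {n d : ℕ}
  {X : Matrix (Fin n) (Fin d) ℝ} {y : Fin n → ℝ} {A : (Fin d → ℝ) ≃ₗ[ℝ] E} {e : E} {m : ℝ}
  {z : Fin n → E} {ε : ℝ}

/-- Covariance closeness with ε < 1 makes the empirical form definite. This gives the invertibility
of XᵀX, without which the nonsingular inverse in the algorithm would be a default value. -/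
lemma eq_zero_of_fitted_eq_zero (hcov : CovClose z ε) (hε : ε ≤ 1 / 4) {b : E}
    (h : ∀ i, fitted e m z b i = 0) : b = 0 := by
  have h1 := (abs_le.1 (hcov.fitted_sq (e := e) (m := m) b)).1
  simp only [h, ne_eq, OfNat.ofNat_ne_zero, not_false_eq_true, zero_pow, Finset.sum_const_zero,
    mul_zero] at h1
  have h2 := energy_nonneg e m b
  have h3 : energy e m b = 0 := by nlinarith
  rw [← norm_eq_zero]
  unfold energy at h3
  nlinarith [sq_nonneg (m * ⟪e, b⟫), sq_nonneg ‖b‖]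

namespace IsWhitenedModel

lemma sq_label (h : IsWhitenedModel X y A e m z) (i : Fin n) : y i * y i = 1 := by
  rcases h.label i with h | h <;> rw [h] <;> norm_num

lemma mulVec_mul (h : IsWhitenedModel X y A e m z) (u v : Fin d → ℝ) (i : Fin n) :
    (X *ᵥ u) i * (X *ᵥ v) i = fitted e m z (A u) i * fitted e m z (A v) i := by
  rw [h.mulVec, h.mulVec]
  linear_combination (fitted e m z (A u) i * fitted e m z (A v) i) * h.sq_label i

lemma mulVec_sq (h : IsWhitenedModel X y A e m z) (u : Fin d → ℝ) (i : Fin n) :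
    (X *ᵥ u) i ^ 2 = fitted e m z (A u) i ^ 2 := by
  rw [sq, sq, h.mulVec_mul]

lemma gram_posDef (h : IsWhitenedModel X y A e m z) (hcov : CovClose z ε) (hε : ε ≤ 1 / 4) :
    (Xᵀ * X).PosDef := by
  refine _root_.gram_posDef fun u hu => ?_
  have h1 : A u = 0 := by
    refine eq_zero_of_fitted_eq_zero (e := e) (m := m) hcov hε fun i => ?_
    have h2 : (X *ᵥ u) i = 0 := congrFun hu i
    rw [h.mulVec] at h2
    rcases mul_eq_zero.1 h2 with h3 | h3
    · have := h.sq_label i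
      rw [h3] at this; norm_num at this
    · exact h3
  simpa using h1

lemma wrongSet_sgn_subset (h : IsWhitenedModel X y A e m z) {s : ℝ} (hs : s = 1 ∨ s = -1)
    (u : Fin d → ℝ) :
    wrongSet y s (fun i => sgn ((X *ᵥ u) i)) ⊆
      Finset.univ.filter fun i => s * fitted e m z (A u) i ≤ 0 := by
  intro i hi
  simp only [wrongSet, Finset.mem_filter, Finset.mem_univ, true_and] at hi ⊢
  by_contra! hcon
  apply hi
  rw [h.mulVec]
  unfold sgn
  rcases hs with rfl | rfl <;> rcases h.label i with hy | hy <;> rw [hy] <;> split_ifs <;>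
    linarith

/-- A step of the projected power iteration in whitened coordinates. -/
lemma exists_fit_ppiStep (h : IsWhitenedModel X y A e m z) (hcov : CovClose z ε) (hε : ε ≤ 1 / 4)
    {s : ℝ} (hs : s = 1 ∨ s = -1) {y' : Fin n → ℝ} (hy' : ∀ i, y' i = 1 ∨ y' i = -1) :
    ∃ b : E, wrongSet y s (ppiStep X y') ⊆ (Finset.univ.filter fun i => fitted e m z b i ≤ 0) ∧
      ∀ u, ∑ i, (fitted e m z b i - if i ∈ wrongSet y s y' then -1 else 1) *
        fitted e m z u i = 0 := by
  obtain ⟨b, hb, hnorm⟩ := exists_ppiStep_eq (X := X)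
    ((h.gram_posDef hcov hε).isUnit.map Matrix.detMonoidHom) y'
  refine ⟨s • A b, ?_, fun u => ?_⟩
  · rw [hb]
    simp only [fitted_smul]
    exact h.wrongSet_sgn_subset hs b
  · have h1 := hnorm (A.symm u)
    rw [← mul_zero s, ← h1, Finset.mul_sum]
    refine Finset.sum_congr rfl fun i _ => ?_
    rw [fitted_smul, h.mulVec, h.mulVec, A.apply_symm_apply]
    -- After multiplication by s and by the true label, the regression target is 1 except on the
    -- wrong set.
    have h2 : (if i ∈ wrongSet y s y' then (-1 : ℝ) else 1) = s * y i * y' i := by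
      simp only [wrongSet, Finset.mem_filter, Finset.mem_univ, true_and]
      rcases hs with rfl | rfl <;> rcases h.label i with hy | hy <;> rcases hy' i with hy'' | hy'' <;>
        rw [hy, hy''] <;> norm_num
    rw [h2]
    linear_combination (-(s * fitted e m z (A b) i * fitted e m z u i)) * h.sq_label i

lemma ppiStep_eq_one_or (y' : Fin n → ℝ) (i : Fin n) :
    ppiStep X y' i = 1 ∨ ppiStep X y' i = -1 := sgn_eq_one_or _

/-- The one-step recursion: atypical noise, a statistical floor of order ε²n, and a multiple 80σ/δ²
of the previous errors that a small σ turns into a contraction. -/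
lemma card_wrongSet_ppiStep_le (h : IsWhitenedModel X y A e m z) (hn : 0 < n) (he : ‖e‖ = 1)
    (hm : 1 ≤ m) (hcov : CovClose z ε) (hε : ε ≤ 1 / 4) {δ : ℝ} (hδ : 0 < δ) {k : ℕ} {σ : ℝ}
    (hσ : 0 ≤ σ) (hsub : SubsetBound z k σ)
    {s : ℝ} (hs : s = 1 ∨ s = -1) {y' : Fin n → ℝ} (hy' : ∀ i, y' i = 1 ∨ y' i = -1)
    (hk : (wrongSet y s y').card ≤ k) :
    ((wrongSet y s (ppiStep X y')).card : ℝ) ≤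
      (Finset.univ.filter fun i => ⟪e, z i⟫ ≤ -((1 - δ) * m)).card + 20 * ε ^ 2 / δ ^ 2 * n +
        80 * σ / δ ^ 2 * (wrongSet y s y').card := by
  have hn' : (0 : ℝ) < n := by exact_mod_cast hn
  obtain ⟨b, hb, hnorm⟩ := h.exists_fit_ppiStep hcov hε hs hy'
  have h1 := energy_fit_sub_le hn he hcov hε hσ (hsub _ hk) hnorm
  have h2 := card_fitted_nonpos_le hn he hm hcov hε hδ h1
  have h3 : ((wrongSet y s (ppiStep X y')).card : ℝ) ≤
    (Finset.univ.filter fun i => fitted e m z b i ≤ 0).card := by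
    exact_mod_cast Finset.card_le_card hb
  refine h3.trans (h2.trans (le_of_eq ?_))
  field_simp
  ring

lemma card_wrongSet_ppiStep_le_of_small (h : IsWhitenedModel X y A e m z) (hn : 0 < n)
    (he : ‖e‖ = 1) (hm : 1 ≤ m) (hcov : CovClose z ε) (hε : ε ≤ 1 / 4) {δ : ℝ} (hδ : 0 < δ) {k : ℕ}
    {σ ρ : ℝ} (hσ : 0 ≤ σ) (hsub : SubsetBound z k σ) (hρ : ∀ i, ‖z i‖ ^ 2 ≤ ρ) (hρ0 : 0 ≤ ρ)
    (hsmall : 2 * (1 + ρ) * (4 * ε ^ 2 + 16 * (k / n) * σ) < δ ^ 2 / 4)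
    {s : ℝ} (hs : s = 1 ∨ s = -1) {y' : Fin n → ℝ} (hy' : ∀ i, y' i = 1 ∨ y' i = -1)
    (hk : (wrongSet y s y').card ≤ k) :
    (wrongSet y s (ppiStep X y')).card ≤
      (Finset.univ.filter fun i => ⟪e, z i⟫ ≤ -((1 - δ) * m)).card := by
  obtain ⟨b, hb, hnorm⟩ := h.exists_fit_ppiStep hcov hε hs hy'
  have h1 := energy_fit_sub_le hn he hcov hε hσ (hsub _ hk) hnorm
  refine (Finset.card_le_card hb).trans (card_fitted_nonpos_le_of_small he hm hδ hρ ?_)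
  refine lt_of_le_of_lt ?_ hsmall
  have : ((wrongSet y s y').card : ℝ) ≤ k := by exact_mod_cast hk
  refine mul_le_mul_of_nonneg_left (h1.trans ?_) (by positivity)
  gcongr

lemma iterate_eq_one_or {y' : Fin n → ℝ} (hy' : ∀ i, y' i = 1 ∨ y' i = -1) (t : ℕ) (i : Fin n) :
    (ppiStep X)^[t] y' i = 1 ∨ (ppiStep X)^[t] y' i = -1 := by
  cases t with
  | zero => exact hy' i
  | succ t => rw [Function.iterate_succ_apply']; exact ppiStep_eq_one_or _ i

/-- The recursion x ↦ F + x/4 has fixed point 4F/3 and preserves x ≤ k when F ≤ 3k/4. Staying below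
k is needed because the subset bound only covers sets of at most k indices. -/
lemma card_wrongSet_iterate_le (h : IsWhitenedModel X y A e m z) (hn : 0 < n) (he : ‖e‖ = 1)
    (hm : 1 ≤ m) (hcov : CovClose z ε) (hε : ε ≤ 1 / 4) {δ : ℝ} (hδ : 0 < δ) {k : ℕ} {σ : ℝ}
    (hσ : 0 ≤ σ) (hσδ : 80 * σ / δ ^ 2 ≤ 1 / 4) (hsub : SubsetBound z k σ)
    {s : ℝ} (hs : s = 1 ∨ s = -1) {y' : Fin n → ℝ} (hy' : ∀ i, y' i = 1 ∨ y' i = -1)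
    (hk : (wrongSet y s y').card ≤ k) {F : ℝ}
    (hF : (Finset.univ.filter fun i => ⟪e, z i⟫ ≤ -((1 - δ) * m)).card +
      20 * ε ^ 2 / δ ^ 2 * n ≤ F) (hFk : F ≤ 3 / 4 * k) (t : ℕ) :
    (wrongSet y s ((ppiStep X)^[t] y')).card ≤ k ∧
    ((wrongSet y s ((ppiStep X)^[t] y')).card : ℝ) ≤ (1 / 4) ^ t * n + 4 / 3 * F := by
  have hF0 : 0 ≤ F := le_trans (by positivity) hF
  induction t with
  | zero =>
    refine ⟨hk, ?_⟩
    have : ((wrongSet y s y').card : ℝ) ≤ n := by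
      exact_mod_cast (Finset.card_le_univ _).trans (by simp)
    simp only [pow_zero, one_mul, Function.iterate_zero, id]
    linarith
  | succ t ih =>
    rw [Function.iterate_succ_apply']
    have h1 := h.card_wrongSet_ppiStep_le hn he hm hcov hε hδ hσ hsub hs
      (iterate_eq_one_or hy' t) ih.1
    have h2 : 80 * σ / δ ^ 2 * (wrongSet y s ((ppiStep X)^[t] y')).card ≤
        1 / 4 * (wrongSet y s ((ppiStep X)^[t] y')).card := by gcongr
    constructor
    · have h3 : ((wrongSet y s ((ppiStep X)^[t] y')).card : ℝ) ≤ k := by exact_mod_cast ih.1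
      have : ((wrongSet y s (ppiStep X ((ppiStep X)^[t] y'))).card : ℝ) ≤ k := by linarith
      exact_mod_cast this
    · rw [pow_succ]
      linarith [ih.2]

/-- The spectral initialization in whitened coordinates. -/
lemma exists_sign_card_wrongSet_le (h : IsWhitenedModel X y A e m z) (hn : 0 < n) (he : ‖e‖ = 1)
    {η : ℝ} (hη0 : 0 < η) (hη : η ≤ 1 / 24) (hm : 96 / η ≤ m) (hcov : CovClose z ε)
    (hε : ε ≤ 1 / 4) (hw : WeightedClose e z d η) {k : ℕ} (hk : 2 / (η * m) ^ 2 * n ≤ k)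
    (hsub : SubsetBound z k η) {r ρ : ℝ} (hr : 0 ≤ r)
    (hloo : ∀ i, |∑ j ∈ Finset.univ.erase i, fitted e m z (precisionVec e m (z i)) j ^ 2 -
      (n - 1 : ℝ) * whitenedSq e m (z i)| ≤ (n - 1 : ℝ) * r * whitenedSq e m (z i))
    (hρ : ∀ i, ‖z i‖ ^ 2 ≤ ρ)
    (hlev : (ρ + 1) ^ 2 / n + (ρ + 1) / n + r * (ρ + 1) + 2 * ε ^ 2 * (ρ + 1) ≤ η)
    {y0 : Fin n → ℝ} (hy0 : IsSpectralOutput X y0) :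
    ∃ s : ℝ, (s = 1 ∨ s = -1) ∧ ((wrongSet y s y0).card : ℝ) ≤ (140 * η + 5 / m ^ 2) * n := by
  obtain ⟨b, l, g, rfl, hb, hgl, hg, hmin⟩ := hy0.exists_fit hn (h.gram_posDef hcov hε)
  have hfit : ∀ i, fitted e m z (A (y i • g i)) i = l i := by
    intro i
    rw [map_smul, fitted_smul, ← h.mulVec, hgl]
  have hD : ∀ i, |(l i - d) - (whitenedSq e m (z i) - d)| ≤ η := by
    intro i
    have h1 := abs_leverage_sub_le hn he hcov hε (hloo i) hr (θ := A (y i • g i)) (fun u => by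
      have h2 := hg i (A.symm u)
      simp only [h.mulVec_mul, A.apply_symm_apply] at h2
      rw [h.mulVec, A.apply_symm_apply] at h2
      simp only [map_smul, fitted_smul, mul_assoc]
      rw [← Finset.mul_sum, mul_left_comm, h2, ← mul_assoc, h.sq_label, one_mul])
    rw [hfit] at h1
    have h2 : whitenedSq e m (z i) ≤ ρ + 1 := (whitenedSq_le _).trans (by linarith [hρ i])
    have h3 := whitenedSq_nonneg (m := m) he (z i)
    rw [sub_sub_sub_cancel_right]
    refine h1.trans (le_trans ?_ hlev)
    gcongr
  simp only [h.mulVec_sq] at hb hmin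
  obtain ⟨s, hs, hcard⟩ := exists_sign_card_spectral_le hn he hη0 hη hm hcov hε hw hk hsub hD hb
    (fun u => by simpa using hmin (A.symm u))
  refine ⟨s, hs, le_trans ?_ hcard⟩
  exact_mod_cast Finset.card_le_card (h.wrongSet_sgn_subset hs b)

end IsWhitenedModel

end Iteration

/-! ### From regular noise to the error count of the two-stage procedure. -/

section TwoStage

open Matrix
open scoped RealInnerProductSpace

variable {E : Type*} [NormedAddCommGroup E] [InnerProductSpace ℝ E] {n d : ℕ}

/-- The number of indices at which the noise in the direction `e` is at most `-x`. -/
noncomputable def noiseCount (e : E) (z : Fin n → E) (x : ℝ) : ℕ :=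
  (Finset.univ.filter fun i => ⟪e, z i⟫ ≤ -x).card

/-- The regularity properties of the noise on which the analysis of the two-stage procedure
rests. -/
structure RegularNoise (z : Fin n → E) (e : E) (m : ℝ) (d : ℕ) (ε r ρ η σ : ℝ) (k₀ k : ℕ) :
    Prop where
  cov : CovClose z ε
  weighted : WeightedClose e z d η
  leverage : ∀ i, |∑ j ∈ Finset.univ.erase i, fitted e m z (precisionVec e m (z i)) j ^ 2 -
      (n - 1 : ℝ) * whitenedSq e m (z i)| ≤ (n - 1 : ℝ) * r * whitenedSq e m (z i)
  norm_sq_le : ∀ i, ‖z i‖ ^ 2 ≤ ρ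
  subset_spectral : SubsetBound z k₀ η
  subset_step : SubsetBound z k σ

/-- The relations between the parameters under which the two-stage procedure converges. -/
structure IsAdmissible (n : ℕ) (m δ ε r ρ η σ : ℝ) (k₀ k : ℕ) : Prop where
  n_pos : 0 < n
  δ_pos : 0 < δ
  δ_lt : δ < 1
  η_pos : 0 < η
  η_le : η ≤ 1 / 24
  le_m : 96 / η ≤ m
  ε_le : ε ≤ 1 / 4
  r_nonneg : 0 ≤ r
  ρ_nonneg : 0 ≤ ρ
  σ_nonneg : 0 ≤ σ
  le_k₀ : 2 / (η * m) ^ 2 * n ≤ k₀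
  leverage : (ρ + 1) ^ 2 / n + (ρ + 1) / n + r * (ρ + 1) + 2 * ε ^ 2 * (ρ + 1) ≤ η
  σ_le : 80 * σ / δ ^ 2 ≤ 1 / 4
  le_k : (140 * η + 5 / m ^ 2) * n ≤ k
  base : 5 / 4 / ((1 - δ) * m) ^ 2 * n + 20 * ε ^ 2 / δ ^ 2 * n ≤ 3 / 4 * k

variable {X : Matrix (Fin n) (Fin d) ℝ} {y yhat : Fin n → ℝ} {A : (Fin d → ℝ) ≃ₗ[ℝ] E} {e : E}
  {m : ℝ} {z : Fin n → E} {δ ε r ρ η σ : ℝ} {k₀ k : ℕ}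

lemma IsAdmissible.one_le_m (h : IsAdmissible n m δ ε r ρ η σ k₀ k) : 1 ≤ m := by
  refine le_trans ?_ h.le_m
  rw [le_div_iff₀ h.η_pos]
  linarith [h.η_le]

/-- The noise count is a small proportion of the sample. -/
lemma noiseCount_le (hn : 0 < n) (he : ‖e‖ = 1) (hcov : CovClose z ε) (hε : ε ≤ 1 / 4) {x : ℝ}
    (hx : 0 < x) : (noiseCount e z x : ℝ) ≤ 5 / 4 / x ^ 2 * n := by
  have := card_le_of_sq_ge hn hcov hε e (t := x ^ 2) (by positivity)
    (Finset.univ.filter fun i => ⟪e, z i⟫ ≤ -x) (fun i hi => by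
      have := (Finset.mem_filter.1 hi).2
      nlinarith)
  rwa [he, one_pow, mul_one] at this

lemma quarter_pow_mul_le (hn : 0 < n) {t : ℕ} (ht : ⌈Real.logb 2 n⌉₊ ≤ t) :
    (1 / 4 : ℝ) ^ t * n ≤ 1 := by
  have hn' : (0 : ℝ) < n := by exact_mod_cast hn
  have h1 : (n : ℝ) ≤ 2 ^ t := by
    rw [← Real.rpow_natCast, ← Real.logb_le_iff_le_rpow (by norm_num) hn']
    exact (Nat.le_ceil _).trans (by exact_mod_cast ht)
  calc (1 / 4 : ℝ) ^ t * n ≤ (1 / 2 : ℝ) ^ t * 2 ^ t := by gcongr; norm_num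
    _ = 1 := by rw [← mul_pow]; norm_num

namespace IsWhitenedModel

/-- The spectral stage fixes the global sign s and puts the wrong set below k. Every iterate is then
compared with the truth for this same s, and k is large enough for the recursion to stay in range.
-/
lemma exists_card_wrongSet_iterate_le (h : IsWhitenedModel X y A e m z) (he : ‖e‖ = 1)
    (hz : RegularNoise z e m d ε r ρ η σ k₀ k) (ha : IsAdmissible n m δ ε r ρ η σ k₀ k)
    {y0 : Fin n → ℝ} (hy0 : IsSpectralOutput X y0) :
    ∃ s : ℝ, (s = 1 ∨ s = -1) ∧ (∀ i, y0 i = 1 ∨ y0 i = -1) ∧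
      ∀ t, ((wrongSet y s ((ppiStep X)^[t] y0)).card : ℝ) ≤
        (1 / 4) ^ t * n + 4 / 3 * (noiseCount e z ((1 - δ) * m) + 20 * ε ^ 2 / δ ^ 2 * n) := by
  obtain ⟨s, hs, hcard⟩ := h.exists_sign_card_wrongSet_le ha.n_pos he ha.η_pos ha.η_le ha.le_m
    hz.cov ha.ε_le hz.weighted ha.le_k₀ hz.subset_spectral ha.r_nonneg hz.leverage hz.norm_sq_le
    ha.leverage hy0
  have hy : ∀ i, y0 i = 1 ∨ y0 i = -1 := by
    obtain ⟨v, -, rfl⟩ := hy0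
    exact fun i => sgn_eq_one_or _
  have hm := ha.one_le_m
  have hx : 0 < (1 - δ) * m := mul_pos (by linarith [ha.δ_lt]) (by linarith)
  refine ⟨s, hs, hy, fun t => ?_⟩
  refine (h.card_wrongSet_iterate_le ha.n_pos he hm hz.cov ha.ε_le ha.δ_pos
    ha.σ_nonneg ha.σ_le hz.subset_step hs hy ?_ le_rfl ?_ t).2
  · exact_mod_cast hcard.trans ha.le_k
  · have := noiseCount_le ha.n_pos he hz.cov ha.ε_le hx
    exact (add_le_add_left this _).trans ha.base

/-- Error bound for the two-stage procedure. -/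
lemma misclass_le_of_isTwoStageOutput (h : IsWhitenedModel X y A e m z) (he : ‖e‖ = 1)
    (hz : RegularNoise z e m d ε r ρ η σ k₀ k) (ha : IsAdmissible n m δ ε r ρ η σ k₀ k)
    (hy : IsTwoStageOutput X yhat) :
    n * misclass yhat y ≤ 1 + 4 / 3 * (noiseCount e z ((1 - δ) * m) + 20 * ε ^ 2 / δ ^ 2 * n) := by
  obtain ⟨y0, hy0, rfl⟩ := hy
  obtain ⟨s, hs, -, hcard⟩ := h.exists_card_wrongSet_iterate_le he hz ha hy0
  have hn' : (0 : ℝ) < n := by exact_mod_cast ha.n_pos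
  have h1 := misclass_le (y := y) (yhat := ppi X y0) hs
  rw [le_div_iff₀ hn', mul_comm] at h1
  refine h1.trans ((hcard _).trans ?_)
  gcongr
  exact quarter_pow_mul_le ha.n_pos (by omega)

/-- Error bound for the two-stage procedure, when the residuals after the last step are uniformly
small. -/
lemma misclass_le_of_isTwoStageOutput_of_small (h : IsWhitenedModel X y A e m z) (he : ‖e‖ = 1)
    (hz : RegularNoise z e m d ε r ρ η σ k₀ k) (ha : IsAdmissible n m δ ε r ρ η σ k₀ k)
    {k' : ℕ} {σ' : ℝ} (hσ' : 0 ≤ σ') (hsub : SubsetBound z k' σ')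
    (hk' : 1 + 4 / 3 * (noiseCount e z ((1 - δ) * m) + 20 * ε ^ 2 / δ ^ 2 * n) ≤ k')
    (hsmall : 2 * (1 + ρ) * (4 * ε ^ 2 + 16 * (k' / n) * σ') < δ ^ 2 / 4)
    (hy : IsTwoStageOutput X yhat) :
    n * misclass yhat y ≤ noiseCount e z ((1 - δ) * m) := by
  obtain ⟨y0, hy0, rfl⟩ := hy
  obtain ⟨s, hs, hy0', hcard⟩ := h.exists_card_wrongSet_iterate_le he hz ha hy0
  have hn' : (0 : ℝ) < n := by exact_mod_cast ha.n_pos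
  have h1 := misclass_le (y := y) (yhat := ppi X y0) hs
  rw [le_div_iff₀ hn', mul_comm] at h1
  refine h1.trans ?_
  -- All steps but the last bring the errors below k'; the last one is kept for the uniform residual
  -- bound.
  have h2 := hcard (4 * ⌈Real.logb 2 n⌉₊ + 3)
  have h3 : ((wrongSet y s ((ppiStep X)^[4 * ⌈Real.logb 2 n⌉₊ + 3] y0)).card : ℝ) ≤ k' := by
    refine h2.trans (le_trans ?_ hk')
    gcongr
    exact quarter_pow_mul_le ha.n_pos (by omega)
  have h4 := h.card_wrongSet_ppiStep_le_of_small ha.n_pos he ha.one_le_m hz.cov ha.ε_le ha.δ_pos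
    hσ' hsub hz.norm_sq_le ha.ρ_nonneg hsmall hs (iterate_eq_one_or hy0' _) (Nat.cast_le.1 h3)
  have h5 : ppi X y0 = ppiStep X ((ppiStep X)^[4 * ⌈Real.logb 2 n⌉₊ + 3] y0) :=
    Function.iterate_succ_apply' _ _ _
  rw [h5]
  exact Nat.cast_le.2 h4

end IsWhitenedModel

end TwoStage

/-! ### Probability of the regularity events for general weights. -/

section NoiseEvents

open scoped RealInnerProductSpace

/-- Presents κ‖u‖² as a continuous symmetric bilinear form on ℝ × E, the shape that the net argument
requires of its target. -/
lemma norm_sq_form_apply {d : ℕ} (κ : ℝ) (v w : ℝ × EuclideanSpace ℝ (Fin d)) :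
    weightedForm Finset.univ (fun _ => κ) (fun i : Fin d =>
      (innerSL ℝ (EuclideanSpace.basisFun (Fin d) ℝ i)).comp
        (ContinuousLinearMap.snd ℝ ℝ (EuclideanSpace ℝ (Fin d)))) v w = κ * ⟪v.2, w.2⟫ := by
  rw [weightedForm_apply, ← Finset.mul_sum]
  congr 1
  simp only [ContinuousLinearMap.comp_apply, ContinuousLinearMap.coe_snd', innerSL_apply_apply]
  rw [← (EuclideanSpace.basisFun (Fin d) ℝ).sum_inner_mul_inner]
  exact Finset.sum_congr rfl fun i _ => by rw [real_inner_comm v.2]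

lemma weightedForm_symm {F ι : Type*} [NormedAddCommGroup F] [NormedSpace ℝ F]
    (s : Finset ι) (a : ι → ℝ) (l : ι → F →L[ℝ] ℝ) (v w : F) :
    weightedForm s a l v w = weightedForm s a l w v := by
  rw [weightedForm_apply, weightedForm_apply]
  exact Finset.sum_congr rfl fun i _ => by ring

/-- As 625 ≤ e⁷, the union bound over the net costs an exponent 7(d + 1) + 1, which the surplus 20
dL absorbs. -/
lemma pow_net_mul_exp_le {d : ℕ} (hd : 1 ≤ d) {L K x : ℝ} (hL : 1 ≤ L) (hK : 0 ≤ K)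
    (hx : (K + 20) * (d * L) ≤ x) :
    (625 : ℝ) ^ (d + 1) * (2 * Real.exp (-x)) ≤ Real.exp (-(K * L)) := by
  have hd' : (1 : ℝ) ≤ d := by exact_mod_cast hd
  have h1 : (625 : ℝ) ≤ Real.exp 7 := by
    have h := Real.exp_one_gt_d9.le
    calc (625 : ℝ) ≤ 2.7182818283 ^ 7 := by norm_num
      _ ≤ Real.exp 1 ^ 7 := by gcongr
      _ = Real.exp 7 := by rw [← Real.exp_nat_mul]; norm_num
  have h2 : (2 : ℝ) ≤ Real.exp 1 := by linarith [Real.exp_one_gt_d9]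
  calc (625 : ℝ) ^ (d + 1) * (2 * Real.exp (-x)) ≤
      Real.exp 7 ^ (d + 1) * (Real.exp 1 * Real.exp (-x)) := by gcongr
    _ = Real.exp (7 * (d + 1) + 1 - x) := by
        rw [← Real.exp_nat_mul, ← Real.exp_add, ← Real.exp_add]; push_cast; ring_nf
    _ ≤ Real.exp (-(K * L)) := by
        gcongr
        have h3 : (1 : ℝ) ≤ d * L := one_le_mul_of_one_le_of_one_le hd' hL
        have h4 : (d : ℝ) ≤ d * L := le_mul_of_one_le_right (by linarith) hL
        have h5 : K * L ≤ K * (d * L) := by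
          gcongr; exact le_mul_of_one_le_left (by linarith) hd'
        linarith

section General

variable {E : Type*} [NormedAddCommGroup E] [InnerProductSpace ℝ E] [FiniteDimensional ℝ E]
  [MeasurableSpace E] [BorelSpace E]
variable {Ω : Type*} [MeasurableSpace Ω] {P : Measure Ω} [IsProbabilityMeasure P]
  {n : ℕ} {z : Fin n → Ω → E}

/-- Concentration of the empirical second moments with a subexponential weight. -/
lemma measureReal_subexponential_dev_le (hn : 0 < n) (hzm : ∀ i, Measurable (z i))
    (hind : iIndepFun z P) (hz : ∀ i, HasLaw (z i) (stdGaussian E) P) {A : E → ℝ}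
    (hA : Measurable A) {θ : ℝ} (hθ : 0 < θ)
    (hAi : Integrable (fun z => Real.exp (θ * |A z|)) (stdGaussian E))
    (hA4 : ∫ z, Real.exp (θ * |A z|) ∂(stdGaussian E) ≤ 4)
    (hi : ∀ c u, Integrable (fun z => A z * (c + ⟪u, z⟫) ^ 2) (stdGaussian E))
    (T : (ℝ × E) →L[ℝ] (ℝ × E) →L[ℝ] ℝ) (hT : ∀ v w, T v w = T w v)
    (hTA : ∀ c u, ∫ z, A z * (c + ⟪u, z⟫) ^ 2 ∂(stdGaussian E) = T (c, u) (c, u))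
    {τ : ℝ} (hτ : 0 < τ) {r : ℝ} (hr0 : 0 ≤ r) (hr : r ≤ 128) :
    P.real {ω | ¬ ((∀ i, |A (z i ω)| ≤ τ) ∧ ∀ (c : ℝ) (u : E),
      |(n : ℝ)⁻¹ * ∑ i, A (z i ω) * (c + ⟪u, z i ω⟫) ^ 2 - T (c, u) (c, u)| ≤
        3 * (τ * r + 5000 / θ * Real.exp (-(θ * τ / 4))) * (c ^ 2 + ‖u‖ ^ 2))} ≤
      n * (4 * Real.exp (-(θ * τ))) +
        625 ^ (Module.finrank ℝ E + 1) * (2 * Real.exp (-(n * r ^ 2 / 4096))) := by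
  let a : E → ℝ := fun z => if |A z| ≤ τ then A z else 0
  have ha : Measurable a :=
    Measurable.ite (measurableSet_le (by fun_prop) measurable_const) hA measurable_const
  have haτ : ∀ z, |a z| ≤ τ := by
    intro z
    by_cases h : |A z| ≤ τ
    · simp only [a, if_pos h]; exact h
    · simp only [a, if_neg h, abs_zero]; exact hτ.le
  have h1 := measureReal_exists_gt_le hzm hind hz hA hθ hAi hA4 τ
  have h2 := measureReal_weighted_dev_le hn hzm hind hz ha hτ haτ T hT
    (β := 5000 / θ * Real.exp (-(θ * τ / 4))) (fun c u hc hu => by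
      rw [← hTA]; exact truncation_bias_le hA hθ hAi hA4 τ hc hu (hi c u)) hr0 hr
  refine le_trans (measureReal_mono ?_ (measure_ne_top _ _))
    ((measureReal_union_le _ _).trans (add_le_add h1 h2))
  intro ω hω
  by_contra hcon
  simp only [Set.mem_union, Set.mem_ofPred_eq, not_or, not_not] at hcon
  refine hω ⟨hcon.1, fun c u => ?_⟩
  have h3 : ∀ i, A (z i ω) = a (z i ω) := fun i => by simp only [a, if_pos (hcon.1 i)]
  simp only [h3]
  exact hcon.2 c u

lemma measurable_whitenedSq (e : E) (m : ℝ) : Measurable (whitenedSq e m) := by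
  unfold whitenedSq; fun_prop

lemma measurable_precisionVec (e : E) (m : ℝ) : Measurable (precisionVec e m) := by
  unfold precisionVec; fun_prop

lemma measureReal_leverage_le (hn : 0 < n) (hzm : ∀ i, Measurable (z i)) (hind : iIndepFun z P)
    (hz : ∀ i, HasLaw (z i) (stdGaussian E) P) {e : E} (he : ‖e‖ = 1) (m : ℝ)
    {r : ℝ} (hr0 : 0 ≤ r) (hr : r ≤ 128) :
    P.real {ω | ¬ ∀ i, |∑ j ∈ Finset.univ.erase i,
        fitted e m (fun j => z j ω) (precisionVec e m (z i ω)) j ^ 2 -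
      (n - 1 : ℝ) * whitenedSq e m (z i ω)| ≤ (n - 1 : ℝ) * r * whitenedSq e m (z i ω)} ≤
      n * (2 * Real.exp (-((n - 1 : ℝ) * r ^ 2 / 4096))) := by
  classical
  let l : E → ℝ := whitenedSq e m
  have hl : Measurable l := measurable_whitenedSq e m
  let g : E → E := precisionVec e m
  have hg : Measurable g := measurable_precisionVec e m
  -- The representer of evaluation at x, normalized to unit energy. When it vanishes, any unit
  -- default serves, as both sides of the claim are then 0.
  let v : E → ℝ × E := fun x => if l x = 0 then (1, 0) else
    ((√(l x))⁻¹ * (m * ⟪e, g x⟫), (√(l x))⁻¹ • g x)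
  have hv : Measurable v := by
    refine Measurable.ite (hl (measurableSet_singleton 0)) measurable_const ?_
    fun_prop
  have hle : ∀ x, l x = energy e m (g x) := fun x => (energy_precisionVec he x).symm
  have hl0 : ∀ x, 0 ≤ l x := whitenedSq_nonneg he
  have hv1 : ∀ x, (v x).1 ^ 2 + ‖(v x).2‖ ^ 2 = 1 := by
    intro x
    by_cases h : l x = 0
    · simp [v, h]
    · simp only [v, if_neg h]
      rw [norm_smul, Real.norm_eq_abs, mul_pow _ (m * _), mul_pow _ ‖g x‖, sq_abs, ← mul_add, inv_pow,
        Real.sq_sqrt (hl0 x)]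
      change (l x)⁻¹ * energy e m (g x) = 1
      rw [← hle]
      exact inv_mul_cancel₀ h
  have h := measureReal_leave_one_out_le hzm hind hz hv hv1 hr0 hr
  have hcast : ((n - 1 : ℕ) : ℝ) = (n : ℝ) - 1 := by
    rw [Nat.cast_sub hn]; simp
  rw [hcast] at h
  refine le_trans (measureReal_mono ?_ (measure_ne_top _ _)) h
  intro ω hω hcon
  refine hω fun i => ?_
  have h1 := hcon i
  change |_ - (n - 1 : ℝ) * l (z i ω)| ≤ (n - 1 : ℝ) * r * l (z i ω)
  by_cases h0 : l (z i ω) = 0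
  · have hg0 : g (z i ω) = 0 := by
      have := hle (z i ω)
      rw [h0, energy] at this
      rw [← norm_eq_zero]
      nlinarith [sq_nonneg (m * ⟪e, g (z i ω)⟫), sq_nonneg ‖g (z i ω)‖]
    have hg0' : precisionVec e m (z i ω) = 0 := hg0
    simp [h0, hg0', fitted]
  · simp only [v, if_neg h0] at h1
    have hs : √(l (z i ω)) ^ 2 = l (z i ω) := Real.sq_sqrt (hl0 _)
    have hs0 : √(l (z i ω)) ≠ 0 := fun h => h0 (by rw [← hs, h]; simp)
    have h2 : ∀ j, ((√(l (z i ω)))⁻¹ * (m * ⟪e, g (z i ω)⟫) + ⟪(√(l (z i ω)))⁻¹ • g (z i ω), z j ω⟫) ^ 2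
        = (l (z i ω))⁻¹ * fitted e m (fun j => z j ω) (precisionVec e m (z i ω)) j ^ 2 := by
      intro j
      rw [real_inner_smul_left, ← mul_add, mul_pow, inv_pow, hs]
      rfl
    simp only [h2, ← Finset.mul_sum] at h1
    have hpos : 0 < l (z i ω) := lt_of_le_of_ne (hl0 _) (Ne.symm h0)
    have h3 := mul_le_mul_of_nonneg_right h1 hpos.le
    rw [← abs_of_pos hpos, ← abs_mul, abs_of_pos hpos, sub_mul, mul_comm (l (z i ω))⁻¹,
      inv_mul_cancel_right₀ h0] at h3
    exact h3

end General

end NoiseEvents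

/-! ### Quantitative noise events in terms of n, d and L = log n. -/

section NoiseBounds

open scoped RealInnerProductSpace

variable {n d : ℕ} {Ω : Type*} [MeasurableSpace Ω] {P : Measure Ω} [IsProbabilityMeasure P]
  {z : Fin n → Ω → EuclideanSpace ℝ (Fin d)} {L w K : ℝ}

/-- The numerical relations between the sample size `n`, the dimension `d`, `L = log n` and
`w = √(L / n)`. -/
structure IsScale (n d : ℕ) (L w : ℝ) : Prop where
  n_ge : 2 ≤ n
  d_ge : 1 ≤ d
  L_ge : 1 ≤ L
  exp_L : Real.exp L = n
  w_nonneg : 0 ≤ w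
  sq_w : w ^ 2 * n = L

namespace IsScale

lemma n_pos (h : IsScale n d L w) : (0 : ℝ) < n := by
  have := h.n_ge
  exact_mod_cast (by omega : 0 < n)

lemma one_le_d (h : IsScale n d L w) : (1 : ℝ) ≤ d := by exact_mod_cast h.d_ge

lemma one_le_dL (h : IsScale n d L w) : 1 ≤ d * L := one_le_mul_of_one_le_of_one_le h.one_le_d h.L_ge

lemma q_nonneg (h : IsScale n d L w) : 0 ≤ d * L * w := mul_nonneg (by linarith [h.one_le_dL]) h.w_nonneg

lemma sq_q_mul (h : IsScale n d L w) : (d * L * w) ^ 2 * n = d ^ 2 * L ^ 3 := by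
  linear_combination (d ^ 2 * L ^ 2) * h.sq_w

lemma dL_le (h : IsScale n d L w) : d * L ≤ (d * L * w) ^ 2 * n := by
  rw [h.sq_q_mul]
  have h1 := h.one_le_dL
  have h2 := h.L_ge
  calc (d * L : ℝ) ≤ (d * L) ^ 2 := by nlinarith
    _ = d ^ 2 * L ^ 2 * 1 := by ring
    _ ≤ d ^ 2 * L ^ 2 * L := by gcongr
    _ = _ := by ring

lemma one_le_sqrt_d (h : IsScale n d L w) : 1 ≤ √(d : ℝ) := Real.one_le_sqrt.2 h.one_le_d

lemma sqrt_d_le (h : IsScale n d L w) : √(d : ℝ) ≤ d := by nlinarith [Real.sq_sqrt (Nat.cast_nonneg d), h.one_le_sqrt_d]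

lemma sqrt_d_mul_w_le (h : IsScale n d L w) : √(d : ℝ) * w ≤ d * L * w := by
  have h1 : √(d : ℝ) ≤ d * L :=
    h.sqrt_d_le.trans (le_mul_of_one_le_right (by linarith [h.one_le_d]) h.L_ge)
  exact mul_le_mul_of_nonneg_right h1 h.w_nonneg

lemma n_mul_exp_neg (h : IsScale n d L w) : n * Real.exp (-L) = 1 := by
  rw [← h.exp_L, ← Real.exp_add, add_neg_cancel, Real.exp_zero]

/-- The choice r = 64√(K + 20)·√d·w makes n r²/4096 equal to (K + 20) dL, just enough to beat the
net; ε is 3r, the net losing a factor 3. -/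
lemma measureReal_covClose_compl_le (h : IsScale n d L w) (hzm : ∀ i, Measurable (z i)) (hind : iIndepFun z P)
    (hz : ∀ i, HasLaw (z i) (stdGaussian _) P) (hK : 0 ≤ K) (hq : √(K + 20) * (d * L * w) ≤ 2) :
    P.real {ω | ¬ CovClose (fun i => z i ω) (192 * √(K + 20) * (√d * w))} ≤
      Real.exp (-(K * L)) := by
  have hκ : √(K + 20) ^ 2 = K + 20 := Real.sq_sqrt (by linarith)
  have hr : 64 * √(K + 20) * (√d * w) ≤ 128 := by
    have := mul_le_mul_of_nonneg_left h.sqrt_d_mul_w_le (Real.sqrt_nonneg (K + 20))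
    linarith
  have hr0 : 0 ≤ 64 * √(K + 20) * (√d * w) := by have := h.w_nonneg; positivity
  let E := EuclideanSpace ℝ (Fin d)
  let T : (ℝ × E) →L[ℝ] (ℝ × E) →L[ℝ] ℝ :=
    weightedForm Finset.univ (fun _ => 1)
      (fun _ : Unit => ContinuousLinearMap.fst ℝ ℝ E) +
    weightedForm Finset.univ (fun _ => 1) (fun i : Fin d =>
      (innerSL ℝ (EuclideanSpace.basisFun (Fin d) ℝ i)).comp (ContinuousLinearMap.snd ℝ ℝ E))
  have hTe : ∀ v w, T v w = v.1 * w.1 + ⟪v.2, w.2⟫ := by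
    intro v w
    change weightedForm _ _ _ v w + weightedForm _ _ _ v w = _
    rw [norm_sq_form_apply 1, weightedForm_apply]
    simp
  have h1 := measureReal_weighted_dev_le (by have := h.n_ge; omega) hzm hind hz
    (a := fun _ => 1) measurable_const one_pos (by simp) T (fun v w => by
      rw [hTe, hTe, real_inner_comm, mul_comm]) (β := 0) (fun c u _ _ => by
      simp only [one_mul, hTe]
      rw [integral_affine_sq, real_inner_self_eq_norm_sq]
      simp [sq]) hr0 hr
  refine le_trans (measureReal_mono ?_ (measure_ne_top _ _)) (h1.trans ?_)
  · intro ω hω hcon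
    refine hω fun c u => ?_
    have h2 := hcon c u
    simp only [one_mul, hTe, real_inner_self_eq_norm_sq] at h2
    rw [← sq] at h2
    refine h2.trans (le_of_eq ?_)
    ring
  · rw [finrank_euclideanSpace_fin]
    refine pow_net_mul_exp_le h.d_ge h.L_ge hK (le_of_eq ?_)
    rw [mul_pow, mul_pow, mul_pow, hκ, Real.sq_sqrt (Nat.cast_nonneg d)]
    linear_combination (-(K + 20) * d) * h.sq_w

/-- The truncation level is set so that θτ ≥ 4(K + 3)L: exceeding it anywhere has probability
O(e^{-KL}), and the bias factor exp(−θτ/4) is at most 1/n. The product of the level √d·L with the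
deviation √d·w is of order dLw, which is where n ≫ d² log³ n is needed. -/
lemma measureReal_weighted_compl_le (h : IsScale n d L w) (hzm : ∀ i, Measurable (z i)) (hind : iIndepFun z P)
    (hz : ∀ i, HasLaw (z i) (stdGaussian _) P) {A : EuclideanSpace ℝ (Fin d) → ℝ}
    (hA : Measurable A) {θ : ℝ} (hθ : 0 < θ) (hθd : 1 / θ ≤ 64 * √d)
    (hAi : Integrable (fun z => Real.exp (θ * |A z|)) (stdGaussian _))
    (hA4 : ∫ z, Real.exp (θ * |A z|) ∂(stdGaussian _) ≤ 4)
    (hi : ∀ c u, Integrable (fun z => A z * (c + ⟪u, z⟫) ^ 2) (stdGaussian _))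
    (T : (ℝ × EuclideanSpace ℝ (Fin d)) →L[ℝ] (ℝ × EuclideanSpace ℝ (Fin d)) →L[ℝ] ℝ)
    (hT : ∀ v w, T v w = T w v)
    (hTA : ∀ c u, ∫ z, A z * (c + ⟪u, z⟫) ^ 2 ∂(stdGaussian _) = T (c, u) (c, u))
    (hK : 0 ≤ K) {η : ℝ} (hη1 : η ≤ 1)
    (hq : 960000 * (√(K + 20) * (K + 3) + 1) * (d * L * w) ≤ η) :
    P.real {ω | ¬ ((∀ i, |A (z i ω)| ≤ 256 * √d * (K + 3) * L) ∧
      ∀ (c : ℝ) (u : EuclideanSpace ℝ (Fin d)),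
      |(n : ℝ)⁻¹ * ∑ i, A (z i ω) * (c + ⟪u, z i ω⟫) ^ 2 - T (c, u) (c, u)| ≤
        η * (c ^ 2 + ‖u‖ ^ 2))} ≤ 5 * Real.exp (-(K * L)) := by
  have hκ : √(K + 20) ^ 2 = K + 20 := Real.sq_sqrt (by linarith)
  have hκ0 : 0 ≤ √(K + 20) := Real.sqrt_nonneg _
  have hL := h.L_ge
  have hw0 := h.w_nonneg
  have hd0 := h.one_le_sqrt_d
  have hn0 := h.n_pos
  set q := d * L * w with hqdef
  have hq0 : 0 ≤ q := h.q_nonneg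
  have hκK : 0 ≤ √(K + 20) * K := by positivity
  have hκq : 0 ≤ √(K + 20) * q := by positivity
  have hκKq : 0 ≤ √(K + 20) * K * q := by positivity
  have hr : 64 * √(K + 20) * (√d * w) ≤ 128 := by
    have := mul_le_mul_of_nonneg_left h.sqrt_d_mul_w_le hκ0
    rw [← hqdef] at this
    nlinarith
  have hr0 : 0 ≤ 64 * √(K + 20) * (√d * w) := by positivity
  have hτ : 0 < 256 * √d * (K + 3) * L := by positivity
  have hθτ : 4 * ((K + 3) * L) ≤ θ * (256 * √d * (K + 3) * L) := by
    rw [div_le_iff₀ hθ] at hθd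
    have := mul_le_mul_of_nonneg_right hθd (show 0 ≤ 4 * ((K + 3) * L) by positivity)
    linarith
  have h1 := measureReal_subexponential_dev_le (by have := h.n_ge; omega) hzm hind hz hA hθ hAi hA4
    hi T hT hTA hτ hr0 hr
  refine le_trans (measureReal_mono ?_ (measure_ne_top _ _)) (h1.trans ?_)
  · intro ω hω hcon
    refine hω ⟨hcon.1, fun c u => (hcon.2 c u).trans ?_⟩
    gcongr
    have h2 : 256 * √d * (K + 3) * L * (64 * √(K + 20) * (√d * w)) =
        16384 * (√(K + 20) * (K + 3)) * q := by
      rw [hqdef]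
      linear_combination (16384 * (√(K + 20) * (K + 3)) * L * w) * Real.sq_sqrt (Nat.cast_nonneg d)
    have h3 : Real.exp (-(θ * (256 * √d * (K + 3) * L) / 4)) ≤ Real.exp (-L) := by
      gcongr
      nlinarith
    have h4 : 5000 / θ * Real.exp (-(θ * (256 * √d * (K + 3) * L) / 4)) ≤ 320000 * q := by
      have h5 : √d * Real.exp (-L) ≤ q ^ 2 := by
        have h6 : (d : ℝ) ≤ q ^ 2 * n := by
          refine le_trans ?_ h.dL_le
          exact le_mul_of_one_le_right (by linarith [h.one_le_d]) hL
        have h7 : √(d : ℝ) ≤ q ^ 2 * n := h.sqrt_d_le.trans h6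
        calc √d * Real.exp (-L) ≤ q ^ 2 * n * Real.exp (-L) := by gcongr
          _ = q ^ 2 := by rw [mul_assoc, h.n_mul_exp_neg, mul_one]
      have h6 : q ≤ 1 := by nlinarith
      calc 5000 / θ * Real.exp (-(θ * (256 * √d * (K + 3) * L) / 4)) ≤
            5000 * (64 * √d) * Real.exp (-L) := by
            rw [div_eq_mul_one_div]
            gcongr
        _ = 320000 * (√d * Real.exp (-L)) := by ring
        _ ≤ 320000 * q := by nlinarith
    rw [h2]
    nlinarith
  · have h2 : (n : ℝ) * (4 * Real.exp (-(θ * (256 * √d * (K + 3) * L)))) ≤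
        4 * Real.exp (-(K * L)) := by
      have h3 : Real.exp (-(θ * (256 * √d * (K + 3) * L))) ≤ Real.exp (-L + -(K * L)) := by
        gcongr
        nlinarith
      rw [Real.exp_add] at h3
      calc (n : ℝ) * (4 * Real.exp (-(θ * (256 * √d * (K + 3) * L)))) ≤
            n * (4 * (Real.exp (-L) * Real.exp (-(K * L)))) := by gcongr
        _ = 4 * (n * Real.exp (-L)) * Real.exp (-(K * L)) := by ring
        _ = _ := by rw [h.n_mul_exp_neg, mul_one]
    have h3 : (625 : ℝ) ^ (Module.finrank ℝ (EuclideanSpace ℝ (Fin d)) + 1) *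
        (2 * Real.exp (-(n * (64 * √(K + 20) * (√d * w)) ^ 2 / 4096))) ≤ Real.exp (-(K * L)) := by
      rw [finrank_euclideanSpace_fin]
      refine pow_net_mul_exp_le h.d_ge h.L_ge hK (le_of_eq ?_)
      rw [mul_pow, mul_pow, mul_pow, hκ, Real.sq_sqrt (Nat.cast_nonneg d)]
      linear_combination (-(K + 20) * d) * h.sq_w
    linarith

lemma measureReal_norm_weighted_compl_le (h : IsScale n d L w) (hzm : ∀ i, Measurable (z i)) (hind : iIndepFun z P)
    (hz : ∀ i, HasLaw (z i) (stdGaussian _) P) (hK : 0 ≤ K) {η : ℝ} (hη1 : η ≤ 1)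
    (hq : 960000 * (√(K + 20) * (K + 3) + 1) * (d * L * w) ≤ η) :
    P.real {ω | ¬ ((∀ i, |‖z i ω‖ ^ 2 - d| ≤ 256 * √d * (K + 3) * L) ∧
      ∀ (c : ℝ) (u : EuclideanSpace ℝ (Fin d)),
      |(n : ℝ)⁻¹ * ∑ i, (‖z i ω‖ ^ 2 - d) * (c + ⟪u, z i ω⟫) ^ 2 - 2 * ‖u‖ ^ 2| ≤
        η * (c ^ 2 + ‖u‖ ^ 2))} ≤ 5 * Real.exp (-(K * L)) := by
  have h0 := integral_exp_norm_sq_abs_le (d := d) h.d_ge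
  have hd0 := h.one_le_sqrt_d
  have h1 := h.measureReal_weighted_compl_le hzm hind hz (A := fun x => ‖x‖ ^ 2 - d) (by fun_prop)
    (θ := 1 / (64 * √d)) (by positivity) (by rw [one_div_one_div]) h0.1 h0.2
    (fun c u => (integral_norm_sq_mul c u).1) _ (weightedForm_symm _ _ _)
    (fun c u => by
      rw [(integral_norm_sq_mul c u).2, norm_sq_form_apply 2, real_inner_self_eq_norm_sq])
    hK hη1 hq
  simpa only [norm_sq_form_apply, real_inner_self_eq_norm_sq] using h1

lemma measureReal_coord_weighted_compl_le (h : IsScale n d L w) (hzm : ∀ i, Measurable (z i)) (hind : iIndepFun z P)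
    (hz : ∀ i, HasLaw (z i) (stdGaussian _) P) {e : EuclideanSpace ℝ (Fin d)} (he : ‖e‖ = 1)
    (hK : 0 ≤ K) {η : ℝ} (hη1 : η ≤ 1)
    (hq : 960000 * (√(K + 20) * (K + 3) + 1) * (d * L * w) ≤ η) :
    P.real {ω | ¬ ∀ (c : ℝ) (u : EuclideanSpace ℝ (Fin d)),
      |(n : ℝ)⁻¹ * ∑ i, (⟪e, z i ω⟫ ^ 2 - 1) * (c + ⟪u, z i ω⟫) ^ 2 - 2 * ⟪e, u⟫ ^ 2| ≤
        η * (c ^ 2 + ‖u‖ ^ 2)} ≤ 5 * Real.exp (-(K * L)) := by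
  have h0 := integral_exp_coord_abs_le he
  have hd0 := h.one_le_sqrt_d
  let T := weightedForm Finset.univ (fun _ => 2) (fun _ : Unit => (innerSL ℝ e).comp
    (ContinuousLinearMap.snd ℝ ℝ (EuclideanSpace ℝ (Fin d))))
  have hT : ∀ c u, T (c, u) (c, u) = 2 * ⟪e, u⟫ ^ 2 := by
    intro c u
    simp [T, weightedForm_apply, sq]
  have h1 := h.measureReal_weighted_compl_le hzm hind hz (A := fun x => ⟪e, x⟫ ^ 2 - 1) (by fun_prop)
    (θ := 1 / 64) (by norm_num) (by rw [one_div_one_div]; linarith) h0.1 h0.2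
    (fun c u => integrable_coord_mul e c u) T (weightedForm_symm _ _ _)
    (fun c u => by rw [integral_coord_mul he, hT]) hK hη1 hq
  simp only [hT] at h1
  refine le_trans (measureReal_mono ?_ (measure_ne_top _ _)) h1
  intro ω hω hcon
  exact hω hcon.2

/-- The deviation is of order w with no factor √d, because each direction is frozen by conditioning.
Multiplied by leverages of order dL, it is again of order dLw. -/
lemma measureReal_leverage_compl_le (h : IsScale n d L w) (hzm : ∀ i, Measurable (z i)) (hind : iIndepFun z P)
    (hz : ∀ i, HasLaw (z i) (stdGaussian _) P) {e : EuclideanSpace ℝ (Fin d)} (he : ‖e‖ = 1)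
    (m : ℝ) (hK : 0 ≤ K) (hq : √(K + 3) * (d * L * w) ≤ 1) :
    P.real {ω | ¬ ∀ i, |∑ j ∈ Finset.univ.erase i,
        fitted e m (fun j => z j ω) (precisionVec e m (z i ω)) j ^ 2 -
      (n - 1 : ℝ) * whitenedSq e m (z i ω)| ≤
        (n - 1 : ℝ) * (128 * √(K + 3) * w) * whitenedSq e m (z i ω)} ≤
      2 * Real.exp (-(K * L)) := by
  have hκ : √(K + 3) ^ 2 = K + 3 := Real.sq_sqrt (by linarith)
  have hκ0 : 0 ≤ √(K + 3) := Real.sqrt_nonneg _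
  have hw0 := h.w_nonneg
  have hL := h.L_ge
  have h1 := measureReal_leverage_le (by have := h.n_ge; omega) hzm hind hz he m
    (r := 128 * √(K + 3) * w) (by positivity) (by
      have h2 : w ≤ d * L * w := le_mul_of_one_le_left hw0 h.one_le_dL
      have := mul_le_mul_of_nonneg_left h2 hκ0
      linarith)
  refine h1.trans ?_
  have h2 : Real.exp (-((n - 1 : ℝ) * (128 * √(K + 3) * w) ^ 2 / 4096)) ≤
      Real.exp (-L + -(K * L)) := by
    gcongr
    have hn2 : (2 : ℝ) ≤ n := by exact_mod_cast h.n_ge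
    have h3 : (n - 1 : ℝ) * (128 * √(K + 3) * w) ^ 2 / 4096 = 4 * (K + 3) * ((n - 1) * w ^ 2) := by
      rw [mul_pow, mul_pow, hκ]; ring
    have h4 : L / 2 ≤ (n - 1) * w ^ 2 := by nlinarith [h.sq_w, sq_nonneg w]
    rw [h3]
    have h5 : 4 * (K + 3) * (L / 2) ≤ 4 * (K + 3) * ((n - 1) * w ^ 2) := by gcongr
    nlinarith
  rw [Real.exp_add] at h2
  calc (n : ℝ) * (2 * Real.exp (-((n - 1 : ℝ) * (128 * √(K + 3) * w) ^ 2 / 4096))) ≤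
      n * (2 * (Real.exp (-L) * Real.exp (-(K * L)))) := by gcongr
    _ = 2 * (n * Real.exp (-L)) * Real.exp (-(K * L)) := by ring
    _ = _ := by rw [h.n_mul_exp_neg, mul_one]

end IsScale

lemma measureReal_subsetBound_compl_le (hzm : ∀ i, Measurable (z i)) (hind : iIndepFun z P)
    (hz : ∀ i, HasLaw (z i) (stdGaussian _) P) {b : ℝ} (hb : 1 ≤ b) (k : ℕ) {σ : ℝ}
    (hσ : 6 * (b * k + 4 * (2 * n * Real.exp (-(b / 4)) + K * L + 7 * d)) ≤ σ * n) :
    P.real {ω | ¬ SubsetBound (fun i => z i ω) k σ} ≤ Real.exp (-(K * L)) := by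
  have h1 := measureReal_subset_sum_le hzm hind hz k hb
    (2 * n * Real.exp (-(b / 4)) + K * L + 7 * d)
  refine le_trans (measureReal_mono ?_ (measure_ne_top _ _)) (h1.trans ?_)
  · intro ω hω hcon
    refine hω fun s hs c u => (hcon s hs c u).trans ?_
    gcongr
  · have h2 : (625 : ℝ) ≤ Real.exp 7 := by
      have h := Real.exp_one_gt_d9.le
      calc (625 : ℝ) ≤ 2.7182818283 ^ 7 := by norm_num
        _ ≤ Real.exp 1 ^ 7 := by gcongr
        _ = Real.exp 7 := by rw [← Real.exp_nat_mul]; norm_num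
    rw [finrank_euclideanSpace_fin]
    calc (625 : ℝ) ^ d * Real.exp (-(2 * n * Real.exp (-(b / 4)) + K * L + 7 * d) +
          2 * n * Real.exp (-(b / 4))) ≤ Real.exp 7 ^ d * Real.exp (-(K * L) - 7 * d) := by
          gcongr
          linarith
      _ = Real.exp (-(K * L)) := by rw [← Real.exp_nat_mul, ← Real.exp_add]; ring_nf


/-- Subsets of a small proportion of the sample carry a small part of the second moments. -/
lemma exists_subsetBound_proportion {σ : ℝ} (hσ : 0 < σ) :
    ∃ p : ℝ, 0 < p ∧ ∀ K : ℝ, 0 ≤ K → ∃ C : ℝ, ∀ (n d : ℕ) (L w : ℝ), IsScale n d L w →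
      C * (d * L * w) ≤ 1 → ∀ {Ω : Type} [MeasurableSpace Ω] {P : Measure Ω}
      [IsProbabilityMeasure P] {z : Fin n → Ω → EuclideanSpace ℝ (Fin d)},
      (∀ i, Measurable (z i)) → iIndepFun z P → (∀ i, HasLaw (z i) (stdGaussian _) P) →
      P.real {ω | ¬ SubsetBound (fun i => z i ω) ⌈p * n⌉₊ σ} ≤ Real.exp (-(K * L)) := by
  -- With this b the excess term 48 n exp(−b/4) uses at most a quarter of σn, and p = σ/(24b) makes
  -- 6bpn another quarter. What is left absorbs the rounding and the terms of order dL.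
  set b := max 1 (4 * Real.log (192 / σ)) with hb
  have hb1 : 1 ≤ b := le_max_left _ _
  have hbe : Real.exp (-(b / 4)) ≤ σ / 192 := by
    have h1 : Real.log (192 / σ) ≤ b / 4 := by linarith [le_max_right 1 (4 * Real.log (192 / σ))]
    rw [← Real.exp_log (show 0 < σ / 192 by positivity)]
    gcongr
    rw [← inv_div 192 σ, Real.log_inv]
    linarith
  refine ⟨σ / (24 * b), by positivity, fun K hK => ⟨4 * (24 * (K + 7) + 6 * b) / σ + 1, ?_⟩⟩
  intro n d L w h hC Ω _ P _ z hzm hind hz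
  have hn := h.n_pos
  refine measureReal_subsetBound_compl_le hzm hind hz hb1 _ ?_
  have hk : (⌈σ / (24 * b) * n⌉₊ : ℝ) ≤ σ / (24 * b) * n + 1 :=
    (Nat.ceil_lt_add_one (by positivity)).le
  have h1 : b * ⌈σ / (24 * b) * n⌉₊ ≤ σ * n / 24 + b := by
    calc b * (⌈σ / (24 * b) * n⌉₊ : ℝ) ≤ b * (σ / (24 * b) * n + 1) := by gcongr
      _ = _ := by field_simp
  have h2 : n * Real.exp (-(b / 4)) ≤ σ * n / 192 := by
    calc n * Real.exp (-(b / 4)) ≤ n * (σ / 192) := by gcongr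
      _ = _ := by ring
  set q := d * L * w with hq
  have hq0 : 0 ≤ q := h.q_nonneg
  have h3 : 4 * (24 * (K + 7) + 6 * b) * q ^ 2 ≤ σ := by
    have h4 : 4 * (24 * (K + 7) + 6 * b) / σ * q ≤ 1 := by linarith
    have h5 : q ≤ 1 := by
      have : 0 ≤ 4 * (24 * (K + 7) + 6 * b) / σ * q := by positivity
      linarith
    rw [div_mul_eq_mul_div, div_le_one hσ] at h4
    have : 0 ≤ 4 * (24 * (K + 7) + 6 * b) * q := by positivity
    nlinarith
  have h4 : K * L + 7 * d ≤ (K + 7) * (d * L) := by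
    have := h.one_le_d
    have := h.L_ge
    have h5 : K * L ≤ K * (d * L) := by gcongr; exact le_mul_of_one_le_left (by linarith) h.one_le_d
    have h6 : (d : ℝ) ≤ d * L := le_mul_of_one_le_right (by linarith) h.L_ge
    linarith
  have h5 : d * L ≤ q ^ 2 * n := h.dL_le
  have h6 : 1 ≤ q ^ 2 * n := h.one_le_dL.trans h5
  have h7 : (K + 7) * (d * L) ≤ (K + 7) * (q ^ 2 * n) := by gcongr
  have h8 : b ≤ b * (q ^ 2 * n) := le_mul_of_one_le_right (by linarith) h6
  have h9 := mul_le_mul_of_nonneg_right h3 hn.le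
  have h10 : 0 ≤ σ * n := by positivity
  linarith

end NoiseBounds

/-! ### Choice of the parameters. -/

section Parameters

open scoped RealInnerProductSpace

lemma mul_le_one_of_le {a C q : ℝ} (h : a ≤ C) (hq : 0 ≤ q) (hC : C * q ≤ 1) : a * q ≤ 1 :=
  (mul_le_mul_of_nonneg_right h hq).trans hC

lemma residual_error_le {n d : ℕ} {L w K : ℝ} (h : IsScale n d L w) (hK : 0 ≤ K) {B : ℝ}
    (hB : 1 ≤ B) (hq1 : d * L * w ≤ 1) :
    2 * (192 * √(K + 20) * (√d * w)) ^ 2 * (B * (d * L) + 1) ≤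
      147456 * (K + 20) * B * (d * L * w) := by
  have hκ : √(K + 20) ^ 2 = K + 20 := Real.sq_sqrt (by linarith)
  have hs : √(d : ℝ) ^ 2 = d := Real.sq_sqrt (Nat.cast_nonneg d)
  have hL := h.L_ge
  have hw := h.w_nonneg
  have hq0 := h.q_nonneg
  have hρ : B * (d * L) + 1 ≤ 2 * B * (d * L) := by nlinarith [h.one_le_dL]
  have hqq : (d * L * w) ^ 2 ≤ d * L * w := by nlinarith
  calc 2 * (192 * √(K + 20) * (√d * w)) ^ 2 * (B * (d * L) + 1) ≤
        2 * (192 * √(K + 20) * (√d * w)) ^ 2 * (2 * B * (d * L)) := by gcongr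
    _ = 147456 * (K + 20) * B * (d ^ 2 * L * 1 * w ^ 2) := by
        rw [mul_pow, mul_pow, mul_pow, hκ, hs]; ring
    _ ≤ 147456 * (K + 20) * B * (d ^ 2 * L * L * w ^ 2) := by gcongr
    _ = 147456 * (K + 20) * B * (d * L * w) ^ 2 := by ring
    _ ≤ _ := by gcongr

lemma leverage_error_le {n d : ℕ} {L w K : ℝ} (h : IsScale n d L w) (hK : 0 ≤ K) {B η : ℝ}
    (hB : 1 ≤ B) (hq1 : d * L * w ≤ 1)
    (hq : (4 * B ^ 2 + 2 * B + 256 * √(K + 3) * B + 147456 * (K + 20) * B) * (d * L * w) ≤ η) :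
    (B * (d * L) + 1) ^ 2 / n + (B * (d * L) + 1) / n +
      128 * √(K + 3) * w * (B * (d * L) + 1) +
      2 * (192 * √(K + 20) * (√d * w)) ^ 2 * (B * (d * L) + 1) ≤ η := by
  set q := d * L * w with hqd
  have hq0 : 0 ≤ q := h.q_nonneg
  have hn := h.n_pos
  have hdL := h.one_le_dL
  have hL := h.L_ge
  have hw := h.w_nonneg
  have hρ : B * (d * L) + 1 ≤ 2 * B * (d * L) := by nlinarith
  have hρ0 : 0 ≤ B * (d * L) + 1 := by positivity
  have hqq : q ^ 2 ≤ q := by nlinarith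
  have h1 : (B * (d * L) + 1) ^ 2 / n ≤ 4 * B ^ 2 * q := by
    rw [div_le_iff₀ hn]
    calc (B * (d * L) + 1) ^ 2 ≤ (2 * B * (d * L)) ^ 2 := by gcongr
      _ = 4 * B ^ 2 * (d ^ 2 * L ^ 2) := by ring
      _ ≤ 4 * B ^ 2 * (d ^ 2 * L ^ 3) := by gcongr; norm_num
      _ = 4 * B ^ 2 * q ^ 2 * n := by rw [← h.sq_q_mul]; ring
      _ ≤ 4 * B ^ 2 * q * n := by gcongr
  have h2 : (B * (d * L) + 1) / n ≤ 2 * B * q := by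
    rw [div_le_iff₀ hn]
    calc B * (d * L) + 1 ≤ 2 * B * (d * L) := hρ
      _ ≤ 2 * B * (q ^ 2 * n) := mul_le_mul_of_nonneg_left h.dL_le (by positivity)
      _ = 2 * B * q ^ 2 * n := by ring
      _ ≤ 2 * B * q * n := by gcongr
  have h3 : 128 * √(K + 3) * w * (B * (d * L) + 1) ≤ 256 * √(K + 3) * B * q := by
    calc 128 * √(K + 3) * w * (B * (d * L) + 1) ≤ 128 * √(K + 3) * w * (2 * B * (d * L)) := by gcongr
      _ = _ := by rw [hqd]; ring
  have h4 := residual_error_le h hK hB hq1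
  rw [← hqd] at h4
  linarith

lemma IsScale.measureReal_regularNoise_compl_le {n d : ℕ} {L w K : ℝ} (h : IsScale n d L w)
    {Ω : Type*} [MeasurableSpace Ω] {P : Measure Ω} [IsProbabilityMeasure P]
    {z : Fin n → Ω → EuclideanSpace ℝ (Fin d)} (hzm : ∀ i, Measurable (z i)) (hind : iIndepFun z P)
    (hz : ∀ i, HasLaw (z i) (stdGaussian _) P) {e : EuclideanSpace ℝ (Fin d)} (he : ‖e‖ = 1)
    (m : ℝ) (hK : 0 ≤ K) {η σ : ℝ} {k₀ k : ℕ} (hη1 : η ≤ 1)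
    (hq₁ : √(K + 20) * (d * L * w) ≤ 2)
    (hq₂ : 960000 * (√(K + 20) * (K + 3) + 1) * (d * L * w) ≤ η)
    (hq₃ : √(K + 3) * (d * L * w) ≤ 1)
    (hs₀ : P.real {ω | ¬ SubsetBound (fun i => z i ω) k₀ η} ≤ Real.exp (-(K * L)))
    (hs : P.real {ω | ¬ SubsetBound (fun i => z i ω) k σ} ≤ Real.exp (-(K * L))) :
    P.real {ω | ¬ RegularNoise (fun i => z i ω) e m d (192 * √(K + 20) * (√d * w))
      (128 * √(K + 3) * w) ((1 + 256 * (K + 3)) * (d * L)) η σ k₀ k} ≤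
      15 * Real.exp (-(K * L)) := by
  have p1 := h.measureReal_covClose_compl_le hzm hind hz hK hq₁
  have p2 := h.measureReal_norm_weighted_compl_le hzm hind hz hK hη1 hq₂
  have p3 := h.measureReal_coord_weighted_compl_le hzm hind hz he hK hη1 hq₂
  have p4 := h.measureReal_leverage_compl_le hzm hind hz he m hK hq₃
  have hU := (measureReal_union_le _ _).trans
    (add_le_add p1 ((measureReal_union_le _ _).trans (add_le_add p2 ((measureReal_union_le _ _).trans
    (add_le_add p3 ((measureReal_union_le _ _).trans (add_le_add p4
    ((measureReal_union_le _ _).trans (add_le_add hs₀ hs)))))))))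
  refine (measureReal_mono ?_ (measure_ne_top _ _)).trans (hU.trans (by linarith))
  intro ω hω
  by_contra hcon
  simp only [Set.mem_union, Set.mem_ofPred_eq, not_or, not_not] at hcon
  obtain ⟨c1, ⟨c2, c2'⟩, c3, c4, c5, c6⟩ := hcon
  refine hω ⟨c1, ⟨c2', c3⟩, c4, fun i => ?_, c5, c6⟩
  have hL := h.L_ge
  have h6 := (abs_le.1 (c2 i)).2
  have h7 : √(d : ℝ) * ((K + 3) * L) ≤ d * ((K + 3) * L) := by gcongr; exact h.sqrt_d_le
  have h8 : (d : ℝ) ≤ d * L := le_mul_of_one_le_right (by linarith [h.one_le_d]) hL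
  linarith

/-- The noise is regular, with admissible parameters, outside an event of polynomially small
probability. -/
theorem exists_regularNoise {δ K : ℝ} (hδ : 0 < δ) (hδ1 : δ < 1) (hK : 0 ≤ K) :
    ∃ η σ p₀ p C M : ℝ, ∀ (n d : ℕ) (L w : ℝ), IsScale n d L w → C * (d * L * w) ≤ 1 →
      ∀ (e : EuclideanSpace ℝ (Fin d)) (m : ℝ), ‖e‖ = 1 → M ≤ m →
      IsAdmissible n m δ (192 * √(K + 20) * (√d * w)) (128 * √(K + 3) * w)
        ((1 + 256 * (K + 3)) * (d * L)) η σ ⌈p₀ * n⌉₊ ⌈p * n⌉₊ ∧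
      ∀ {Ω : Type} [MeasurableSpace Ω] {P : Measure Ω} [IsProbabilityMeasure P]
        {z : Fin n → Ω → EuclideanSpace ℝ (Fin d)}, (∀ i, Measurable (z i)) → iIndepFun z P →
        (∀ i, HasLaw (z i) (stdGaussian _) P) →
        P.real {ω | ¬ RegularNoise (fun i => z i ω) e m d (192 * √(K + 20) * (√d * w))
          (128 * √(K + 3) * w) ((1 + 256 * (K + 3)) * (d * L)) η σ ⌈p₀ * n⌉₊ ⌈p * n⌉₊} ≤
          15 * Real.exp (-(K * L)) := by
  -- With this σ the contraction factor 80σ/δ² is exactly 1/4. It fixes the basin size p, which in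
  -- turn dictates the spectral accuracy η and then p₀.
  obtain ⟨p, hp, hpK⟩ := exists_subsetBound_proportion (σ := δ ^ 2 / 320) (by positivity)
  obtain ⟨C₁, hC₁⟩ := hpK K hK
  -- The bound η ≤ p/280 leaves 140η at most p/2; the other half of p pays for 5/m².
  obtain ⟨η, hηd⟩ : ∃ t : ℝ, t = min (1 / 24) (p / 280) := ⟨_, rfl⟩
  have hη : 0 < η := hηd ▸ lt_min (by norm_num) (by positivity)
  have hη1 : η ≤ 1 / 24 := hηd ▸ min_le_left _ _
  have hηp : η ≤ p / 280 := hηd ▸ min_le_right _ _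
  obtain ⟨p₀, hp₀, hp₀K⟩ := exists_subsetBound_proportion hη
  obtain ⟨C₂, hC₂⟩ := hp₀K K hK
  obtain ⟨B, hB⟩ : ∃ t : ℝ, t = 1 + 256 * (K + 3) := ⟨_, rfl⟩
  have hB1 : 1 ≤ B := by rw [hB]; linarith
  have hδ' : 0 < 1 - δ := by linarith
  obtain ⟨a₁, ha₁⟩ : ∃ t : ℝ, t = 768 * √(K + 20) := ⟨_, rfl⟩
  obtain ⟨a₂, ha₂⟩ : ∃ t : ℝ, t = 960000 * (√(K + 20) * (K + 3) + 1) / η := ⟨_, rfl⟩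
  obtain ⟨a₄, ha₄⟩ : ∃ t : ℝ, t = (4 * B ^ 2 + 2 * B + 256 * √(K + 3) * B + 147456 * (K + 20) * B) / η := ⟨_, rfl⟩
  obtain ⟨a₅, ha₅⟩ : ∃ t : ℝ, t = 20 * 36864 * (K + 20) / δ ^ 2 / (3 / 8 * p) := ⟨_, rfl⟩
  have h₁ : 0 ≤ a₁ := by rw [ha₁]; positivity
  have h₂ : 0 ≤ a₂ := by rw [ha₂]; positivity
  have h₄ : 0 ≤ a₄ := by rw [ha₄]; positivity
  have h₅ : 0 ≤ a₅ := by rw [ha₅]; positivity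
  have h₃ := Real.sqrt_nonneg (K + 3)
  have hc₁ := abs_nonneg C₁
  have hc₂ := abs_nonneg C₂
  obtain ⟨b₁, hb₁⟩ : ∃ t : ℝ, t = 96 / η := ⟨_, rfl⟩
  obtain ⟨b₂, hb₂⟩ : ∃ t : ℝ, t = 10 / p := ⟨_, rfl⟩
  obtain ⟨b₃, hb₃⟩ : ∃ t : ℝ, t = 2 / (η ^ 2 * p₀) := ⟨_, rfl⟩
  obtain ⟨b₄, hb₄⟩ : ∃ t : ℝ, t = 10 / 3 / ((1 - δ) ^ 2 * p) := ⟨_, rfl⟩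
  have k₁ : 0 ≤ b₁ := by rw [hb₁]; positivity
  have k₂ : 0 ≤ b₂ := by rw [hb₂]; positivity
  have k₃ : 0 ≤ b₃ := by rw [hb₃]; positivity
  have k₄ : 0 ≤ b₄ := by rw [hb₄]; positivity
  -- Sums of nonnegative constants, so that each single requirement on dLw and on m follows from the
  -- one assumption about C or M.
  refine ⟨η, δ ^ 2 / 320, p₀, p, 1 + a₁ + a₂ + √(K + 3) + a₄ + a₅ + |C₁| + |C₂|,
    1 + b₁ + b₂ + b₃ + b₄, ?_⟩
  intro n d L w h hC e m he hM
  obtain ⟨q, hqd⟩ : ∃ t : ℝ, t = d * L * w := ⟨_, rfl⟩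
  have hq0 : 0 ≤ q := hqd ▸ h.q_nonneg
  rw [← hqd] at hC
  have hn := h.n_pos
  have hq1 : q ≤ 1 := by
    rw [← one_mul q]
    exact mul_le_one_of_le (by linarith only [h₁, h₂, h₃, h₄, h₅, hc₁, hc₂]) hq0 hC
  have e₁ := mul_le_one_of_le (a := a₁)
    (by linarith only [h₁, h₂, h₃, h₄, h₅, hc₁, hc₂]) hq0 hC
  have e₂ := mul_le_one_of_le (a := a₂)
    (by linarith only [h₁, h₂, h₃, h₄, h₅, hc₁, hc₂]) hq0 hC
  have e₃ := mul_le_one_of_le (a := √(K + 3))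
    (by linarith only [h₁, h₂, h₃, h₄, h₅, hc₁, hc₂]) hq0 hC
  have e₄ := mul_le_one_of_le (a := a₄)
    (by linarith only [h₁, h₂, h₃, h₄, h₅, hc₁, hc₂]) hq0 hC
  have e₅ := mul_le_one_of_le (a := a₅)
    (by linarith only [h₁, h₂, h₃, h₄, h₅, hc₁, hc₂]) hq0 hC
  have e₆ := mul_le_one_of_le (a := C₁)
    (by linarith only [h₁, h₂, h₃, h₄, h₅, hc₁, hc₂, le_abs_self C₁]) hq0 hC
  have e₇ := mul_le_one_of_le (a := C₂)
    (by linarith only [h₁, h₂, h₃, h₄, h₅, hc₁, hc₂, le_abs_self C₂]) hq0 hC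
  rw [ha₂, div_mul_eq_mul_div, div_le_one hη] at e₂
  rw [ha₄, div_mul_eq_mul_div, div_le_one hη] at e₄
  rw [ha₅, div_mul_eq_mul_div, div_le_one (by positivity)] at e₅
  have hm1 : 1 ≤ m := by linarith only [hM, k₁, k₂, k₃, k₄]
  have hmm : m ≤ m ^ 2 := by nlinarith only [hm1]
  have hκ : √(K + 20) ^ 2 = K + 20 := Real.sq_sqrt (by linarith)
  have hκ0 := Real.sqrt_nonneg (K + 20)
  have hs : √(d : ℝ) ^ 2 = d := Real.sq_sqrt (Nat.cast_nonneg d)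
  have hw := h.w_nonneg
  have hL := h.L_ge
  have hsw : √d * w ≤ q := hqd ▸ h.sqrt_d_mul_w_le
  have hε2 : (192 * √(K + 20) * (√d * w)) ^ 2 ≤ 36864 * (K + 20) * q := by
    calc (192 * √(K + 20) * (√d * w)) ^ 2 ≤ (192 * √(K + 20) * q) ^ 2 := by gcongr
      _ = 36864 * (K + 20) * q ^ 2 := by rw [mul_pow, mul_pow, hκ]; ring
      _ ≤ 36864 * (K + 20) * q := by gcongr; nlinarith only [hq0, hq1]
  have hdL := h.one_le_dL
  refine ⟨⟨by exact_mod_cast hn, hδ, hδ1, hη, hη1, ?_, ?_, by positivity, by positivity,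
    by positivity, ?_, hB ▸ leverage_error_le h hK hB1 (hqd ▸ hq1) (hqd ▸ e₄), ?_, ?_, ?_⟩, ?_⟩
  · linarith only [hM, hb₁, k₂, k₃, k₄]
  · have := mul_le_mul_of_nonneg_left hsw hκ0
    rw [ha₁] at e₁
    linarith only [this, e₁]
  · refine le_trans ?_ (Nat.le_ceil _)
    gcongr
    have h6 : b₃ ≤ m ^ 2 := by linarith only [hM, hmm, k₁, k₂, k₃, k₄]
    rw [hb₃, div_le_iff₀ (by positivity)] at h6
    rw [div_le_iff₀ (by positivity)]
    linarith
  · have : 80 * (δ ^ 2 / 320) / δ ^ 2 = 1 / 4 := by field_simp; norm_num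
    exact this.le
  · refine le_trans ?_ (Nat.le_ceil _)
    gcongr
    have h6 : b₂ ≤ m ^ 2 := by linarith only [hM, hmm, k₁, k₂, k₃, k₄]
    have h7 : 5 / m ^ 2 ≤ p / 2 := by
      rw [hb₂, div_le_iff₀ hp] at h6
      rw [div_le_iff₀ (by positivity)]
      linarith
    linarith
  · have h6 : b₄ ≤ m ^ 2 := by linarith only [hM, hmm, k₁, k₂, k₃, k₄]
    have h7 : 5 / 4 / ((1 - δ) * m) ^ 2 ≤ 3 / 8 * p := by
      rw [hb₄, div_le_iff₀ (by positivity)] at h6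
      rw [div_le_iff₀ (by positivity)]
      linarith
    have h8 : 20 * (192 * √(K + 20) * (√d * w)) ^ 2 / δ ^ 2 ≤ 3 / 8 * p := by
      refine le_trans ?_ e₅
      calc 20 * (192 * √(K + 20) * (√d * w)) ^ 2 / δ ^ 2 ≤ 20 * (36864 * (K + 20) * q) / δ ^ 2 := by
            gcongr
        _ = _ := by ring
    have h9 : p * n ≤ ⌈p * n⌉₊ := Nat.le_ceil _
    have h10 := mul_le_mul_of_nonneg_right (add_le_add h7 h8) hn.le
    linarith
  · intro Ω _ P _ z hzm hind hz
    rw [ha₁] at e₁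
    exact h.measureReal_regularNoise_compl_le hzm hind hz he m hK (by linarith only [hη1])
      (by rw [← hqd]; linarith only [e₁, mul_nonneg hκ0 hq0]) (hqd ▸ e₂) (hqd ▸ e₃)
      (hC₂ n d L w h (hqd ▸ e₇) hzm hind hz) (hC₁ n d L w h (hqd ▸ e₆) hzm hind hz)

end Parameters

/-! ### High-probability error bounds in the two signal regimes. -/

section TwoStageBounds

open scoped RealInnerProductSpace

/-- On the noise `z`, the two-stage procedure misclassifies at most `F` samples, whatever the
coordinates and the labels. -/
def TwoStageBound {n d : ℕ} (z : Fin n → EuclideanSpace ℝ (Fin d)) (e : EuclideanSpace ℝ (Fin d))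
    (m F : ℝ) : Prop :=
  ∀ (X : Matrix (Fin n) (Fin d) ℝ) (y yhat : Fin n → ℝ)
    (A : (Fin d → ℝ) ≃ₗ[ℝ] EuclideanSpace ℝ (Fin d)), IsWhitenedModel X y A e m z →
    IsTwoStageOutput X yhat → n * misclass yhat y ≤ F

lemma IsScale.sq_error_mul_eq {n d : ℕ} {L w K : ℝ} (h : IsScale n d L w) (hK : 0 ≤ K) (δ : ℝ) :
    20 * (192 * √(K + 20) * (√d * w)) ^ 2 / δ ^ 2 * n =
      20 * 36864 * (K + 20) / δ ^ 2 * (d * L) := by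
  have hκ : √(K + 20) ^ 2 = K + 20 := Real.sq_sqrt (by linarith)
  have hs : √(d : ℝ) ^ 2 = d := Real.sq_sqrt (Nat.cast_nonneg d)
  rw [mul_pow, mul_pow, mul_pow, hκ, hs]
  linear_combination (20 * 36864 * (K + 20) / δ ^ 2 * d) * h.sq_w

/-- Outside an event of polynomially small probability, the two-stage procedure makes at most a
constant multiple of `N + d log n` errors, where `N` is the number of atypical noise vectors. -/
theorem exists_twoStageBound {δ K : ℝ} (hδ : 0 < δ) (hδ1 : δ < 1) (hK : 0 ≤ K) :
    ∃ C M : ℝ, ∀ (n d : ℕ) (L w : ℝ), IsScale n d L w → C * (d * L * w) ≤ 1 →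
      ∀ (e : EuclideanSpace ℝ (Fin d)) (m : ℝ), ‖e‖ = 1 → M ≤ m →
      ∀ {Ω : Type} [MeasurableSpace Ω] {P : Measure Ω} [IsProbabilityMeasure P]
        {z : Fin n → Ω → EuclideanSpace ℝ (Fin d)}, (∀ i, Measurable (z i)) → iIndepFun z P →
        (∀ i, HasLaw (z i) (stdGaussian _) P) →
        P.real {ω | ¬ TwoStageBound (fun i => z i ω) e m
          (1 + 4 / 3 * (noiseCount e (fun i => z i ω) ((1 - δ) * m) +
            20 * 36864 * (K + 20) / δ ^ 2 * (d * L)))} ≤ 15 * Real.exp (-(K * L)) := by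
  obtain ⟨η, σ, p₀, p, C, M, H⟩ := exists_regularNoise hδ hδ1 hK
  refine ⟨C, M, fun n d L w h hC e m he hM Ω _ P _ z hzm hind hz => ?_⟩
  obtain ⟨ha, hP⟩ := H n d L w h hC e m he hM
  refine (measureReal_mono ?_ (measure_ne_top _ _)).trans (hP hzm hind hz)
  intro ω hω hcon
  refine hω fun X y yhat A hX hy => ?_
  rw [← h.sq_error_mul_eq hK]
  exact hX.misclass_le_of_isTwoStageOutput he hcon ha hy

/-- When the signal strength is large enough, all errors of the two-stage procedure are at
atypical noise vectors, outside an event of polynomially small probability. -/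
theorem exists_twoStageBound_of_le_sq {δ K : ℝ} (hδ : 0 < δ) (hδ1 : δ ≤ 1 / 20) (hK : 0 ≤ K) :
    ∃ C M V : ℝ, ∀ (n d : ℕ) (L w : ℝ), IsScale n d L w → C * (d * L * w) ≤ 1 →
      V ≤ Real.exp (L / 20) →
      ∀ (e : EuclideanSpace ℝ (Fin d)) (m : ℝ), ‖e‖ = 1 → M ≤ m → L ≤ m ^ 2 →
      ∀ {Ω : Type} [MeasurableSpace Ω] {P : Measure Ω} [IsProbabilityMeasure P]
        {z : Fin n → Ω → EuclideanSpace ℝ (Fin d)}, (∀ i, Measurable (z i)) → iIndepFun z P →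
        (∀ i, HasLaw (z i) (stdGaussian _) P) →
        P.real {ω | ¬ TwoStageBound (fun i => z i ω) e m
          (noiseCount e (fun i => z i ω) ((1 - δ) * m))} ≤ 17 * Real.exp (-(K * L)) := by
  obtain ⟨η, σ, p₀, p, C, M, H⟩ := exists_regularNoise hδ (by linarith) hK
  set B := 1 + 256 * (K + 3) with hB
  have hB1 : 1 ≤ B := by rw [hB]; linarith
  set a := 4 * (147456 * (K + 20) * B) / (δ ^ 2 / 16) with ha
  have ha0 : 0 ≤ a := by positivity
  set Cε := 20 * 36864 * (K + 20) / δ ^ 2 with hCε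
  have hCε0 : 0 ≤ Cε := by positivity
  set c := 960 + 24 * (K + 9) with hc
  have hc0 : 0 ≤ c := by positivity
  set V₁ := 1 + 4 / 3 * (2 + 20 * K + Cε) with hV₁
  have hV₁0 : 0 ≤ V₁ := by positivity
  set V₂ := 128 * B * c / (δ ^ 2 / 16) with hV₂
  have hV₂0 : 0 ≤ V₂ := by positivity
  refine ⟨|C| + a + 1, M, 1 + V₁ + V₂, fun n d L w h hC hV e m he hM hLm Ω _ P _ z hzm hind hz => ?_⟩
  have hq0 := h.q_nonneg
  have hn := h.n_pos
  have hL := h.L_ge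
  have hdL := h.one_le_dL
  have hC' : C * (d * L * w) ≤ 1 := mul_le_one_of_le (by linarith [le_abs_self C]) hq0 hC
  have hCa : a * (d * L * w) ≤ 1 := mul_le_one_of_le (by linarith [abs_nonneg C]) hq0 hC
  have hq1 : d * L * w ≤ 1 := by
    rw [← one_mul (d * L * w)]
    exact mul_le_one_of_le (by linarith [abs_nonneg C]) hq0 hC
  obtain ⟨had, hP⟩ := H n d L w h hC' e m he hM
  -- All quantities are measured in powers of v = n^{1/20}: dL ≤ v¹⁰, the noise count is O(v¹¹), k'
  -- is about v¹², and σ' is O(v⁻⁷). The threshold V makes a single factor v exceed every constant.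
  set v := Real.exp (L / 20) with hv
  have hv1 : 1 ≤ v := by linarith
  have hv0 : 0 < v := by linarith
  have hvn : (n : ℝ) = v ^ 20 := by
    rw [← h.exp_L, hv, ← Real.exp_nat_mul]; congr 1; push_cast; ring
  have hLv : L ≤ 20 * v := by
    have := Real.add_one_le_exp (L / 20)
    rw [← hv] at this
    linarith
  have hdLv : d * L ≤ v ^ 10 := by
    apply le_of_sq_le_sq _ (by positivity)
    calc (d * L : ℝ) ^ 2 = d ^ 2 * L ^ 2 := by ring
      _ ≤ d ^ 2 * L ^ 3 := by gcongr; norm_num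
      _ = (d * L * w) ^ 2 * n := h.sq_q_mul.symm
      _ ≤ 1 ^ 2 * n := by gcongr
      _ = (v ^ 10) ^ 2 := by rw [hvn]; ring
  set k' := ⌈v ^ 12⌉₊ with hk'
  have hk'l : v ^ 12 ≤ k' := Nat.le_ceil _
  have hk'u : (k' : ℝ) ≤ 2 * v ^ 12 := by
    have h1 := (Nat.ceil_lt_add_one (show 0 ≤ v ^ 12 by positivity)).le
    have h2 : 1 ≤ v ^ 12 := one_le_pow₀ hv1
    linarith
  set σ' := (24 * L * k' + 24 * (K + 9) * (d * L)) / n with hσ'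
  have hσ'0 : 0 ≤ σ' := by positivity
  have hσ'n : σ' * n = 24 * L * k' + 24 * (K + 9) * (d * L) := by
    rw [hσ']; field_simp
  have hd1 := h.one_le_d
  -- With b = 4L the term 2n exp(−b/4) is the constant 2, so the subset bound holds down to sets of
  -- size k' at the cost of a factor log n.
  have hsub := measureReal_subsetBound_compl_le (K := K) (L := L) hzm hind hz
    (b := 4 * L) (by linarith) k' (σ := σ') (by
      have h1 : 2 * n * Real.exp (-(4 * L / 4)) = 2 := by
        rw [mul_div_cancel_left₀ L (by norm_num), mul_assoc, h.n_mul_exp_neg, mul_one]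
      rw [h1, hσ'n]
      have h5 : K * L ≤ K * (d * L) := by gcongr; exact le_mul_of_one_le_left (by linarith) hd1
      have h6 : (d : ℝ) ≤ d * L := le_mul_of_one_le_right (by linarith) hL
      linarith)
  have hm0 : 0 ≤ m := by linarith [had.one_le_m]
  have hcount := measureReal_count_ge_le hzm hind hz he (x := (1 - δ) * m)
    (mul_nonneg (by linarith) hm0) (2 * n * Real.exp (-(((1 - δ) * m) ^ 2 / 2)) + K * L)
  rw [show -(2 * n * Real.exp (-(((1 - δ) * m) ^ 2 / 2)) + K * L) +
    2 * n * Real.exp (-(((1 - δ) * m) ^ 2 / 2)) = -(K * L) by ring] at hcount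
  have hU := (measureReal_union_le _ _).trans (add_le_add (hP hzm hind hz)
    ((measureReal_union_le _ _).trans (add_le_add hsub hcount)))
  refine (measureReal_mono ?_ (measure_ne_top _ _)).trans (hU.trans (by linarith))
  intro ω hω
  by_contra hcon
  simp only [Set.mem_union, Set.mem_ofPred_eq, not_or, not_not, not_le] at hcon
  obtain ⟨c1, c2, c3⟩ := hcon
  refine hω fun X y yhat A hX hy => ?_
  refine hX.misclass_le_of_isTwoStageOutput_of_small he c1 had hσ'0 c2 ?_ ?_ hy
  · rw [h.sq_error_mul_eq hK, ← hCε]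
    refine le_trans ?_ hk'l
    -- As m² ≥ L and δ ≤ 1/20, this amounts to 1 − (19/20)²/2 ≤ 11/20, which is why δ is capped at
    -- 1/20.
    have h1 : n * Real.exp (-(((1 - δ) * m) ^ 2 / 2)) ≤ v ^ 11 := by
      rw [← h.exp_L, ← Real.exp_add, hv, ← Real.exp_nat_mul]
      gcongr
      have h2 : (19 / 20) ^ 2 * m ^ 2 ≤ ((1 - δ) * m) ^ 2 := by
        rw [← mul_pow]; gcongr; linarith
      push_cast
      linarith
    have h2 : (noiseCount e (fun i => z i ω) ((1 - δ) * m) : ℝ) ≤ 2 * v ^ 11 + K * L :=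
      c3.le.trans (by linarith)
    have h3 : K * L ≤ 20 * K * v ^ 11 := by
      calc K * L ≤ K * (20 * v) := by gcongr
        _ = 20 * K * v ^ 1 := by ring
        _ ≤ 20 * K * v ^ 11 := by gcongr; norm_num
    have h4 : Cε * (d * L) ≤ Cε * v ^ 11 := by
      gcongr
      exact hdLv.trans (pow_le_pow_right₀ hv1 (by norm_num))
    have h5 : 1 ≤ v ^ 11 := one_le_pow₀ hv1
    calc 1 + 4 / 3 * (noiseCount e (fun i => z i ω) ((1 - δ) * m) + Cε * (d * L)) ≤
        V₁ * v ^ 11 := by rw [hV₁]; linarith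
      _ ≤ v * v ^ 11 := by gcongr; linarith
      _ = v ^ 12 := by ring
  · have h1 := residual_error_le h hK hB1 hq1
    have h2 : 4 * (147456 * (K + 20) * B) * (d * L * w) ≤ δ ^ 2 / 16 := by
      rwa [ha, div_mul_eq_mul_div, div_le_one (by positivity)] at hCa
    have h3 : B * (d * L) + 1 ≤ 2 * B * v ^ 10 := by
      have h4 : B * (d * L) ≤ B * v ^ 10 := by gcongr
      have h5 : 1 ≤ v ^ 10 := one_le_pow₀ hv1
      have h6 : v ^ 10 ≤ B * v ^ 10 := le_mul_of_one_le_left (by positivity) hB1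
      linarith
    have h4 : σ' * v ^ 7 ≤ c := by
      have h5 : σ' * v ^ 20 ≤ c * v ^ 13 := by
        rw [← hvn, hσ'n]
        have h6 : L * k' ≤ 20 * v * (2 * v ^ 12) := by gcongr
        have h7 : (K + 9) * (d * L) ≤ (K + 9) * v ^ 13 := by
          gcongr
          exact hdLv.trans (pow_le_pow_right₀ hv1 (by norm_num))
        rw [hc]
        linarith
      have h6 : σ' * v ^ 7 * v ^ 13 ≤ c * v ^ 13 := by
        calc σ' * v ^ 7 * v ^ 13 = σ' * v ^ 20 := by ring
          _ ≤ _ := h5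
      exact le_of_mul_le_mul_right h6 (by positivity)
    have h5 : (k' : ℝ) / n * v ^ 8 ≤ 2 := by
      rw [div_mul_eq_mul_div, div_le_iff₀ hn]
      rw [hvn]
      calc (k' : ℝ) * v ^ 8 ≤ 2 * v ^ 12 * v ^ 8 := by gcongr
        _ = 2 * v ^ 20 := by ring
    -- The powers of v add up to 10 − 8 − 7 = −5, so the term vanishes polynomially in n.
    have h6 : 2 * (B * (d * L) + 1) * (16 * (k' / n) * σ') < δ ^ 2 / 16 := by
      have h7 : 2 * (B * (d * L) + 1) * (16 * (k' / n) * σ') ≤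
          2 * (2 * B * v ^ 10) * (16 * (k' / n) * σ') := by gcongr
      have h8 : 2 * (2 * B * v ^ 10) * (16 * (k' / n) * σ') * v ^ 5 ≤ 128 * B * c := by
        calc 2 * (2 * B * v ^ 10) * (16 * (k' / n) * σ') * v ^ 5 =
              64 * B * ((k' / n * v ^ 8) * (σ' * v ^ 7)) := by ring
          _ ≤ 64 * B * (2 * c) := by gcongr
          _ = _ := by ring
      have h9 : 128 * B * c < δ ^ 2 / 16 * v := by
        have : V₂ < v := by linarith
        rw [hV₂, div_lt_iff₀ (by positivity)] at this
        linarith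
      have h10 : v ≤ v ^ 5 := le_self_pow₀ hv1 (by norm_num)
      have h11 : δ ^ 2 / 16 * v ≤ δ ^ 2 / 16 * v ^ 5 := by gcongr
      have h12 : 2 * (2 * B * v ^ 10) * (16 * (k' / n) * σ') * v ^ 5 < δ ^ 2 / 16 * v ^ 5 := by
        linarith
      exact h7.trans_lt (lt_of_mul_lt_mul_right h12 (by positivity))
    have h7 : 0 < δ ^ 2 := by positivity
    linarith

end TwoStageBounds

/-! ### Reduction of the mixture model to whitened Gaussian noise. -/

section ModelReduction

open Matrix
open scoped RealInnerProductSpace MatrixOrder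

variable {n d : ℕ}

/-- The symmetric square root of a covariance matrix, and its inverse, as operators. -/
lemma exists_sqrt_operator {Sig : Matrix (Fin d) (Fin d) ℝ} (hSig : Sig.PosDef) :
    ∃ Q : EuclideanSpace ℝ (Fin d) →L[ℝ] EuclideanSpace ℝ (Fin d),
      (∀ x, Q (toEuclideanCLM (𝕜 := ℝ) (CFC.sqrt Sig) x) = x) ∧
      (∀ x, toEuclideanCLM (𝕜 := ℝ) (CFC.sqrt Sig) (Q x) = x) ∧
      (∀ x y, ⟪toEuclideanCLM (𝕜 := ℝ) (CFC.sqrt Sig) x, y⟫ =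
        ⟪x, toEuclideanCLM (𝕜 := ℝ) (CFC.sqrt Sig) y⟫) ∧
      ∀ μ, snr μ Sig = ‖Q μ‖ ^ 2 := by
  set S := CFC.sqrt Sig with hS
  have hSS : S * S = Sig :=
    CFC.sqrt_mul_sqrt_self _ (Matrix.nonneg_iff_posSemidef.2 hSig.posSemidef)
  have hSt : Sᵀ = S := by
    have : S.PosSemidef := Matrix.nonneg_iff_posSemidef.1 (CFC.sqrt_nonneg _)
    simpa using this.1.eq
  have hdet : IsUnit S.det := by
    have h1 : IsUnit Sig.det := hSig.isUnit.map Matrix.detMonoidHom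
    rw [← hSS, Matrix.det_mul] at h1
    exact isUnit_of_mul_isUnit_left h1
  refine ⟨toEuclideanCLM (𝕜 := ℝ) S⁻¹, fun x => ?_, fun x => ?_, fun x y => ?_, fun μ => ?_⟩
  · rw [← mul_apply_eq_comp, ← map_mul, Matrix.nonsing_inv_mul _ hdet, map_one]
    rfl
  · rw [← mul_apply_eq_comp, ← map_mul, Matrix.mul_nonsing_inv _ hdet, map_one]
    rfl
  · rw [EuclideanSpace.inner_eq_star_dotProduct, EuclideanSpace.inner_eq_star_dotProduct,
      Matrix.ofLp_toEuclideanCLM, Matrix.ofLp_toEuclideanCLM, star_trivial, star_trivial,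
      dotProduct_mulVec_mulVec, hSt, dotProduct_comm]
  · rw [EuclideanSpace.norm_eq, Real.sq_sqrt (by positivity), snr, ← hSS, Matrix.mul_inv_rev,
      ← Matrix.mulVec_mulVec, dotProduct_mulVec_mulVec, Matrix.transpose_nonsing_inv, hSt]
    simp only [dotProduct, Matrix.ofLp_toEuclideanCLM, Real.norm_eq_abs, sq_abs]
    simp only [sq]

lemma map_neg_stdGaussian :
    (stdGaussian (EuclideanSpace ℝ (Fin d))).map (fun x => -x) = stdGaussian _ :=
  stdGaussian_map (LinearIsometryEquiv.neg ℝ)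

/-- Multiplication by the label merges the two components: for label 1 the whitened, centred vector
is the standard Gaussian itself, for label −1 its negative, which has the same law. -/
lemma map_mixtureLaw_eq_stdGaussian {Sig : Matrix (Fin d) (Fin d) ℝ}
    {Q : EuclideanSpace ℝ (Fin d) →L[ℝ] EuclideanSpace ℝ (Fin d)}
    (hQ : ∀ x, Q (toEuclideanCLM (𝕜 := ℝ) (CFC.sqrt Sig) x) = x) (μ : EuclideanSpace ℝ (Fin d)) :
    (mixtureLaw μ Sig).map (fun p => Q (p.2 • p.1 - μ)) = stdGaussian _ := by
  have hg : Measurable fun p : EuclideanSpace ℝ (Fin d) × ℝ => Q (p.2 • p.1 - μ) := by fun_prop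
  have h1 : ((multivariateGaussian μ Sig).prod (Measure.dirac 1)).map
      (fun p : EuclideanSpace ℝ (Fin d) × ℝ => Q (p.2 • p.1 - μ)) = stdGaussian _ := by
    rw [Measure.prod_dirac, multivariateGaussian, Measure.map_map (by fun_prop) (by fun_prop),
      Measure.map_map (by fun_prop) (by fun_prop)]
    have : ((fun p : EuclideanSpace ℝ (Fin d) × ℝ => Q (p.2 • p.1 - μ)) ∘ (fun x => (x, 1))) ∘
        (fun x => μ + toEuclideanCLM (𝕜 := ℝ) (CFC.sqrt Sig) x) = id := by
      funext x
      simp [hQ]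
    rw [this, Measure.map_id]
  have h2 : ((multivariateGaussian (-μ) Sig).prod (Measure.dirac (-1))).map
      (fun p : EuclideanSpace ℝ (Fin d) × ℝ => Q (p.2 • p.1 - μ)) = stdGaussian _ := by
    rw [Measure.prod_dirac, multivariateGaussian, Measure.map_map (by fun_prop) (by fun_prop),
      Measure.map_map (by fun_prop) (by fun_prop)]
    have : ((fun p : EuclideanSpace ℝ (Fin d) × ℝ => Q (p.2 • p.1 - μ)) ∘ (fun x => (x, -1))) ∘
        (fun x => -μ + toEuclideanCLM (𝕜 := ℝ) (CFC.sqrt Sig) x) = fun x => -x := by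
      funext x
      simp [hQ]
    rw [this, map_neg_stdGaussian]
  rw [mixtureLaw, Measure.map_add _ _ hg, Measure.map_smul, Measure.map_smul, h1, h2, ← add_smul,
    ENNReal.inv_two_add_inv_two, one_smul]

lemma ae_mixtureLaw (μ : EuclideanSpace ℝ (Fin d)) (Sig : Matrix (Fin d) (Fin d) ℝ) :
    ∀ᵐ p ∂(mixtureLaw μ Sig), p.2 = 1 ∨ p.2 = -1 := by
  have hm : MeasurableSet {p : EuclideanSpace ℝ (Fin d) × ℝ | p.2 = 1 ∨ p.2 = -1} :=
    (measurableSet_eq_fun measurable_snd measurable_const).union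
      (measurableSet_eq_fun measurable_snd measurable_const)
  rw [mixtureLaw, ae_add_measure_iff]
  constructor
  · refine Measure.ae_smul_measure ?_ _
    rw [Measure.prod_dirac, ae_map_iff (by fun_prop) hm]
    simp
  · refine Measure.ae_smul_measure ?_ _
    rw [Measure.prod_dirac, ae_map_iff (by fun_prop) hm]
    simp

/-- In suitable coordinates, the mixture model is a whitened model with standard Gaussian noise. -/
lemma IsMixtureSample.exists_whitened {Ω : Type*} [MeasurableSpace Ω] {P : Measure Ω}
    {μ : EuclideanSpace ℝ (Fin d)} {Sig : Matrix (Fin d) (Fin d) ℝ}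
    {x : Fin n → Ω → EuclideanSpace ℝ (Fin d)} {y : Fin n → Ω → ℝ}
    (h : IsMixtureSample P μ Sig x y) (hSig : Sig.PosDef) (hsnr : 0 < snr μ Sig) :
    ∃ (e : EuclideanSpace ℝ (Fin d)) (A : (Fin d → ℝ) ≃ₗ[ℝ] EuclideanSpace ℝ (Fin d))
      (z : Ω → Fin n → EuclideanSpace ℝ (Fin d)), ‖e‖ = 1 ∧
      HasLaw z (Measure.pi fun _ => stdGaussian _) P ∧
      ∀ᵐ ω ∂P, IsWhitenedModel (dataMatrix fun i => x i ω) (fun i => y i ω) A e (√(snr μ Sig))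
        (z ω) := by
  obtain ⟨Q, hQR, hRQ, hR, hsn⟩ := exists_sqrt_operator hSig
  set R := toEuclideanCLM (𝕜 := ℝ) (CFC.sqrt Sig) with hRdef
  have hm : √(snr μ Sig) = ‖Q μ‖ := by rw [hsn, Real.sqrt_sq (norm_nonneg _)]
  have hm0 : 0 < ‖Q μ‖ := by rw [← hm]; exact Real.sqrt_pos.2 hsnr
  let B : EuclideanSpace ℝ (Fin d) ≃ₗ[ℝ] EuclideanSpace ℝ (Fin d) :=
    LinearEquiv.ofLinearMap R.toLinearMap Q.toLinearMap (LinearMap.ext hRQ) (LinearMap.ext hQR)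
  let A : (Fin d → ℝ) ≃ₗ[ℝ] EuclideanSpace ℝ (Fin d) :=
    (WithLp.linearEquiv 2 ℝ (Fin d → ℝ)).symm.trans B
  have hA : ∀ u, A u = R (WithLp.toLp 2 u) := fun u => rfl
  have hlaw : ∀ i, HasLaw (fun ω => Q (y i ω • x i ω - μ)) (stdGaussian _) P := fun i =>
    HasLaw.fun_comp (Y := fun p : EuclideanSpace ℝ (Fin d) × ℝ => Q (p.2 • p.1 - μ))
      ⟨by fun_prop, map_mixtureLaw_eq_stdGaussian hQR μ⟩ (h.law i)
  have hind : iIndepFun (fun i ω => Q (y i ω • x i ω - μ)) P :=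
    h.indep.comp (fun _ p => Q (p.2 • p.1 - μ)) (fun _ => by fun_prop)
  refine ⟨‖Q μ‖⁻¹ • Q μ, A, fun ω i => Q (y i ω • x i ω - μ), ?_, iIndepFun.hasLaw_pi hlaw hind, ?_⟩
  · rw [norm_smul, norm_inv, norm_norm, inv_mul_cancel₀ hm0.ne']
  have hy : ∀ᵐ ω ∂P, ∀ i, y i ω = 1 ∨ y i ω = -1 := by
    rw [ae_all_iff]
    intro i
    have h1 := ae_mixtureLaw μ Sig
    rw [← (h.law i).map_eq] at h1
    exact ae_of_ae_map (h.law i).aemeasurable h1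
  filter_upwards [hy] with ω hω
  refine ⟨hω, fun u i => ?_⟩
  have hyy : y i ω * y i ω = 1 := by rcases hω i with h | h <;> rw [h] <;> norm_num
  have h1 : (dataMatrix (fun i => x i ω) *ᵥ u) i = ⟪x i ω, WithLp.toLp 2 u⟫ := by
    rw [EuclideanSpace.inner_eq_star_dotProduct, star_trivial, dotProduct_comm]
    rfl
  have h2 : x i ω = y i ω • R (Q (y i ω • x i ω - μ) + Q μ) := by
    rw [← map_add, hRQ, sub_add_cancel, smul_smul, hyy, one_smul]
  have h3 : fitted (‖Q μ‖⁻¹ • Q μ) ‖Q μ‖ (fun i => Q (y i ω • x i ω - μ)) (A u) i =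
      ⟪Q (y i ω • x i ω - μ) + Q μ, A u⟫ := by
    rw [fitted, real_inner_smul_left, inner_add_left, ← mul_assoc, mul_inv_cancel₀ hm0.ne',
      one_mul, real_inner_comm (Q (y i ω • x i ω - μ)) (A u), add_comm]
  rw [h1, hm, h3, hA, ← hR, ← real_inner_smul_left, ← h2]

end ModelReduction

/-! ### Risk and exact recovery from the high-probability bounds. -/

section Risk

open scoped RealInnerProductSpace

variable {n d : ℕ}

lemma misclass_nonneg (yhat y : Fin n → ℝ) : 0 ≤ misclass yhat y := by
  unfold misclass; positivity

lemma misclass_le_one (yhat y : Fin n → ℝ) : misclass yhat y ≤ 1 := by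
  unfold misclass
  refine div_le_one_of_le₀ ?_ (Nat.cast_nonneg n)
  have h1 : (Finset.univ.filter fun i => yhat i ≠ y i).card ≤ n :=
    (Finset.card_le_univ _).trans (by simp)
  exact_mod_cast (min_le_left _ _).trans h1

lemma noiseCount_eq_sum (e : EuclideanSpace ℝ (Fin d)) (z : Fin n → EuclideanSpace ℝ (Fin d))
    (x : ℝ) : (noiseCount e z x : ℝ) = ∑ i, Set.indicator {v | ⟪e, v⟫ ≤ -x} 1 (z i) := by
  rw [noiseCount, Finset.card_filter]
  push_cast
  exact Finset.sum_congr rfl fun i _ => by simp [Set.indicator_apply]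

lemma integrable_noiseCount_and_integral_le {e : EuclideanSpace ℝ (Fin d)} (he : ‖e‖ = 1) {x : ℝ}
    (hx : 0 ≤ x) :
    Integrable (fun z : Fin n → EuclideanSpace ℝ (Fin d) => (noiseCount e z x : ℝ))
      (Measure.pi fun _ => stdGaussian _) ∧
    ∫ z : Fin n → EuclideanSpace ℝ (Fin d), (noiseCount e z x : ℝ)
      ∂(Measure.pi fun _ => stdGaussian _) ≤ n * Real.exp (-(x ^ 2 / 2)) := by
  have hA : MeasurableSet {v : EuclideanSpace ℝ (Fin d) | ⟪e, v⟫ ≤ -x} :=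
    measurableSet_le (by fun_prop) measurable_const
  have hmp := fun i : Fin n => measurePreserving_eval
    (fun _ : Fin n => stdGaussian (EuclideanSpace ℝ (Fin d))) i
  have hi : ∀ i : Fin n, Integrable (fun z : Fin n → EuclideanSpace ℝ (Fin d) =>
      Set.indicator {v : EuclideanSpace ℝ (Fin d) | ⟪e, v⟫ ≤ -x} (1 : EuclideanSpace ℝ (Fin d) → ℝ) (z i))
      (Measure.pi fun _ => stdGaussian _) := fun i =>
    (hmp i).integrable_comp_of_integrable ((integrable_const (1 : ℝ)).indicator hA)
  simp only [noiseCount_eq_sum]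
  refine ⟨integrable_finsetSum _ fun i _ => hi i, ?_⟩
  rw [integral_finsetSum _ fun i _ => hi i]
  have h1 : ∀ i ∈ (Finset.univ : Finset (Fin n)), ∫ z : Fin n → EuclideanSpace ℝ (Fin d),
      Set.indicator {v : EuclideanSpace ℝ (Fin d) | ⟪e, v⟫ ≤ -x} (1 : EuclideanSpace ℝ (Fin d) → ℝ) (z i)
      ∂(Measure.pi fun _ => stdGaussian _) ≤ Real.exp (-(x ^ 2 / 2)) := by
    intro i _
    have h2 := (hmp i).hasLaw.integral_comp
      (f := Set.indicator {v : EuclideanSpace ℝ (Fin d) | ⟪e, v⟫ ≤ -x} (1 : EuclideanSpace ℝ (Fin d) → ℝ))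
      (measurable_one.indicator hA).aestronglyMeasurable
    refine (le_of_eq ?_).trans (measureReal_inner_le_neg_le he hx)
    rw [← integral_indicator_one hA, ← h2]
    rfl
  refine (Finset.sum_le_sum h1).trans (le_of_eq ?_)
  simp

variable {Ω : Type*} [MeasurableSpace Ω] {P : Measure Ω}
  {μ : EuclideanSpace ℝ (Fin d)} {Sig : Matrix (Fin d) (Fin d) ℝ}
  {x : Fin n → Ω → EuclideanSpace ℝ (Fin d)} {y : Fin n → Ω → ℝ} {yhat : Ω → Fin n → ℝ}

/-- Transfer of a bound for the two-stage procedure to the risk. -/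
lemma IsMixtureSample.integral_misclass_le (hn : 0 < n) (h : IsMixtureSample P μ Sig x y)
    (hSig : Sig.PosDef) (hsnr : 0 < snr μ Sig)
    (hout : ∀ᵐ ω ∂P, IsTwoStageOutput (dataMatrix fun i => x i ω) (yhat ω))
    {c₀ c₁ κ δ : ℝ} (hc₀ : 0 ≤ c₀) (hc₁ : 0 ≤ c₁) (hδ : δ ≤ 1)
    (hbad : ∀ e : EuclideanSpace ℝ (Fin d), ‖e‖ = 1 →
      (Measure.pi fun _ : Fin n => stdGaussian (EuclideanSpace ℝ (Fin d))).real
        {z | ¬ TwoStageBound z e (√(snr μ Sig))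
          (c₀ + c₁ * noiseCount e z ((1 - δ) * √(snr μ Sig)))} ≤ κ) :
    ∫ ω, misclass (yhat ω) (fun i => y i ω) ∂P ≤
      κ + c₀ / n + c₁ * Real.exp (-((1 - δ) ^ 2 * snr μ Sig / 2)) := by
  obtain ⟨e, A, Z, he, hZ, hw⟩ := h.exists_whitened hSig hsnr
  have hn' : (0 : ℝ) < n := by exact_mod_cast hn
  set m := √(snr μ Sig) with hm
  have hm2 : m ^ 2 = snr μ Sig := Real.sq_sqrt hsnr.le
  set π := Measure.pi fun _ : Fin n => stdGaussian (EuclideanSpace ℝ (Fin d))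
  -- The bad event quantifies over all matrices and outputs, so it is replaced by a measurable hull
  -- of the same measure.
  set S := toMeasurable π {z | ¬ TwoStageBound z e m (c₀ + c₁ * noiseCount e z ((1 - δ) * m))}
  have hS : MeasurableSet S := measurableSet_toMeasurable _ _
  have hSκ : π.real S ≤ κ := by
    rw [measureReal_def, measure_toMeasurable]; exact hbad e he
  obtain ⟨hNi, hNle⟩ := integrable_noiseCount_and_integral_le (n := n) he (x := (1 - δ) * m)
    (mul_nonneg (by linarith) (Real.sqrt_nonneg _))
  -- An integrable majorant depending on the noise only: the risk is at most 1 on the bad event and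
  -- at most the error bound divided by n elsewhere.
  let G : (Fin n → EuclideanSpace ℝ (Fin d)) → ℝ := fun z =>
    S.indicator 1 z + (n : ℝ)⁻¹ * (c₀ + c₁ * noiseCount e z ((1 - δ) * m))
  have h1i : Integrable (S.indicator (1 : (Fin n → EuclideanSpace ℝ (Fin d)) → ℝ)) π := (integrable_const (1 : ℝ)).indicator hS
  have h2i : Integrable (fun z : Fin n → EuclideanSpace ℝ (Fin d) =>
      c₀ + c₁ * (noiseCount e z ((1 - δ) * m) : ℝ)) π :=
    (integrable_const _).add (hNi.const_mul _)
  have hGi : Integrable G π := h1i.add (h2i.const_mul _)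
  have hGZ : Integrable (fun ω => G (Z ω)) P := by
    have := hGi
    rw [← hZ.map_eq] at this
    exact this.comp_aemeasurable hZ.aemeasurable
  have hle : ∫ ω, misclass (yhat ω) (fun i => y i ω) ∂P ≤ ∫ ω, G (Z ω) ∂P := by
    refine integral_mono_of_nonneg (ae_of_all _ fun ω => misclass_nonneg _ _) hGZ ?_
    filter_upwards [hw, hout] with ω hω hoω
    by_cases hz : Z ω ∈ S
    · have h3 : 0 ≤ (n : ℝ)⁻¹ * (c₀ + c₁ * noiseCount e (Z ω) ((1 - δ) * m)) := by positivity
      simp only [G, Set.indicator_of_mem hz, Pi.one_apply]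
      linarith [misclass_le_one (yhat ω) (fun i => y i ω)]
    · have h3 : TwoStageBound (Z ω) e m (c₀ + c₁ * noiseCount e (Z ω) ((1 - δ) * m)) := by
        by_contra hcon
        exact hz (subset_toMeasurable _ _ hcon)
      have h4 := h3 _ _ _ A hω hoω
      simp only [G, Set.indicator_of_notMem hz, zero_add]
      rwa [le_inv_mul_iff₀ hn']
  refine hle.trans ?_
  have hGe : ∫ ω, G (Z ω) ∂P = ∫ z, G z ∂π := hZ.integral_comp hGi.aestronglyMeasurable
  rw [hGe, integral_add h1i (h2i.const_mul _), integral_indicator_one hS, integral_const_mul,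
    integral_add (integrable_const _) (hNi.const_mul _), integral_const_mul, integral_const]
  rw [probReal_univ, one_smul, mul_pow, hm2] at *
  have h5 : (n : ℝ)⁻¹ * (c₀ + c₁ * ∫ z : Fin n → EuclideanSpace ℝ (Fin d),
      (noiseCount e z ((1 - δ) * m) : ℝ) ∂π) ≤
      (n : ℝ)⁻¹ * (c₀ + c₁ * (n * Real.exp (-((1 - δ) ^ 2 * snr μ Sig / 2)))) := by gcongr
  have h6 : (n : ℝ)⁻¹ * (c₀ + c₁ * (n * Real.exp (-((1 - δ) ^ 2 * snr μ Sig / 2)))) =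
      c₀ / n + c₁ * Real.exp (-((1 - δ) ^ 2 * snr μ Sig / 2)) := by field_simp
  linarith

/-- Transfer of a bound for the two-stage procedure to the probability of exact recovery. -/
lemma IsMixtureSample.le_measureReal_misclass_eq_zero [IsProbabilityMeasure P] (hn : 0 < n)
    (h : IsMixtureSample P μ Sig x y) (hSig : Sig.PosDef) (hsnr : 0 < snr μ Sig)
    (hout : ∀ᵐ ω ∂P, IsTwoStageOutput (dataMatrix fun i => x i ω) (yhat ω))
    {κ δ : ℝ} (hδ : δ ≤ 1)
    (hbad : ∀ e : EuclideanSpace ℝ (Fin d), ‖e‖ = 1 →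
      (Measure.pi fun _ : Fin n => stdGaussian (EuclideanSpace ℝ (Fin d))).real
        {z | ¬ TwoStageBound z e (√(snr μ Sig)) (noiseCount e z ((1 - δ) * √(snr μ Sig)))} ≤ κ) :
    1 - (κ + n * Real.exp (-((1 - δ) ^ 2 * snr μ Sig / 2))) ≤
      P.real {ω | misclass (yhat ω) (fun i => y i ω) = 0} := by
  obtain ⟨e, A, Z, he, hZ, hw⟩ := h.exists_whitened hSig hsnr
  have hn' : (0 : ℝ) < n := by exact_mod_cast hn
  set m := √(snr μ Sig) with hm
  have hm2 : m ^ 2 = snr μ Sig := Real.sq_sqrt hsnr.le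
  set π := Measure.pi fun _ : Fin n => stdGaussian (EuclideanSpace ℝ (Fin d))
  set S := toMeasurable π {z | ¬ TwoStageBound z e m (noiseCount e z ((1 - δ) * m))}
  have hS : MeasurableSet S := measurableSet_toMeasurable _ _
  have hSκ : π.real S ≤ κ := by
    rw [measureReal_def, measure_toMeasurable]; exact hbad e he
  obtain ⟨hNi, hNle⟩ := integrable_noiseCount_and_integral_le (n := n) he (x := (1 - δ) * m)
    (mul_nonneg (by linarith) (Real.sqrt_nonneg _))
  -- The count is an integer, so off this event it is 0 and the error bound forces exact recovery.
  -- Markov's inequality bounds the event by the mean count.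
  set S' := toMeasurable π {z | (1 : ℝ) ≤ noiseCount e z ((1 - δ) * m)}
  have hS' : MeasurableSet S' := measurableSet_toMeasurable _ _
  have hSκ' : π.real S' ≤ n * Real.exp (-((1 - δ) ^ 2 * snr μ Sig / 2)) := by
    rw [measureReal_def, measure_toMeasurable]
    have h1 := mul_meas_ge_le_integral_of_nonneg (μ := π)
      (f := fun z => (noiseCount e z ((1 - δ) * m) : ℝ))
      (ae_of_all _ fun z => Nat.cast_nonneg _) hNi 1
    rw [one_mul] at h1
    rw [← hm2, ← mul_pow]
    exact h1.trans hNle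
  have hPS : P.real (Z ⁻¹' S) = π.real S := hZ.measureReal_eq hS
  have hPS' : P.real (Z ⁻¹' S') = π.real S' := hZ.measureReal_eq hS'
  have hcompl : P.real {ω | misclass (yhat ω) (fun i => y i ω) = 0}ᶜ ≤
      P.real (Z ⁻¹' S ∪ Z ⁻¹' S') := by
    refine ENNReal.toReal_mono (measure_ne_top _ _) (measure_mono_ae ?_)
    filter_upwards [hw, hout] with ω hω hoω hmis
    by_contra hcon
    have hcon' : Z ω ∉ S ∧ Z ω ∉ S' := by
      constructor <;> intro hmem
      · exact hcon (Or.inl hmem)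
      · exact hcon (Or.inr hmem)
    have h3 : TwoStageBound (Z ω) e m (noiseCount e (Z ω) ((1 - δ) * m)) := by
      by_contra hc
      exact hcon'.1 (subset_toMeasurable _ _ hc)
    have h4 := h3 _ _ _ A hω hoω
    have h5 : noiseCount e (Z ω) ((1 - δ) * m) = 0 := by
      by_contra hc
      refine hcon'.2 (subset_toMeasurable _ _ ?_)
      have : 1 ≤ noiseCount e (Z ω) ((1 - δ) * m) := Nat.one_le_iff_ne_zero.2 hc
      change (1 : ℝ) ≤ _
      exact_mod_cast this
    rw [h5, Nat.cast_zero] at h4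
    refine hmis (le_antisymm ?_ (misclass_nonneg _ _))
    exact nonpos_of_mul_nonpos_right h4 hn'
  -- Subadditivity alone gives this inequality, so the recovery event need not be measurable.
  have h1 : (1 : ℝ) ≤ P.real {ω | misclass (yhat ω) (fun i => y i ω) = 0} +
      P.real {ω | misclass (yhat ω) (fun i => y i ω) = 0}ᶜ := by
    have := measureReal_union_le (μ := P) {ω | misclass (yhat ω) (fun i => y i ω) = 0}
      {ω | misclass (yhat ω) (fun i => y i ω) = 0}ᶜ
    rwa [Set.union_compl_self, probReal_univ] at this
  have h2 := hcompl.trans (measureReal_union_le _ _)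
  rw [hPS, hPS'] at h2
  linarith

end Risk

/-! ### Passage to the limit in n and in the margin δ. -/

section Asymptotics

lemma tendsto_log_natCast_atTop : Tendsto (fun n : ℕ => Real.log n) atTop atTop :=
  Real.tendsto_log_atTop.comp tendsto_natCast_atTop_atTop

lemma eventually_isScale {d : ℕ → ℕ}
    (hd : Tendsto (fun n : ℕ => (n : ℝ) / ((d n : ℝ) ^ 2 * Real.log n ^ 3)) atTop atTop) (C : ℝ) :
    ∀ᶠ n : ℕ in atTop, IsScale n (d n) (Real.log n) (√(Real.log n / n)) ∧
      C * (d n * Real.log n * √(Real.log n / n)) ≤ 1 := by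
  filter_upwards [eventually_ge_atTop 2, tendsto_log_natCast_atTop.eventually_ge_atTop 1,
    hd.eventually_ge_atTop ((|C| + 1) ^ 2)] with n hn hL hC
  have hn' : (0 : ℝ) < n := by exact_mod_cast (by omega : 0 < n)
  -- Division by zero returns 0, so a divergent ratio excludes dimension 0.
  have hd0 : d n ≠ 0 := by
    intro h0
    rw [h0] at hC
    simp only [Nat.cast_zero, ne_eq, OfNat.ofNat_ne_zero, not_false_eq_true, zero_pow, zero_mul,
      div_zero] at hC
    nlinarith [abs_nonneg C]
  have hd1 : (1 : ℝ) ≤ d n := by exact_mod_cast Nat.one_le_iff_ne_zero.2 hd0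
  have hs : IsScale n (d n) (Real.log n) (√(Real.log n / n)) := by
    refine ⟨hn, Nat.one_le_iff_ne_zero.2 hd0, hL, Real.exp_log hn', Real.sqrt_nonneg _, ?_⟩
    rw [Real.sq_sqrt (by positivity)]
    field_simp
  refine ⟨hs, ?_⟩
  set q := d n * Real.log n * √(Real.log n / n) with hq
  have hq0 : 0 ≤ q := hs.q_nonneg
  have h1 : q ^ 2 * n = d n ^ 2 * Real.log n ^ 3 := hs.sq_q_mul
  rw [le_div_iff₀ (by positivity), ← h1] at hC
  have h2 : ((|C| + 1) * q) ^ 2 ≤ 1 ^ 2 := by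
    have h3 : ((|C| + 1) ^ 2 * q ^ 2) * n ≤ 1 * n := by linarith
    rw [mul_pow, one_pow]
    exact le_of_mul_le_mul_right h3 hn'
  have h3 := le_of_sq_le_sq h2 (by norm_num)
  exact (mul_le_mul_of_nonneg_right (by linarith [le_abs_self C]) hq0).trans h3

/-- If `a ≤ exp (-s / (2 + ε))` eventually for every `ε > 0`, then `ε` can be replaced by a
sequence that tends to `0`. -/
lemma exists_rate {a s : ℕ → ℝ} (ha : ∀ n, 0 ≤ a n) (hs : Tendsto s atTop atTop)
    (h : ∀ ε : ℝ, 0 < ε → ∀ᶠ n in atTop, a n ≤ Real.exp (-(s n) / (2 + ε))) :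
    ∃ δ : ℕ → ℝ, Tendsto δ atTop (𝓝 0) ∧
      ∀ᶠ n in atTop, a n ≤ Real.exp (-(s n) / (2 + δ n)) := by
  -- The smallest nonnegative δ_n for which the bound holds when 0 < a_n < 1. If a_n = 0, the
  -- convention log 0 = 0 gives δ_n = 0 for s_n > 0, and the bound is trivial.
  refine ⟨fun n => max 0 (s n / (-Real.log (a n)) - 2), ?_, ?_⟩
  · rw [Metric.tendsto_atTop']
    intro ε hε
    obtain ⟨N, hN⟩ := eventually_atTop.1 ((h (ε / 2) (by positivity)).and
      (hs.eventually_gt_atTop 0))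
    refine ⟨N, fun n hn => ?_⟩
    obtain ⟨h1, h2⟩ := hN n hn.le
    rw [Real.dist_eq, sub_zero, abs_of_nonneg (le_max_left _ _)]
    refine max_lt hε ?_
    rcases (ha n).eq_or_lt with h0 | h0
    · rw [← h0]; simp; linarith
    · have h3 : Real.log (a n) ≤ -(s n) / (2 + ε / 2) := by
        rw [Real.log_le_iff_le_exp h0]; exact h1
      have h4 : s n / (2 + ε / 2) ≤ -Real.log (a n) := by
        rw [neg_div] at h3; linarith
      have h5 : 0 < s n / (2 + ε / 2) := by positivity
      have h6 : s n / (-Real.log (a n)) ≤ 2 + ε / 2 := by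
        rw [div_le_iff₀ (by linarith)]
        rw [div_le_iff₀ (by positivity)] at h4
        linarith
      linarith
  · filter_upwards [h 1 one_pos, hs.eventually_gt_atTop 0] with n h1 h2
    rcases (ha n).eq_or_lt with h0 | h0
    · rw [← h0]; positivity
    have hlog : 0 < -Real.log (a n) := by
      have h3 : Real.log (a n) ≤ -(s n) / (2 + 1) := by
        rw [Real.log_le_iff_le_exp h0]; exact h1
      have : 0 < s n / (2 + 1) := by positivity
      rw [neg_div] at h3
      linarith
    rw [← Real.log_le_iff_le_exp h0, neg_div, le_neg, div_le_iff₀ (by positivity)]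
    have h3 := le_max_right 0 (s n / (-Real.log (a n)) - 2)
    have h4 : s n / (-Real.log (a n)) ≤ 2 + max 0 (s n / (-Real.log (a n)) - 2) := by linarith
    rw [div_le_iff₀ hlog] at h4
    linarith

/-- The inequality is strict so that the gap between the two exponents, times a divergent SNR, can
absorb constant factors. -/
lemma exists_margin {ε : ℝ} (hε : 0 < ε) :
    ∃ δ : ℝ, 0 < δ ∧ δ ≤ 1 / 20 ∧ 1 / (2 + ε) < (1 - δ) ^ 2 / 2 := by
  refine ⟨min (1 / 20) (ε / (8 * (1 + ε))), lt_min (by norm_num) (by positivity), min_le_left _ _, ?_⟩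
  set δ := min (1 / 20) (ε / (8 * (1 + ε)))
  have h1 : δ ≤ ε / (8 * (1 + ε)) := min_le_right _ _
  have h2 : δ * (4 + 2 * ε) < ε := by
    rw [le_div_iff₀ (by positivity)] at h1
    have h3 : 0 < δ := lt_min (by norm_num) (by positivity)
    nlinarith
  rw [div_lt_div_iff₀ (by positivity) (by norm_num)]
  nlinarith [mul_nonneg (sq_nonneg δ) hε.le, sq_nonneg δ]

variable {d : ℕ → ℕ} {μ : (n : ℕ) → EuclideanSpace ℝ (Fin (d n))}
  {Sig : (n : ℕ) → Matrix (Fin (d n)) (Fin (d n)) ℝ}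
  {Ω : ℕ → Type*} [∀ n, MeasurableSpace (Ω n)]
  {P : (n : ℕ) → Measure (Ω n)}
  {x : (n : ℕ) → Fin n → Ω n → EuclideanSpace ℝ (Fin (d n))}
  {y : (n : ℕ) → Fin n → Ω n → ℝ} {yhat : (n : ℕ) → Ω n → Fin n → ℝ}

lemma measurable_eval_noise {n d : ℕ} (i : Fin n) :
    Measurable fun z : Fin n → EuclideanSpace ℝ (Fin d) => z i := measurable_pi_apply i

lemma iIndepFun_noise (n d : ℕ) :
    iIndepFun (fun (i : Fin n) (z : Fin n → EuclideanSpace ℝ (Fin d)) => z i)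
      (Measure.pi fun _ => stdGaussian _) :=
  iIndepFun_pi (X := fun _ v => v) fun _ => aemeasurable_id

lemma hasLaw_noise {n d : ℕ} (i : Fin n) :
    HasLaw (fun z : Fin n → EuclideanSpace ℝ (Fin d) => z i) (stdGaussian _)
      (Measure.pi fun _ => stdGaussian _) :=
  (measurePreserving_eval (fun _ : Fin n => stdGaussian (EuclideanSpace ℝ (Fin d))) i).hasLaw

/-- The risk is at most a constant multiple of `exp (-(1 - δ)² SNR / 2)`. -/
lemma exists_eventually_integral_misclass_le (hSig : ∀ n, (Sig n).PosDef)
    (hd : Tendsto (fun n : ℕ => (n : ℝ) / ((d n : ℝ) ^ 2 * Real.log n ^ 3)) atTop atTop)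
    (hxy : ∀ n, IsMixtureSample (P n) (μ n) (Sig n) (x n) (y n))
    (hout : ∀ᶠ n in atTop, ∀ᵐ ω ∂(P n),
      IsTwoStageOutput (dataMatrix fun i => x n i ω) (yhat n ω))
    {C : ℝ} (hsnr : Tendsto (fun n => snr (μ n) (Sig n)) atTop atTop)
    (hC : ∀ᶠ n : ℕ in atTop, snr (μ n) (Sig n) ≤ C * Real.log n)
    {δ : ℝ} (hδ : 0 < δ) (hδ1 : δ ≤ 1 / 20) :
    ∃ C' : ℝ, 0 < C' ∧ ∀ᶠ n in atTop, ∫ ω, misclass (yhat n ω) (fun i => y n i ω) ∂(P n) ≤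
      C' * Real.exp (-((1 - δ) ^ 2 * snr (μ n) (Sig n) / 2)) := by
  -- Since SNR ≤ C log n, the failure probability e^{-K log n} is at most e^{-SNR/2} in both
  -- regimes.
  set K := |C| + 1 with hK
  have hK1 : 1 ≤ K := by rw [hK]; linarith [abs_nonneg C]
  obtain ⟨C₁, M₁, H₁⟩ := exists_twoStageBound (K := K) hδ (by linarith) (by linarith)
  obtain ⟨C₂, M₂, V, H₂⟩ := exists_twoStageBound_of_le_sq (K := K) hδ hδ1 (by linarith)
  set Cε := 20 * 36864 * (K + 20) / δ ^ 2 with hCε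
  have hCε0 : 0 ≤ Cε := by positivity
  refine ⟨18 + 4 / 3 * Cε, by positivity, ?_⟩
  have hV : ∀ᶠ n : ℕ in atTop, V ≤ Real.exp (Real.log n / 20) :=
    (Real.tendsto_exp_atTop.comp (tendsto_log_natCast_atTop.atTop_div_const
      (by norm_num))).eventually_ge_atTop V
  filter_upwards [hout, hC, hV, eventually_isScale hd C₁, eventually_isScale hd C₂,
    eventually_isScale hd 1, (Real.tendsto_sqrt_atTop.comp hsnr).eventually_ge_atTop (max M₁ M₂),
    hsnr.eventually_gt_atTop 0] with n houtn hCn hVn hs₁ hs₂ hs₃ hM hpos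
  have hs := hs₁.1
  have hn := hs.n_pos
  have hn0 : 0 < n := by exact_mod_cast hn
  have hL := hs.L_ge
  have hdL := hs.one_le_dL
  set s := snr (μ n) (Sig n) with hsdef
  set L := Real.log n with hLdef
  set p := Real.exp (-((1 - δ) ^ 2 * s / 2)) with hp
  have hδ2 : (1 - δ) ^ 2 ≤ 1 := by nlinarith
  have hps : Real.exp (-(s / 2)) ≤ p := by
    rw [hp]; gcongr; nlinarith
  have hsq : √s ^ 2 = s := Real.sq_sqrt hpos.le
  -- Below log n the floor d log n / n ≤ n^{-1/2} is dominated by e^{-s/2}. Above it the uniform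
  -- residual bound of the last step removes the floor.
  rcases le_or_gt s L with hsL | hsL
  · have hpL : Real.exp (-(L / 2)) ≤ p := le_trans (by gcongr) hps
    have h1 := (hxy n).integral_misclass_le hn0 (hSig n) hpos houtn (c₀ := 1 + 4 / 3 * (Cε * (d n * L)))
      (c₁ := 4 / 3) (κ := 15 * Real.exp (-(K * L))) (δ := δ) (by positivity) (by norm_num)
      (by linarith) (fun e he => by
        have h2 := H₁ n (d n) L _ hs hs₁.2 e (√s) he ((le_max_left _ _).trans hM)
          measurable_eval_noise (iIndepFun_noise n (d n)) hasLaw_noise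
        have h3 (z : Fin n → EuclideanSpace ℝ (Fin (d n))) :
            (1 + 4 / 3 * (Cε * (d n * L)) + 4 / 3 * (noiseCount e z ((1 - δ) * √s) : ℝ)) =
              1 + 4 / 3 * (noiseCount e z ((1 - δ) * √s) + Cε * (d n * L)) := by ring
        refine le_trans (measureReal_mono ?_ (measure_ne_top _ _)) h2
        intro z hz hb
        refine hz ?_
        rw [h3]
        exact hb)
    refine h1.trans ?_
    have h2 : Real.exp (-(K * L)) ≤ p := le_trans (by gcongr; nlinarith) hpL
    have h3 : (1 + 4 / 3 * (Cε * (d n * L))) / n ≤ p + 4 / 3 * Cε * p := by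
      have h4 : (n : ℝ) * Real.exp (-(L / 2)) = Real.exp (L / 2) := by
        rw [← hs.exp_L, ← Real.exp_add]; congr 1; ring
      have h5 : d n * L ≤ n * p := by
        refine le_trans ?_ (mul_le_mul_of_nonneg_left hpL hn.le)
        rw [h4]
        apply le_of_sq_le_sq _ (Real.exp_pos _).le
        have h6 : Real.exp (L / 2) ^ 2 = n := by
          rw [← hs.exp_L, ← Real.exp_nat_mul]; congr 1; push_cast; ring
        rw [h6]
        have hq := hs₃.2
        rw [one_mul] at hq
        calc (d n * L : ℝ) ^ 2 = d n ^ 2 * L ^ 2 := by ring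
          _ ≤ d n ^ 2 * L ^ 3 := by gcongr; norm_num
          _ = (d n * L * √(L / n)) ^ 2 * n := hs.sq_q_mul.symm
          _ ≤ 1 ^ 2 * n := by gcongr
          _ = n := by ring
      rw [div_le_iff₀ hn]
      have h6 : Cε * (d n * L) ≤ Cε * (n * p) := by gcongr
      linarith
    have h7 : 0 < p := Real.exp_pos _
    linarith
  · have h1 := (hxy n).integral_misclass_le hn0 (hSig n) hpos houtn (c₀ := 0)
      (c₁ := 1) (κ := 17 * Real.exp (-(K * L))) (δ := δ) le_rfl (by norm_num)
      (by linarith) (fun e he => by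
        have h2 := H₂ n (d n) L _ hs hs₂.2 hVn e (√s) he ((le_max_right _ _).trans hM)
          (by rw [hsq]; exact hsL.le)
          measurable_eval_noise (iIndepFun_noise n (d n)) hasLaw_noise
        simpa only [zero_add, one_mul] using h2)
    refine h1.trans ?_
    have h2 : Real.exp (-(K * L)) ≤ p := by
      refine le_trans ?_ hps
      gcongr
      have : C * L ≤ |C| * L := by gcongr; exact le_abs_self C
      rw [hK]
      nlinarith [abs_nonneg C]
    have h7 : 0 < p := Real.exp_pos _
    have h8 : 0 ≤ 4 / 3 * Cε * p := by positivity
    rw [zero_div, add_zero, one_mul]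
    linarith

lemma eventually_integral_misclass_le (hSig : ∀ n, (Sig n).PosDef)
    (hd : Tendsto (fun n : ℕ => (n : ℝ) / ((d n : ℝ) ^ 2 * Real.log n ^ 3)) atTop atTop)
    (hxy : ∀ n, IsMixtureSample (P n) (μ n) (Sig n) (x n) (y n))
    (hout : ∀ᶠ n in atTop, ∀ᵐ ω ∂(P n),
      IsTwoStageOutput (dataMatrix fun i => x n i ω) (yhat n ω))
    {C : ℝ} (hsnr : Tendsto (fun n => snr (μ n) (Sig n)) atTop atTop)
    (hC : ∀ᶠ n : ℕ in atTop, snr (μ n) (Sig n) ≤ C * Real.log n) {ε : ℝ} (hε : 0 < ε) :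
    ∀ᶠ n in atTop, ∫ ω, misclass (yhat n ω) (fun i => y n i ω) ∂(P n) ≤
      Real.exp (-(snr (μ n) (Sig n)) / (2 + ε)) := by
  obtain ⟨δ, hδ, hδ1, hδε⟩ := exists_margin hε
  obtain ⟨C', hC', H⟩ := exists_eventually_integral_misclass_le hSig hd hxy hout hsnr hC hδ hδ1
  have hg : 0 < (1 - δ) ^ 2 / 2 - 1 / (2 + ε) := by linarith
  filter_upwards [H, (hsnr.const_mul_atTop hg).eventually_ge_atTop (Real.log C')] with n h1 h2
  refine h1.trans ?_
  rw [← Real.exp_log hC', ← Real.exp_add]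
  gcongr
  have h3 : -(snr (μ n) (Sig n)) / (2 + ε) = -(1 / (2 + ε) * snr (μ n) (Sig n)) := by ring
  rw [h3]
  linarith

lemma tendsto_measureReal_misclass_eq_zero [∀ n, IsProbabilityMeasure (P n)]
    (hSig : ∀ n, (Sig n).PosDef)
    (hd : Tendsto (fun n : ℕ => (n : ℝ) / ((d n : ℝ) ^ 2 * Real.log n ^ 3)) atTop atTop)
    (hxy : ∀ n, IsMixtureSample (P n) (μ n) (Sig n) (x n) (y n))
    (hout : ∀ᶠ n in atTop, ∀ᵐ ω ∂(P n),
      IsTwoStageOutput (dataMatrix fun i => x n i ω) (yhat n ω))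
    {ε : ℝ} (hε : 0 < ε)
    (hsnr : ∀ᶠ n : ℕ in atTop, (2 + ε) * Real.log n ≤ snr (μ n) (Sig n)) :
    Tendsto (fun n => (P n).real {ω | misclass (yhat n ω) (fun i => y n i ω) = 0})
      atTop (𝓝 1) := by
  obtain ⟨δ, hδ, hδ1, hδε⟩ := exists_margin hε
  obtain ⟨C, M, V, H⟩ := exists_twoStageBound_of_le_sq (K := 1) hδ hδ1 zero_le_one
  have hV : ∀ᶠ n : ℕ in atTop, V ≤ Real.exp (Real.log n / 20) :=
    (Real.tendsto_exp_atTop.comp (tendsto_log_natCast_atTop.atTop_div_const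
      (by norm_num))).eventually_ge_atTop V
  -- The exponent left after multiplying the Gaussian tail by n: the mean number of atypical indices
  -- is at most n^{-γ}.
  set γ := (1 - δ) ^ 2 / 2 * (2 + ε) - 1 with hγ
  have hγ0 : 0 < γ := by
    rw [div_lt_iff₀ (by positivity)] at hδε
    linarith
  have hlim : Tendsto (fun n : ℕ => 1 - (17 * Real.exp (-Real.log n) +
      Real.exp (-(γ * Real.log n)))) atTop (𝓝 1) := by
    have h1 : Tendsto (fun n : ℕ => Real.exp (-Real.log n)) atTop (𝓝 0) :=
      Real.tendsto_exp_neg_atTop_nhds_zero.comp tendsto_log_natCast_atTop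
    have h2 : Tendsto (fun n : ℕ => Real.exp (-(γ * Real.log n))) atTop (𝓝 0) :=
      Real.tendsto_exp_neg_atTop_nhds_zero.comp (tendsto_log_natCast_atTop.const_mul_atTop hγ0)
    simpa using ((h1.const_mul 17).add h2).const_sub 1
  refine tendsto_of_tendsto_of_tendsto_of_le_of_le' hlim tendsto_const_nhds ?_
    (Eventually.of_forall fun n => measureReal_le_one)
  filter_upwards [hout, hV, hsnr, eventually_isScale hd C,
    tendsto_log_natCast_atTop.eventually_ge_atTop (M ^ 2)] with n houtn hVn hsn hs hLM
  have hn := hs.1.n_pos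
  have hL := hs.1.L_ge
  have hn0 : 0 < n := by exact_mod_cast hn
  set s := snr (μ n) (Sig n) with hsdef
  set L := Real.log n with hLdef
  have hLs : L ≤ s := by nlinarith
  have hpos : 0 < s := by linarith
  have hsq : √s ^ 2 = s := Real.sq_sqrt hpos.le
  have h1 := (hxy n).le_measureReal_misclass_eq_zero hn0 (hSig n) hpos houtn
    (κ := 17 * Real.exp (-(1 * L))) (δ := δ) (by linarith) (fun e he =>
      H n (d n) L _ hs.1 hs.2 hVn e (√s) he (Real.le_sqrt_of_sq_le (hLM.trans hLs))
        (by rw [hsq]; exact hLs) measurable_eval_noise (iIndepFun_noise n (d n)) hasLaw_noise)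
  refine le_trans ?_ h1
  rw [one_mul]
  have h2 : n * Real.exp (-((1 - δ) ^ 2 * s / 2)) ≤ Real.exp (-(γ * L)) := by
    rw [← hs.1.exp_L, ← Real.exp_add]
    gcongr
    have h3 : (1 - δ) ^ 2 / 2 * ((2 + ε) * L) ≤ (1 - δ) ^ 2 / 2 * s := by gcongr
    rw [hγ]
    linarith
  linarith

end Asymptotics

theorem mainTheorem5
    (d : ℕ → ℕ)
    (μ : (n : ℕ) → EuclideanSpace ℝ (Fin (d n)))
    (Sig : (n : ℕ) → Matrix (Fin (d n)) (Fin (d n)) ℝ)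
    (hSig : ∀ n, (Sig n).PosDef)
    (hd : Tendsto (fun n : ℕ => (n : ℝ) / ((d n : ℝ) ^ 2 * Real.log n ^ 3)) atTop atTop)
    {Ω : ℕ → Type*} [∀ n, MeasurableSpace (Ω n)]
    (P : (n : ℕ) → Measure (Ω n)) [∀ n, IsProbabilityMeasure (P n)]
    (x : (n : ℕ) → Fin n → Ω n → EuclideanSpace ℝ (Fin (d n)))
    (y : (n : ℕ) → Fin n → Ω n → ℝ)
    (hxy : ∀ n, IsMixtureSample (P n) (μ n) (Sig n) (x n) (y n))
    (yhat : (n : ℕ) → Ω n → Fin n → ℝ)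
    (hmeas : ∀ n, AEMeasurable (yhat n) (P n))
    (hout : ∀ᶠ n in atTop, ∀ᵐ ω ∂(P n),
      IsTwoStageOutput (dataMatrix fun i => x n i ω) (yhat n ω)) :
    (∀ C : ℝ,
      Tendsto (fun n => snr (μ n) (Sig n)) atTop atTop →
      (∀ᶠ n : ℕ in atTop, snr (μ n) (Sig n) ≤ C * Real.log n) →
      ∃ δ : ℕ → ℝ, Tendsto δ atTop (𝓝 0) ∧
        ∀ᶠ n in atTop,
          ∫ ω, misclass (yhat n ω) (fun i => y n i ω) ∂(P n) ≤
            Real.exp (-(snr (μ n) (Sig n)) / (2 + δ n))) ∧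
    (∀ ε : ℝ, 0 < ε →
      (∀ᶠ n : ℕ in atTop, (2 + ε) * Real.log n ≤ snr (μ n) (Sig n)) →
      Tendsto (fun n => (P n).real {ω | misclass (yhat n ω) (fun i => y n i ω) = 0})
        atTop (𝓝 1)) := by
  refine ⟨fun C hsnr hC => ?_, fun ε hε hsnr => ?_⟩
  · exact exists_rate (fun n => integral_nonneg fun ω => misclass_nonneg _ _) hsnr fun ε hε =>
      eventually_integral_misclass_le hSig hd hxy hout hsnr hC hε
  · exact tendsto_measureReal_misclass_eq_zero hSig hd hxy hout hε hsnr
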